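/- A \emph{paracontact metric three-manifold} $(M,\varphi,\xi,\eta,g)$ is a connected smooth three-manifold $M$ with a $(1,1)$-tensor $\varphi$, a vector field $\xi$, a $1$-form $\eta$ and a pseudo-Riemannian metric $g$ (all smooth) such that $\varphi\xi=0$, $\eta\circ\varphi=0$, $\eta(\xi)=1$, $\varphi^2=\mathrm{Id}-\eta\otimes\xi$, the eigendistributions of $\varphi|_{\ker\eta}$ for the eigenvalues $\pm1$ have equal dimension, $g(\varphi X,\varphi Y)=-g(X,Y)+\eta(X)\eta(Y)$, and $g(X,\varphi Y)=d\eta(X,Y)$, where $2\,d\eta(X,Y)=X(\eta(Y))-Y(\eta(X))-\eta([X,Y])$. It is \emph{homogeneous} if the diffeomorphisms of $M$ preserving $(\varphi,\xi,\eta,g)$ act transitively on $M$. It is a \emph{paracontact Ricci soliton} if $\mathcal L_\xi g+\varrho=\lambda g$ for some real constant $\lambda$, where $\varrho$ is the Ricci tensor of $g$, and it is then called \emph{nontrivial} if $g$ is not Einstein, that is, if $\varrho$ is not a constant multiple of $g$. Two paracontact metric three-manifolds $M$, $N$ being \emph{locally isometric} ($M$ to $N$) means that every point of $M$ has an open neighbourhood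 with a diffeomorphism onto an open subset of $N$ that carries the tensors $\varphi,\xi,\eta,g$ of $M$ to those of $N$. For $a_1\in\mathbb R$, a left-invariant paracontact metric structure $(\varphi,\xi,\eta,g)$ on $SL(2,\mathbb R)$ is said to be \emph{of type $a_1$} if there is a left-invariant vector field $e$ with $\eta(e)=0$, $g(e,e)=1$ and $$[\xi,e]=-a_1e+(2-a_1)\varphi e,\qquad [\xi,\varphi e]=(2+a_1)e+a_1\varphi e,\qquad [e,\varphi e]=-2\xi.$$ \textbf{Theorem.} For every real $a_1\neq0$ there is a left-invariant paracontact metric structure of type $a_1$ on $SL(2,\mathbb R)$. Moreover, a homogeneous paracontact metric three-manifold $(M,\varphi,\xi,\eta,g)$ is a nontrivial paracontact Ricci soliton if and only if, for some real constant $a_1\neq0$, it is locally isometric to $SL(2,\mathbb R)$ equipped with a left-invariant paracontact metric structure of type $a_1$. -/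

import Mathlib

open Set Bundle VectorField
open scoped Manifold ContDiff Topology

noncomputable section

namespace ParacontactGeometry

/-- The model space of three-manifolds. -/
abbrev E3 : Type := EuclideanSpace ℝ (Fin 3)

section Structures

variable (M : Type*) [TopologicalSpace M] [ChartedSpace E3 M] [IsManifold (𝓡 3) ∞ M]

/-- An almost paracontact metric structure `(φ, ξ, η, g)` on a smooth three-manifold. -/
structure AlmostParacontactMetricStructure where
  /-- the `(1,1)`-tensor -/
  φ : Π p : M, TangentSpace (𝓡 3) p →L[ℝ] TangentSpace (𝓡 3) p
  /-- the Reeb vector field -/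
  ξ : Π p : M, TangentSpace (𝓡 3) p
  /-- the `1`-form -/
  η : Π p : M, TangentSpace (𝓡 3) p →L[ℝ] ℝ
  /-- the pseudo-Riemannian metric -/
  g : Π p : M, TangentSpace (𝓡 3) p →L[ℝ] TangentSpace (𝓡 3) p →L[ℝ] ℝ
  φ_smooth : ContMDiff (𝓡 3) ((𝓡 3).prod 𝓘(ℝ, E3 →L[ℝ] E3)) ∞
    (fun p : M ↦ TotalSpace.mk' (E3 →L[ℝ] E3) p (φ p))
  ξ_smooth : ContMDiff (𝓡 3) ((𝓡 3).prod 𝓘(ℝ, E3)) ∞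
    (fun p : M ↦ TotalSpace.mk' E3 p (ξ p))
  η_smooth : ContMDiff (𝓡 3) ((𝓡 3).prod 𝓘(ℝ, E3 →L[ℝ] ℝ)) ∞
    (fun p : M ↦ TotalSpace.mk' (E3 →L[ℝ] ℝ) p (η p))
  g_smooth : ContMDiff (𝓡 3) ((𝓡 3).prod 𝓘(ℝ, E3 →L[ℝ] E3 →L[ℝ] ℝ)) ∞
    (fun p : M ↦ TotalSpace.mk' (E3 →L[ℝ] E3 →L[ℝ] ℝ) p (g p))
  g_symm : ∀ p v w, g p v w = g p w v
  g_nondegenerate : ∀ p v, (∀ w, g p v w = 0) → v = 0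
  φ_ξ : ∀ p, φ p (ξ p) = 0
  η_φ : ∀ p v, η p (φ p v) = 0
  η_ξ : ∀ p, η p (ξ p) = 1
  φ_φ : ∀ p v, φ p (φ p v) = v - η p v • ξ p
  /-- The eigendistributions of `φ` on `ker η` for the eigenvalues `1` and `-1` have the same
  dimension (eigenvectors of `φ` for these eigenvalues lie in `ker η`, because `η ∘ φ = 0`). -/
  finrank_eigenspace : ∀ p,
    Module.finrank ℝ (Module.End.eigenspace (φ p).toLinearMap (1 : ℝ)) =
      Module.finrank ℝ (Module.End.eigenspace (φ p).toLinearMap (-1 : ℝ))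
  /-- The metric is compatible with the almost paracontact structure. -/
  compatible : ∀ p v w, g p (φ p v) (φ p w) = - g p v w + η p v * η p w

/-- A paracontact metric structure: `Φ = dη`, where `Φ(X, Y) = g(X, φ Y)` and
`2 dη(X, Y) = X(η(Y)) - Y(η(X)) - η([X, Y])`. -/
structure ParacontactMetricStructure extends AlmostParacontactMetricStructure M where
  paracontact : ∀ (X Y : Π p : M, TangentSpace (𝓡 3) p) (p : M),
    MDifferentiableAt (𝓡 3) ((𝓡 3).prod 𝓘(ℝ, E3)) (fun q : M ↦ TotalSpace.mk' E3 q (X q)) p →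
    MDifferentiableAt (𝓡 3) ((𝓡 3).prod 𝓘(ℝ, E3)) (fun q : M ↦ TotalSpace.mk' E3 q (Y q)) p →
    g p (X p) (φ p (Y p)) =
      (1 / 2 : ℝ) * (mvfderiv (𝓡 3) (fun q ↦ η q (Y q)) p (X p)
        - mvfderiv (𝓡 3) (fun q ↦ η q (X q)) p (Y p)
        - η p (mlieBracket (𝓡 3) X Y p))

end Structures

section Curvature

variable {M : Type*} [TopologicalSpace M] [ChartedSpace E3 M] [IsManifold (𝓡 3) ∞ M]

/-- Covariant derivatives on the tangent bundle of `M`; `D Y p v` stands for `(∇_v Y)(p)`. -/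
abbrev Connection (M : Type*) [TopologicalSpace M] [ChartedSpace E3 M]
    [IsManifold (𝓡 3) ∞ M] :=
  CovariantDerivative (𝓡 3) E3 (fun p : M ↦ TangentSpace (𝓡 3) p)

/-- `D` is the Levi-Civita connection of the metric `g`: torsion-free and compatible with `g`. -/
structure IsLeviCivita
    (g : Π p : M, TangentSpace (𝓡 3) p →L[ℝ] TangentSpace (𝓡 3) p →L[ℝ] ℝ)
    (D : Connection M) : Prop where
  torsion_eq_zero : D.torsion = 0
  metric : ∀ (X Y : Π p : M, TangentSpace (𝓡 3) p) (p : M) (v : TangentSpace (𝓡 3) p),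
    MDifferentiableAt (𝓡 3) ((𝓡 3).prod 𝓘(ℝ, E3)) (fun q : M ↦ TotalSpace.mk' E3 q (X q)) p →
    MDifferentiableAt (𝓡 3) ((𝓡 3).prod 𝓘(ℝ, E3)) (fun q : M ↦ TotalSpace.mk' E3 q (Y q)) p →
    mvfderiv (𝓡 3) (fun q ↦ g q (X q) (Y q)) p v = g p (D X p v) (Y p) + g p (X p) (D Y p v)

/-- `R(X, Y) Z = ∇_{[X, Y]} Z - (∇_X ∇_Y Z - ∇_Y ∇_X Z)`. -/
def curvature (D : Connection M) (X Y Z : Π p : M, TangentSpace (𝓡 3) p) (p : M) :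
    TangentSpace (𝓡 3) p :=
  D Z p (mlieBracket (𝓡 3) X Y p)
    - (D (fun q ↦ D Z q (Y q)) p (X p) - D (fun q ↦ D Z q (X q)) p (Y p))

/-- The Ricci tensor `ϱ(v, w) = tr (u ↦ R(v, u) w)` at `p`. The curvature is evaluated on the
standard extensions of tangent vectors at `p` to vector fields (smooth near `p`), and the trace is
computed in the standard basis of `T_p M = ℝ³`. -/
def ricci (D : Connection M) (p : M) (v w : TangentSpace (𝓡 3) p) : ℝ :=
  ∑ i : Fin 3,
    (show E3 from curvature D (FiberBundle.extend E3 v)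
      (FiberBundle.extend E3 (show TangentSpace (𝓡 3) p from EuclideanSpace.single i (1 : ℝ)))
      (FiberBundle.extend E3 w) p) i

/-- `(𝓛_X g)(Y, Z) = X(g(Y, Z)) - g([X, Y], Z) - g(Y, [X, Z])`. -/
def lieDerivMetric (g : Π p : M, TangentSpace (𝓡 3) p →L[ℝ] TangentSpace (𝓡 3) p →L[ℝ] ℝ)
    (X Y Z : Π p : M, TangentSpace (𝓡 3) p) (p : M) : ℝ :=
  mvfderiv (𝓡 3) (fun q ↦ g q (Y q) (Z q)) p (X p)
    - g p (mlieBracket (𝓡 3) X Y p) (Z p) - g p (Y p) (mlieBracket (𝓡 3) X Z p)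

/-- The Reeb vector field solves the Ricci soliton equation `𝓛_ξ g + ϱ = c g` for some real
constant `c`, where `ϱ` is the Ricci tensor of the Levi-Civita connection of `g`. -/
def ParacontactMetricStructure.IsRicciSoliton (S : ParacontactMetricStructure M) : Prop :=
  ∃ D : Connection M, IsLeviCivita S.g D ∧ ∃ c : ℝ, ∀ (p : M) (v w : TangentSpace (𝓡 3) p),
    lieDerivMetric S.g S.ξ (FiberBundle.extend E3 v) (FiberBundle.extend E3 w) p
      + ricci D p v w = c * S.g p v w

/-- The metric is Einstein: `ϱ = c g` for some real constant `c`. -/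
def ParacontactMetricStructure.IsEinstein (S : ParacontactMetricStructure M) : Prop :=
  ∃ D : Connection M, IsLeviCivita S.g D ∧ ∃ c : ℝ, ∀ (p : M) (v w : TangentSpace (𝓡 3) p),
    ricci D p v w = c * S.g p v w

/-- A paracontact Ricci soliton is nontrivial if its metric is not Einstein. -/
def ParacontactMetricStructure.IsNontrivialRicciSoliton (S : ParacontactMetricStructure M) :
    Prop :=
  S.IsRicciSoliton ∧ ¬ S.IsEinstein

end Curvature

section Maps

variable {M : Type*} [TopologicalSpace M] [ChartedSpace E3 M] [IsManifold (𝓡 3) ∞ M]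
  {N : Type*} [TopologicalSpace N] [ChartedSpace E3 N] [IsManifold (𝓡 3) ∞ N]

/-- The differential of `f` at `p` carries the structure tensors of `S` at `p` to those of `T`
at `f p`. -/
structure PreservesAt (S : ParacontactMetricStructure M) (T : ParacontactMetricStructure N)
    (f : M → N) (p : M) : Prop where
  map_φ : ∀ v, T.φ (f p) (mfderiv (𝓡 3) (𝓡 3) f p v) = mfderiv (𝓡 3) (𝓡 3) f p (S.φ p v)
  map_ξ : mfderiv (𝓡 3) (𝓡 3) f p (S.ξ p) = T.ξ (f p)
  map_η : ∀ v, T.η (f p) (mfderiv (𝓡 3) (𝓡 3) f p v) = S.η p v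
  map_g : ∀ v w, T.g (f p) (mfderiv (𝓡 3) (𝓡 3) f p v) (mfderiv (𝓡 3) (𝓡 3) f p w) = S.g p v w

/-- The diffeomorphisms preserving the paracontact metric structure act transitively. -/
def ParacontactMetricStructure.IsHomogeneous (S : ParacontactMetricStructure M) : Prop :=
  ∀ p q : M, ∃ f : M ≃ₘ⟮𝓡 3, 𝓡 3⟯ M, f p = q ∧ ∀ x, PreservesAt S S f x

/-- Every point of `M` has an open neighbourhood that is mapped diffeomorphically onto an open
subset of `N`, by a map that carries the structure tensors of `S` to those of `T` (in particular
isometrically). -/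
def ParacontactMetricStructure.IsLocallyIsometricTo (S : ParacontactMetricStructure M)
    (T : ParacontactMetricStructure N) : Prop :=
  ∀ p : M, ∃ f : OpenPartialHomeomorph M N, p ∈ f.source ∧
    ContMDiffOn (𝓡 3) (𝓡 3) ∞ f f.source ∧ ContMDiffOn (𝓡 3) (𝓡 3) ∞ f.symm f.target ∧
    ∀ x ∈ f.source, PreservesAt S T f x

end Maps

section LeftInvariant

variable {G : Type*} [TopologicalSpace G] [ChartedSpace E3 G] [IsManifold (𝓡 3) ∞ G] [Group G]

/-- All left translations preserve the paracontact metric structure. -/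
def ParacontactMetricStructure.IsLeftInvariant (S : ParacontactMetricStructure G) : Prop :=
  ∀ a x : G, PreservesAt S S (fun b ↦ a * b) x

/-- The left-invariant paracontact metric structure `S` admits a left-invariant `φ`-basis
`{ξ, e, φ e}` (with `e` a unit space-like vector in `ker η`) such that
`[ξ, e] = -a₁ e + (2 - a₁) φ e`, `[ξ, φ e] = (2 + a₁) e + a₁ φ e`, `[e, φ e] = -2 ξ`.
The brackets are those of the Lie algebra `T_1 G` of left-invariant vector fields. -/
def ParacontactMetricStructure.HasBrackets (S : ParacontactMetricStructure G) (a₁ : ℝ) : Prop :=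
  S.IsLeftInvariant ∧ ∃ ξ e φe : GroupLieAlgebra (𝓡 3) G,
    ξ = S.ξ 1 ∧ φe = S.φ 1 e ∧ S.η 1 e = 0 ∧ S.g 1 e e = 1 ∧
    ⁅ξ, e⁆ = -a₁ • e + (2 - a₁) • φe ∧
    ⁅ξ, φe⁆ = (2 + a₁) • e + a₁ • φe ∧
    ⁅e, φe⁆ = (-2 : ℝ) • ξ

end LeftInvariant

/-! ### The smooth structure of `SL(2, ℝ)` -/

/-- The group `SL(2, ℝ)`, with the topology induced from the `2 × 2` matrices. -/
abbrev SL2R : Type := Matrix.SpecialLinearGroup (Fin 2) ℝ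

namespace SL2R

/-- The matrix with rows `(x₀, x₁)`, `(x₂, (1 + x₁ x₂) / x₀)`. -/
def ofA (x : E3) (h : x 0 ≠ 0) : SL2R :=
  ⟨!![x 0, x 1; x 2, (1 + x 1 * x 2) / x 0], by
    rw [Matrix.det_fin_two_of]; field_simp; ring⟩

/-- The matrix with rows `(x₁, (x₁ x₂ - 1) / x₀)`, `(x₀, x₂)`. -/
def ofC (x : E3) (h : x 0 ≠ 0) : SL2R :=
  ⟨!![x 1, (x 1 * x 2 - 1) / x 0; x 0, x 2], by
    rw [Matrix.det_fin_two_of]; field_simp; ring⟩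

theorem det_eq (g : SL2R) : g.1 0 0 * g.1 1 1 - g.1 0 1 * g.1 1 0 = 1 := by
  rw [← Matrix.det_fin_two]; exact g.2

theorem continuous_entry (i j : Fin 2) : Continuous (fun g : SL2R ↦ g.1 i j) :=
  continuous_subtype_val.matrix_elem i j

theorem continuousOn_of_entries {f : E3 → SL2R} {s : Set E3}
    (h : ∀ i j, ContinuousOn (fun x ↦ (f x).1 i j) s) : ContinuousOn f s := by
  have hi : Topology.IsInducing (fun g : SL2R ↦ g.1) := ⟨rfl⟩
  rw [hi.continuousOn_iff]
  exact continuousOn_pi.2 fun i ↦ continuousOn_pi.2 fun j ↦ h i j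

theorem isOpen_target : IsOpen {x : E3 | x 0 ≠ 0} :=
  isOpen_ne_fun (by fun_prop) continuous_const

/-- The coordinates `(a, b, c)` on the open set `a ≠ 0` of matrices with rows `(a, b)`, `(c, d)`. -/
def chartA : OpenPartialHomeomorph SL2R E3 where
  toFun g := !₂[g.1 0 0, g.1 0 1, g.1 1 0]
  invFun x := open scoped Classical in if h : x 0 ≠ 0 then ofA x h else 1
  source := {g | g.1 0 0 ≠ 0}
  target := {x | x 0 ≠ 0}
  map_source' g hg := by simpa using hg
  map_target' x hx := by
    have hx : x 0 ≠ 0 := hx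
    rw [dif_pos hx]
    exact hx
  left_inv' g hg := by
    have hg : g.1 0 0 ≠ 0 := hg
    have hd := det_eq g
    ext i j
    fin_cases i <;> fin_cases j <;> simp [hg, ofA]
    field_simp
    linarith
  right_inv' x hx := by
    have hx : x 0 ≠ 0 := hx
    ext i
    fin_cases i <;> simp [hx, ofA]
  open_source := isOpen_ne_fun (continuous_entry 0 0) continuous_const
  open_target := isOpen_target
  continuousOn_toFun := by
    have h00 := continuous_entry 0 0
    have h01 := continuous_entry 0 1
    have h10 := continuous_entry 1 0
    refine Continuous.continuousOn ?_
    refine (PiLp.continuous_toLp 2 _).comp (continuous_pi fun i ↦ ?_)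
    fin_cases i <;> simpa
  continuousOn_invFun := by
    have key : ∀ i j, ContinuousOn
        (fun x : E3 ↦ (!![x 0, x 1; x 2, (1 + x 1 * x 2) / x 0] : Matrix _ _ ℝ) i j)
        {x : E3 | x 0 ≠ 0} := by
      intro i j
      fin_cases i <;> fin_cases j <;> simp
      · fun_prop
      · fun_prop
      · fun_prop
      · exact ContinuousOn.div (by fun_prop) (by fun_prop) fun x hx ↦ hx
    refine continuousOn_of_entries fun i j ↦ (key i j).congr fun x hx ↦ ?_
    have hx : x 0 ≠ 0 := hx
    simp [hx, ofA]

/-- The coordinates `(c, a, d)` on the open set `c ≠ 0` of matrices with rows `(a, b)`, `(c, d)`. -/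
def chartC : OpenPartialHomeomorph SL2R E3 where
  toFun g := !₂[g.1 1 0, g.1 0 0, g.1 1 1]
  invFun x := open scoped Classical in if h : x 0 ≠ 0 then ofC x h else 1
  source := {g | g.1 1 0 ≠ 0}
  target := {x | x 0 ≠ 0}
  map_source' g hg := by simpa using hg
  map_target' x hx := by
    have hx : x 0 ≠ 0 := hx
    rw [dif_pos hx]
    exact hx
  left_inv' g hg := by
    have hg : g.1 1 0 ≠ 0 := hg
    have hd := det_eq g
    ext i j
    fin_cases i <;> fin_cases j <;> simp [hg, ofC]
    field_simp
    linarith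
  right_inv' x hx := by
    have hx : x 0 ≠ 0 := hx
    ext i
    fin_cases i <;> simp [hx, ofC]
  open_source := isOpen_ne_fun (continuous_entry 1 0) continuous_const
  open_target := isOpen_target
  continuousOn_toFun := by
    have h00 := continuous_entry 0 0
    have h01 := continuous_entry 1 1
    have h10 := continuous_entry 1 0
    refine Continuous.continuousOn ?_
    refine (PiLp.continuous_toLp 2 _).comp (continuous_pi fun i ↦ ?_)
    fin_cases i <;> simpa
  continuousOn_invFun := by
    have key : ∀ i j, ContinuousOn
        (fun x : E3 ↦ (!![x 1, (x 1 * x 2 - 1) / x 0; x 0, x 2] : Matrix _ _ ℝ) i j)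
        {x : E3 | x 0 ≠ 0} := by
      intro i j
      fin_cases i <;> fin_cases j <;> simp
      · fun_prop
      · exact ContinuousOn.div (by fun_prop) (by fun_prop) fun x hx ↦ hx
      · fun_prop
      · fun_prop
    refine continuousOn_of_entries fun i j ↦ (key i j).congr fun x hx ↦ ?_
    have hx : x 0 ≠ 0 := hx
    simp [hx, ofC]

instance : ChartedSpace E3 SL2R where
  atlas := {chartA, chartC}
  chartAt g := open scoped Classical in if g.1 0 0 ≠ 0 then chartA else chartC
  mem_chart_source g := by
    by_cases h : g.1 0 0 = 0
    · have hd := det_eq g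
      have hc : g.1 1 0 ≠ 0 := by
        intro hc
        rw [h, hc] at hd
        simp at hd
      rw [if_neg (by simpa using h)]
      exact hc
    · rw [if_pos h]
      exact h
  chart_mem_atlas g := by
    split_ifs <;> simp

theorem contDiffOn_of_coord {f : E3 → E3} {s : Set E3}
    (h : ∀ i, ContDiffOn ℝ ∞ (fun x ↦ f x i) s) : ContDiffOn ℝ ∞ f s :=
  (contDiffOn_piLp 2).2 h

instance : IsManifold (𝓡 3) ∞ SL2R := by
  apply isManifold_of_contDiffOn
  have hdiv : ∀ {f : E3 → ℝ} {s : Set E3}, (∀ x ∈ s, x 0 ≠ 0) → ContDiff ℝ ∞ f →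
      ContDiffOn ℝ ∞ (fun x ↦ f x / x 0) s := fun hs hf ↦
    hf.contDiffOn.div (by fun_prop) hs
  rintro e e' (rfl | rfl) (rfl | rfl)
  · refine contDiffOn_of_coord fun i ↦ ContDiffOn.congr (f := fun x : E3 ↦ x i) (by fun_prop) ?_
    rintro x ⟨⟨hx, -⟩, -⟩
    have hx : x 0 ≠ 0 := hx
    fin_cases i <;> simp [chartA, hx, ofA]
  · refine contDiffOn_of_coord fun i ↦ ContDiffOn.congr
      (f := fun x : E3 ↦ ![x 2, x 0, (1 + x 1 * x 2) / x 0] i) ?_ ?_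
    · fin_cases i <;> simp
      · fun_prop
      · fun_prop
      · refine hdiv ?_ (contDiff_const.add (by fun_prop))
        rintro x ⟨hx, -⟩
        exact hx
    · rintro x ⟨⟨hx, -⟩, -⟩
      have hx : x 0 ≠ 0 := hx
      fin_cases i <;> simp [chartA, chartC, hx, ofA]
  · refine contDiffOn_of_coord fun i ↦ ContDiffOn.congr
      (f := fun x : E3 ↦ ![x 1, (x 1 * x 2 - 1) / x 0, x 0] i) ?_ ?_
    · fin_cases i <;> simp
      · fun_prop
      · refine hdiv ?_ (by fun_prop)
        rintro x ⟨hx, -⟩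
        exact hx
      · fun_prop
    · rintro x ⟨⟨hx, -⟩, -⟩
      have hx : x 0 ≠ 0 := hx
      fin_cases i <;> simp [chartA, chartC, hx, ofC]
  · refine contDiffOn_of_coord fun i ↦ ContDiffOn.congr (f := fun x : E3 ↦ x i) (by fun_prop) ?_
    rintro x ⟨⟨hx, -⟩, -⟩
    have hx : x 0 ≠ 0 := hx
    fin_cases i <;> simp [chartC, hx, ofC]

end SL2R

end ParacontactGeometry

end

/-! Everything is read off a frame `(ξ, E₁, E₂)` in which `E₁`, `E₂` are null eigenvector fields of
`φ` for the eigenvalues `s` and `-s` (`s = ±1`) with `g(E₁, E₂) = 2`; such frames exist near every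
point (`exists_isAdaptedAt`). The contact condition and the `ξ`-component of the Jacobi identity
reduce the brackets to `[ξ, E₁] = P E₁ + α E₂`, `[ξ, E₂] = β E₁ - P E₂`, `[E₁, E₂] = 4s ξ + A E₁ + B
E₂`, and the only components of `𝓛_ξ g` are `-4α` on `(E₁, E₁)` and `-4β` on `(E₂, E₂)`.

Suppose that `M` is homogeneous and a nontrivial soliton. If `β` vanished in all adapted frames,
then so would `α` by exchanging `E₁` and `E₂`, hence `𝓛_ξ g = 0` and `g` would be Einstein. So `β ≠
0` in some frame. The remaining freedom `E₁ ↦ t⁻¹ E₁`, `E₂ ↦ t E₂` multiplies `β` by `t²` and is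
used to make `β = ±1`; this fixes the frame up to a common sign. Automorphisms of the structure then
preserve the frame up to sign, so by homogeneity and continuity `P, α, β, A, B` are all constant
near that point (`exists_hasStructureConstantsAt`). For constant structure functions the Koszul
formula makes the Ricci tensor an explicit polynomial in them, and the soliton equation becomes an
algebraic system whose only solutions with `β ≠ 0` have `s = 1`, `P = 2`, `α = A = B = 0`
(`constants_eq`). These are the structure constants of a basis of `sl(2, ℝ)`.

To pass from equal structure constants to a local isometry, the form `Ω = ∑ θᵏ Xₖ`, built from the
dual coframe and matrices `Xₖ` with the same brackets, satisfies the Maurer-Cartan equation. The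
Frobenius theorem (`exists_hasFDerivAt_of_flat`) solves `df = f Ω`; since `Ω` is trace-free, `f`
takes values in `SL(2, ℝ)`, and it carries the frame to the left-invariant one. Homogeneity spreads
this from one point to all of `M`.

Conversely, a structure of type `a₁` has the adapted frame `ξ, e + φe, e - φe` with the above
constants and `β = -2a₁`. Such frames pull back under local isometries, and in them the soliton
equation holds with constant `-2`, while `ϱ(E₂, E₂) = 4β ≠ 0` on a null vector excludes Einstein
metrics. Existence is an explicit left-invariant construction from the same basis of `sl(2, ℝ)`
(`structureOf`). -/

noncomputable section

namespace ParacontactGeometry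

/-! ### The Frobenius theorem for flat linear systems `df = f Ω`. -/

section Frobenius

variable {E : Type*} [NormedAddCommGroup E] [NormedSpace ℝ E]
  {A : Type*} [NormedRing A] [NormedAlgebra ℝ A]

/-- First-order expansion of a `C²` map with a uniform quadratic remainder. -/
theorem exists_bounds_of_contDiffAt {F : Type*} [NormedAddCommGroup F] [NormedSpace ℝ F]
    {Ω : E → F} {x₀ : E} (hΩ : ContDiffAt ℝ 2 Ω x₀) :
    ∃ C : ℝ, 0 < C ∧ ∃ R > 0, (∀ x ∈ Metric.ball x₀ R, DifferentiableAt ℝ Ω x ∧ ‖Ω x‖ ≤ C ∧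
      ‖fderiv ℝ Ω x‖ ≤ C) ∧ ∀ x ∈ Metric.ball x₀ R, ∀ y ∈ Metric.ball x₀ R,
        ‖Ω y - Ω x - fderiv ℝ Ω x (y - x)‖ ≤ C * ‖y - x‖ ^ 2 := by
  have hd : ContDiffAt ℝ 1 (fderiv ℝ Ω) x₀ := hΩ.fderiv_right (by norm_num)
  obtain ⟨K, t, ht, hK⟩ := hd.exists_lipschitzOnWith
  have h1 : ∀ᶠ x in 𝓝 x₀, ContDiffAt ℝ 2 Ω x := hΩ.eventually (by simp)
  have h2 : ∀ᶠ x in 𝓝 x₀, ‖Ω x‖ < ‖Ω x₀‖ + 1 :=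
    hΩ.continuousAt.norm.eventually (gt_mem_nhds (by simp))
  have h3 : ∀ᶠ x in 𝓝 x₀, ‖fderiv ℝ Ω x‖ < ‖fderiv ℝ Ω x₀‖ + 1 :=
    hd.continuousAt.norm.eventually (gt_mem_nhds (by simp))
  obtain ⟨R, hR, hball⟩ := Metric.eventually_nhds_iff_ball.1
    (h1.and (h2.and (h3.and (Filter.eventually_of_mem ht fun x hx ↦ hx))))
  have hn1 := norm_nonneg (Ω x₀)
  have hn2 := norm_nonneg (fderiv ℝ Ω x₀)
  have hn3 : (0 : ℝ) ≤ K := K.2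
  refine ⟨‖Ω x₀‖ + ‖fderiv ℝ Ω x₀‖ + K + 1, by positivity, R, hR, fun x hx ↦ ?_,
    fun x hx y hy ↦ ?_⟩
  · obtain ⟨a, b, c, -⟩ := hball x hx
    exact ⟨a.differentiableAt (by simp), by linarith, by linarith⟩
  -- Mean value inequality for `Ω` minus its linearisation at `x`, whose derivative on the segment
  -- is at most `K ‖y - x‖`.
  · have key : ‖Ω y - Ω x - fderiv ℝ Ω x (y - x)‖ ≤ (K * ‖y - x‖) * ‖y - x‖ := by
      refine (convex_segment x y).norm_image_sub_le_of_norm_hasFDerivWithin_le'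
        (f' := fun z ↦ fderiv ℝ Ω z) (fun z hz ↦ ?_) (fun z hz ↦ ?_)
        (left_mem_segment ℝ x y) (right_mem_segment ℝ x y)
      · have hz' := (convex_ball x₀ R).segment_subset hx hy hz
        exact ((hball z hz').1.differentiableAt (by simp)).hasFDerivAt.hasFDerivWithinAt
      · have hz' := (convex_ball x₀ R).segment_subset hx hy hz
        have := hK.norm_sub_le (hball z hz').2.2.2 (hball x hx).2.2.2
        refine this.trans ?_
        have hzx : ‖z - x‖ ≤ ‖y - x‖ := by
          obtain ⟨θ, hθ, rfl⟩ := (segment_eq_image' ℝ x y ▸ hz :)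
          simp only [add_sub_cancel_left, norm_smul, Real.norm_eq_abs, abs_of_nonneg hθ.1]
          exact mul_le_of_le_one_left (norm_nonneg _) hθ.2
        gcongr
    refine key.trans ?_
    rw [mul_assoc, ← sq]
    gcongr
    linarith

/-- The solutions of a linear differential equation along the rays through the origin. -/
theorem exists_radial_solution [CompleteSpace A] {Ω : E → E →L[ℝ] A} {C r : ℝ}
    (hr : C * r ≤ 1 / 2) (hC : 0 < C)
    (hc : ∀ x ∈ Metric.ball (0 : E) r, DifferentiableAt ℝ Ω x ∧ ‖Ω x‖ ≤ C)
    (w₀ : A) {x : E} (hx : x ∈ Metric.ball (0 : E) r) :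
    ∃ u : ℝ → A, u 0 = w₀ ∧
      ∀ t ∈ Icc (0 : ℝ) 1, HasDerivWithinAt u (u t * Ω (t • x) x) (Icc 0 1) t := by
  have hxr : ‖x‖ < r := by simpa using hx
  have hmem : ∀ t ∈ Icc (0 : ℝ) 1, t • x ∈ Metric.ball (0 : E) r := by
    intro t ht
    rw [mem_ball_zero_iff, norm_smul, Real.norm_eq_abs, abs_of_nonneg ht.1]
    exact (mul_le_of_le_one_left (norm_nonneg _) ht.2).trans_lt hxr
  have hop : ∀ t ∈ Icc (0 : ℝ) 1, ‖Ω (t • x) x‖ ≤ 1 / 2 := by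
    intro t ht
    calc ‖Ω (t • x) x‖ ≤ ‖Ω (t • x)‖ * ‖x‖ := ContinuousLinearMap.le_opNorm _ _
      _ ≤ C * r := by gcongr; exact (hc _ (hmem t ht)).2
      _ ≤ 1 / 2 := hr
  -- On the ball of radius `‖w₀‖` about `w₀` one has `‖w‖ ≤ 2 ‖w₀‖`, so the speed is at most `‖w₀‖`
  -- and the solution stays in the ball up to time `1`. Smallness of `C r` thus replaces any gluing
  -- of short-time solutions.
  have hpl : IsPicardLindelof (fun t w ↦ w * Ω (t • x) x) (tmin := 0) (tmax := 1)
      ⟨0, by simp⟩ w₀ ‖w₀‖₊ 0 ‖w₀‖₊ (1 / 2) := by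
    refine ⟨fun t ht ↦ LipschitzWith.lipschitzOnWith ?_, fun w _ ↦ ?_, fun t ht w hw ↦ ?_, ?_⟩
    · refine LipschitzWith.of_dist_le_mul fun a b ↦ ?_
      rw [dist_eq_norm, dist_eq_norm, ← sub_mul, mul_comm]
      refine (norm_mul_le _ _).trans ?_
      gcongr
      simpa using hop t ht
    · intro t ht
      have h1 : ContinuousAt (fun t : ℝ ↦ Ω (t • x)) t :=
        ContinuousAt.comp (f := fun t : ℝ ↦ t • x) (hc _ (hmem t ht)).1.continuousAt
          (by fun_prop)
      exact (continuousAt_const.mul (h1.clm_apply continuousAt_const)).continuousWithinAt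
    · have hw' : ‖w‖ ≤ ‖w₀‖ + ‖w₀‖ := by
        have : dist w w₀ ≤ ‖w₀‖ := by simpa using hw
        rw [dist_eq_norm] at this
        linarith [norm_le_norm_add_norm_sub' w w₀]
      calc ‖w * Ω (t • x) x‖ ≤ ‖w‖ * ‖Ω (t • x) x‖ := norm_mul_le _ _
        _ ≤ (‖w₀‖ + ‖w₀‖) * (1 / 2) := by gcongr; exact hop t ht
        _ = ‖w₀‖₊ := by simp; ring
    · simp
  exact hpl.exists_eq_forall_mem_Icc_hasDerivWithinAt₀

/-- Comparison of two neighbouring radial solutions of a flat linear system. -/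
theorem radial_defect_bound {Ω : E → E →L[ℝ] A} {C R : ℝ} (hC : 0 < C)
    (h1 : ∀ x ∈ Metric.ball (0 : E) R, DifferentiableAt ℝ Ω x ∧ ‖Ω x‖ ≤ C ∧ ‖fderiv ℝ Ω x‖ ≤ C)
    (h2 : ∀ x ∈ Metric.ball (0 : E) R, ∀ y ∈ Metric.ball (0 : E) R,
        ‖Ω y - Ω x - fderiv ℝ Ω x (y - x)‖ ≤ C * ‖y - x‖ ^ 2)
    {x h : E} {t B : ℝ} (ht : t ∈ Icc (0 : ℝ) 1) (hx : t • x ∈ Metric.ball (0 : E) R)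
    (hxh : t • (x + h) ∈ Metric.ball (0 : E) R) (hx1 : ‖x‖ ≤ 1) (hxh1 : ‖x + h‖ ≤ 1)
    (hh1 : ‖h‖ ≤ 1) {U : A} (hU : ‖U‖ ≤ B)
    (flat : fderiv ℝ Ω (t • x) x h + Ω (t • x) x * Ω (t • x) h =
      fderiv ℝ Ω (t • x) h x + Ω (t • x) h * Ω (t • x) x) :
    ‖(U * Ω (t • x) x + (U * Ω (t • x) h +
        t • (U * Ω (t • x) x * Ω (t • x) h + U * fderiv ℝ Ω (t • x) x h))) -
      (U + t • (U * Ω (t • x) h)) * Ω (t • (x + h)) (x + h)‖ ≤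
      (4 * C ^ 2 * B + 2 * C * B) * ‖h‖ ^ 2 := by
  have hB : 0 ≤ B := (norm_nonneg _).trans hU
  obtain ⟨ht0, ht1⟩ := ht
  obtain ⟨-, hW, hD⟩ := h1 _ hx
  have h3 := h2 _ hx _ hxh
  generalize Ω (t • x) = W at *
  generalize fderiv ℝ Ω (t • x) = D at *
  generalize Ω (t • (x + h)) = W' at *
  have hρ : ‖W' - W - t • D h‖ ≤ C * ‖h‖ ^ 2 := by
    rw [show t • (x + h) - t • x = t • h by module, map_smul, norm_smul, mul_pow] at h3
    refine h3.trans ?_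
    gcongr
    refine mul_le_of_le_one_left (by positivity) ?_
    rw [Real.norm_eq_abs, abs_of_nonneg ht0]
    exact pow_le_one₀ ht0 ht1
  obtain ⟨ρ, hρdef⟩ : ∃ ρ, ρ = W' - W - t • D h := ⟨_, rfl⟩
  rw [← hρdef] at hρ
  have hW'e : W' = W + t • D h + ρ := by rw [hρdef]; abel
  have flat' : U * W x * W h + U * D x h = U * D h x + U * W h * W x := by
    rw [mul_assoc, mul_assoc, ← mul_add, ← mul_add, ← flat, add_comm]
  -- Flatness exchanges the roles of `x` and `h` in the terms of first order in `h`, which then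
  -- cancel; each remaining term contains `h` twice or the Taylor remainder `ρ`.
  have e : (U * W x + (U * W h + t • (U * W x * W h + U * D x h))) -
      (U + t • (U * W h)) * W' (x + h) =
      -(t • (U * W h * W h) + (t ^ 2) • (U * W h * D h x) + t • ((U + t • (U * W h)) * D h h) +
        (U + t • (U * W h)) * ρ (x + h)) := by
    rw [flat', hW'e]
    simp only [map_add, add_apply, smul_apply, mul_add, add_mul, smul_mul_assoc, mul_smul_comm,
      smul_add]
    module
  have hn := norm_nonneg h
  have nWh : ‖W h‖ ≤ C * ‖h‖ := (W.le_opNorm h).trans (by gcongr)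
  have nDh : ‖D h‖ ≤ C * ‖h‖ := (D.le_opNorm h).trans (by gcongr)
  have nW : ‖U * W h‖ ≤ B * (C * ‖h‖) := (norm_mul_le _ _).trans (by gcongr)
  have nW1 : ‖U * W h‖ ≤ B * C := nW.trans (by
    calc B * (C * ‖h‖) ≤ B * (C * 1) := by gcongr
      _ = B * C := by ring)
  have nY : ‖U + t • (U * W h)‖ ≤ B + B * C := by
    refine (norm_add_le _ _).trans (add_le_add hU ?_)
    rw [norm_smul, Real.norm_eq_abs, abs_of_nonneg ht0]
    exact (mul_le_of_le_one_left (norm_nonneg _) ht1).trans nW1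
  have b1 : ‖t • (U * W h * W h)‖ ≤ C ^ 2 * B * ‖h‖ ^ 2 := by
    rw [norm_smul, Real.norm_eq_abs, abs_of_nonneg ht0]
    refine (mul_le_of_le_one_left (norm_nonneg _) ht1).trans ?_
    calc ‖U * W h * W h‖ ≤ ‖U * W h‖ * ‖W h‖ := norm_mul_le _ _
      _ ≤ (B * (C * ‖h‖)) * (C * ‖h‖) := by gcongr
      _ = _ := by ring
  have b2 : ‖(t ^ 2) • (U * W h * D h x)‖ ≤ C ^ 2 * B * ‖h‖ ^ 2 := by
    rw [norm_smul, Real.norm_eq_abs, abs_of_nonneg (sq_nonneg t)]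
    refine (mul_le_of_le_one_left (norm_nonneg _) (pow_le_one₀ ht0 ht1)).trans ?_
    calc ‖U * W h * D h x‖ ≤ ‖U * W h‖ * ‖D h x‖ := norm_mul_le _ _
      _ ≤ (B * (C * ‖h‖)) * ((C * ‖h‖) * 1) := by
        gcongr
        exact ((D h).le_opNorm x).trans (by gcongr)
      _ = _ := by ring
  have b3 : ‖t • ((U + t • (U * W h)) * D h h)‖ ≤ C * (B + B * C) * ‖h‖ ^ 2 := by
    rw [norm_smul, Real.norm_eq_abs, abs_of_nonneg ht0]
    refine (mul_le_of_le_one_left (norm_nonneg _) ht1).trans ?_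
    calc ‖(U + t • (U * W h)) * D h h‖ ≤ ‖U + t • (U * W h)‖ * ‖D h h‖ := norm_mul_le _ _
      _ ≤ (B + B * C) * ((C * ‖h‖) * ‖h‖) := by
        gcongr
        exact ((D h).le_opNorm h).trans (by gcongr)
      _ = _ := by ring
  have b4 : ‖(U + t • (U * W h)) * ρ (x + h)‖ ≤ C * (B + B * C) * ‖h‖ ^ 2 := by
    calc ‖(U + t • (U * W h)) * ρ (x + h)‖ ≤ ‖U + t • (U * W h)‖ * ‖ρ (x + h)‖ := norm_mul_le _ _
      _ ≤ (B + B * C) * ((C * ‖h‖ ^ 2) * 1) := by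
        gcongr
        exact (ρ.le_opNorm _).trans (by gcongr)
      _ = _ := by ring
  rw [e, norm_neg]
  calc _ ≤ C ^ 2 * B * ‖h‖ ^ 2 + C ^ 2 * B * ‖h‖ ^ 2 + C * (B + B * C) * ‖h‖ ^ 2 +
        C * (B + B * C) * ‖h‖ ^ 2 := by
        refine (norm_add_le _ _).trans (add_le_add ((norm_add_le _ _).trans
          (add_le_add ((norm_add_le _ _).trans (add_le_add b1 b2)) b3)) b4)
    _ = _ := by ring

/-- **Frobenius theorem** for linear total differential equations `df = f Ω` with `Ω` flat,
near the origin. -/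
theorem exists_hasFDerivAt_of_flat_zero [CompleteSpace A] {Ω : E → E →L[ℝ] A}
    (hΩ : ContDiffAt ℝ 2 Ω 0)
    (flat : ∀ᶠ x in 𝓝 (0 : E), ∀ u v, fderiv ℝ Ω x u v + Ω x u * Ω x v =
      fderiv ℝ Ω x v u + Ω x v * Ω x u) :
    ∃ r > 0, ∀ w₀ : A, ∃ f : E → A, f 0 = w₀ ∧
      ∀ x ∈ Metric.ball 0 r, HasFDerivAt f ((ContinuousLinearMap.mul ℝ A (f x)).comp (Ω x)) x := by
  obtain ⟨C, hC, R, hR, h1, h2⟩ := exists_bounds_of_contDiffAt hΩ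
  obtain ⟨R', hR', hflat⟩ := Metric.eventually_nhds_iff_ball.1 flat
  -- The bound `1 / 2` makes the difference of two points of the ball have norm at most `1`; the
  -- bound `1 / (2 * C)` gives `C r ≤ 1 / 2` for the radial solutions.
  set r : ℝ := min (min R R') (min (1 / 2) (1 / (2 * C))) with hrdef
  have hr0 : 0 < r := by positivity
  have hrR : r ≤ R := (min_le_left _ _).trans (min_le_left _ _)
  have hrR' : r ≤ R' := (min_le_left _ _).trans (min_le_right _ _)
  have hr1 : r ≤ 1 / 2 := (min_le_right _ _).trans (min_le_left _ _)
  have hrC : C * r ≤ 1 / 2 := by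
    calc C * r ≤ C * (1 / (2 * C)) := by
          gcongr; exact (min_le_right _ _).trans (min_le_right _ _)
      _ = 1 / 2 := by field_simp
  refine ⟨r, hr0, fun w₀ ↦ ?_⟩
  have hsol := fun x (hx : x ∈ Metric.ball (0 : E) r) ↦ exists_radial_solution hrC hC
    (fun x hx ↦ ⟨(h1 x (Metric.ball_subset_ball hrR hx)).1,
      (h1 x (Metric.ball_subset_ball hrR hx)).2.1⟩) w₀ hx
  classical
  choose! u hu0 hu using hsol
  have hmem : ∀ x ∈ Metric.ball (0 : E) r, ∀ t ∈ Icc (0 : ℝ) 1, t • x ∈ Metric.ball (0 : E) r := by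
    intro x hx t ht
    rw [mem_ball_zero_iff] at hx ⊢
    rw [norm_smul, Real.norm_eq_abs, abs_of_nonneg ht.1]
    exact (mul_le_of_le_one_left (norm_nonneg _) ht.2).trans_lt hx
  have toIci : ∀ (g : ℝ → A) (g' : A) (t : ℝ), t ∈ Ico (0 : ℝ) 1 →
      HasDerivWithinAt g g' (Icc 0 1) t → HasDerivWithinAt g g' (Ici t) t :=
    fun g g' t ht hg ↦ hg.mono_of_mem_nhdsWithin (Icc_mem_nhdsGE_of_mem ht)
  refine ⟨fun x ↦ u x 1, ?_, fun x hx ↦ ?_⟩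
  · have h0 : (0 : E) ∈ Metric.ball (0 : E) r := by simpa using hr0
    -- On the degenerate ray `x = 0` the equation reads `u' = 0`.
    have : ∀ t ∈ Icc (0 : ℝ) 1, u 0 t - w₀ = 0 := by
      refine eq_zero_of_abs_deriv_le_mul_abs_self_of_eq_zero_right (K := 0) (f' := fun _ ↦ 0)
        ?_ ?_ ?_ ?_
      · exact fun t ht ↦ ((hu 0 h0 t ht).continuousWithinAt).sub continuousWithinAt_const
      · intro t ht
        have := (toIci _ _ t ht (hu 0 h0 t (Ico_subset_Icc_self ht))).sub_const w₀
        simpa using this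
      · rw [hu0 0 h0, sub_self]
      · simp
    exact sub_eq_zero.1 (this 1 (by simp))
  have hxr : ‖x‖ < r := by simpa using hx
  obtain ⟨B, hB⟩ : ∃ B, ∀ t ∈ Icc (0 : ℝ) 1, ‖u x t‖ ≤ B :=
    isCompact_Icc.exists_bound_of_continuousOn fun t ht ↦ (hu x hx t ht).continuousWithinAt
  -- The curve `u x t + t • (u x t * Ω (t • x) h)` is the first-order guess for `u (x + h) t`. By
  -- flatness it solves the equation of the neighbouring ray up to `O(‖h‖²)`, and Grönwall on `[0,
  -- 1]` with Lipschitz constant `1 / 2` turns this defect into the factor `2 * (exp (1 / 2) - 1)`.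
  -- At `t = 1` the estimate is differentiability of the endpoint map.
  have key : ∀ h : E, x + h ∈ Metric.ball (0 : E) r →
      ‖u (x + h) 1 - u x 1 - u x 1 * Ω x h‖ ≤
        ((4 * C ^ 2 * B + 2 * C * B) * (2 * (Real.exp (1 / 2) - 1))) * ‖h‖ ^ 2 := by
    intro h hxh
    have hxhr : ‖x + h‖ < r := by simpa using hxh
    have hh1 : ‖h‖ ≤ 1 := by
      calc ‖h‖ = ‖(x + h) - x‖ := by simp
        _ ≤ ‖x + h‖ + ‖x‖ := norm_sub_le _ _
        _ ≤ 1 := by linarith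
    have hder : ∀ t ∈ Icc (0 : ℝ) 1, HasDerivWithinAt (fun t ↦ u x t + t • (u x t * Ω (t • x) h))
        (u x t * Ω (t • x) x + (u x t * Ω (t • x) h +
          t • (u x t * Ω (t • x) x * Ω (t • x) h + u x t * fderiv ℝ Ω (t • x) x h)))
        (Icc 0 1) t := by
      intro t ht
      have hd : HasDerivWithinAt (fun t : ℝ ↦ Ω (t • x)) (fderiv ℝ Ω (t • x) x) (Icc 0 1) t := by
        have a : HasDerivAt (fun t : ℝ ↦ t • x) x t := by
          simpa using (hasDerivAt_id t).smul_const x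
        exact ((h1 _ (Metric.ball_subset_ball hrR (hmem x hx t ht))).1.hasFDerivAt.comp_hasDerivAt
          t a).hasDerivWithinAt
      have hd1 : HasDerivWithinAt (fun t : ℝ ↦ Ω (t • x) h) (fderiv ℝ Ω (t • x) x h)
          (Icc 0 1) t := by
        simpa using hd.clm_apply (hasDerivWithinAt_const t _ h)
      have hd2 := (hu x hx t ht).mul hd1
      have := (hu x hx t ht).add ((hasDerivWithinAt_id t _).smul hd2)
      refine this.congr_deriv ?_
      simp only [id, one_smul]
      abel
    have := dist_le_of_approx_trajectories_ODE_of_mem (a := 0) (b := 1) (K := 1 / 2)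
      (v := fun t w ↦ w * Ω (t • (x + h)) (x + h)) (s := fun _ ↦ univ)
      (f := fun t ↦ u x t + t • (u x t * Ω (t • x) h)) (g := fun t ↦ u (x + h) t)
      (f' := fun t ↦ u x t * Ω (t • x) x + (u x t * Ω (t • x) h +
          t • (u x t * Ω (t • x) x * Ω (t • x) h + u x t * fderiv ℝ Ω (t • x) x h)))
      (g' := fun t ↦ u (x + h) t * Ω (t • (x + h)) (x + h))
      (εf := (4 * C ^ 2 * B + 2 * C * B) * ‖h‖ ^ 2) (εg := 0) (δ := 0)
      ?_ ?_ ?_ ?_ (by simp) ?_ ?_ (by simp) (by simp) ?_ 1 (by simp)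
    · have e1 : gronwallBound 0 ((1 / 2 : NNReal) : ℝ) ((4 * C ^ 2 * B + 2 * C * B) * ‖h‖ ^ 2 + 0)
          (1 - 0) = (4 * C ^ 2 * B + 2 * C * B) * (2 * (Real.exp (1 / 2) - 1)) * ‖h‖ ^ 2 := by
        rw [show ((1 / 2 : NNReal) : ℝ) = 1 / 2 by norm_num,
          gronwallBound_of_K_ne_0 (by norm_num)]
        simp
        ring
      rw [e1, dist_comm, dist_eq_norm] at this
      simpa [sub_add_eq_sub_sub] using this
    · intro t ht
      refine LipschitzWith.lipschitzOnWith (LipschitzWith.of_dist_le_mul fun a b ↦ ?_)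
      rw [dist_eq_norm, dist_eq_norm, ← sub_mul, mul_comm]
      refine (norm_mul_le _ _).trans ?_
      gcongr
      have hm := hmem _ hxh t (Ico_subset_Icc_self ht)
      calc ‖Ω (t • (x + h)) (x + h)‖ ≤ ‖Ω (t • (x + h))‖ * ‖x + h‖ :=
            ContinuousLinearMap.le_opNorm _ _
        _ ≤ C * r := by gcongr; exact (h1 _ (Metric.ball_subset_ball hrR hm)).2.1
        _ ≤ ((1 / 2 : NNReal) : ℝ) := by simpa using hrC
    · exact fun t ht ↦ (hder t ht).continuousWithinAt
    · exact fun t ht ↦ toIci _ _ t ht (hder t (Ico_subset_Icc_self ht))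
    · intro t ht
      have ht' := Ico_subset_Icc_self ht
      rw [dist_eq_norm]
      exact radial_defect_bound hC h1 h2 ht' (Metric.ball_subset_ball hrR (hmem x hx t ht'))
        (Metric.ball_subset_ball hrR (hmem _ hxh t ht')) (by linarith) (by linarith) hh1
        (hB t ht') (hflat _ (Metric.ball_subset_ball hrR' (hmem x hx t ht')) _ _)
    · exact fun t ht ↦ (hu _ hxh t ht).continuousWithinAt
    · exact fun t ht ↦ toIci _ _ t ht (hu _ hxh t (Ico_subset_Icc_self ht))
    · simp [hu0 _ hxh, hu0 _ hx]
  rw [hasFDerivAt_iff_isLittleO_nhds_zero]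
  refine Asymptotics.IsBigO.trans_isLittleO
    (g := fun h : E ↦ ‖h‖ ^ 2) (Asymptotics.IsBigO.of_bound
      ((4 * C ^ 2 * B + 2 * C * B) * (2 * (Real.exp (1 / 2) - 1))) ?_) ?_
  · have hev : ∀ᶠ h in 𝓝 (0 : E), x + h ∈ Metric.ball (0 : E) r := by
      have : ContinuousAt (fun h : E ↦ x + h) 0 := by fun_prop
      exact this.eventually_mem (Metric.isOpen_ball.mem_nhds (by simpa using hx))
    filter_upwards [hev] with h hh
    simpa using key h hh
  · exact Asymptotics.isLittleO_norm_pow_id one_lt_two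

/-- **Frobenius theorem** for linear total differential equations `df = f Ω` with `Ω` flat. -/
theorem exists_hasFDerivAt_of_flat [CompleteSpace A] {Ω : E → E →L[ℝ] A} {x₀ : E}
    (hΩ : ContDiffAt ℝ 2 Ω x₀)
    (flat : ∀ᶠ x in 𝓝 x₀, ∀ u v, fderiv ℝ Ω x u v + Ω x u * Ω x v =
      fderiv ℝ Ω x v u + Ω x v * Ω x u) :
    ∃ r > 0, ∀ w₀ : A, ∃ f : E → A, f x₀ = w₀ ∧
      ∀ x ∈ Metric.ball x₀ r,
        HasFDerivAt f ((ContinuousLinearMap.mul ℝ A (f x)).comp (Ω x)) x := by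
  have hadd : ContinuousAt (fun x : E ↦ x + x₀) 0 := by fun_prop
  have hΩ' : ContDiffAt ℝ 2 (fun x ↦ Ω (x + x₀)) 0 := by
    refine ContDiffAt.comp (g := Ω) (f := fun x ↦ x + x₀) 0 (by simpa using hΩ) (by fun_prop)
  obtain ⟨r, hr, H⟩ := exists_hasFDerivAt_of_flat_zero hΩ' (by
    have := hadd.eventually (by simpa using flat)
    filter_upwards [this] with x hx u v
    rw [fderiv_comp_add_right]
    exact hx u v)
  refine ⟨r, hr, fun w₀ ↦ ?_⟩
  obtain ⟨f, hf0, hf⟩ := H w₀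
  refine ⟨fun x ↦ f (x - x₀), by simpa using hf0, fun x hx ↦ ?_⟩
  have := hf (x - x₀) (by simpa [dist_eq_norm] using hx)
  have h2 := HasFDerivAt.comp x this ((hasFDerivAt_id x).sub_const x₀)
  simpa [Function.comp_def] using h2

/-- Solutions of `df = f Ω` with `Ω` smooth are smooth. -/
theorem contDiffOn_of_hasFDerivAt_mul {Ω : E → E →L[ℝ] A} {f : E → A} {s : Set E} (hs : IsOpen s)
    (hΩ : ContDiffOn ℝ ∞ Ω s)
    (hf : ∀ x ∈ s, HasFDerivAt f ((ContinuousLinearMap.mul ℝ A (f x)).comp (Ω x)) x) :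
    ContDiffOn ℝ ∞ f s := by
  rw [contDiffOn_infty]
  intro n
  induction n with
  | zero => exact contDiffOn_zero.2 fun x hx ↦ (hf x hx).continuousAt.continuousWithinAt
  | succ n ih =>
    rw [Nat.cast_succ, contDiffOn_succ_iff_fderiv_of_isOpen hs]
    refine ⟨fun x hx ↦ (hf x hx).differentiableAt.differentiableWithinAt, by simp, ?_⟩
    have h1 : ContDiffOn ℝ n (fun x ↦ (ContinuousLinearMap.mul ℝ A (f x)).comp (Ω x)) s :=
      ((ContinuousLinearMap.mul ℝ A).contDiff.comp_contDiffOn ih).clm_comp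
        (hΩ.of_le (by exact_mod_cast le_top))
    exact h1.congr fun x hx ↦ (hf x hx).fderiv

end Frobenius

/-! ### Calculus of smooth vector fields and functions near a point. -/

section VectorFields

set_option linter.unusedSectionVars false

variable {M : Type*} [TopologicalSpace M] [ChartedSpace E3 M] [IsManifold (𝓡 3) ∞ M]

instance isManifold_minSmoothness_two : IsManifold (𝓡 3) (minSmoothness ℝ 2) M := by
  rw [minSmoothness_of_isRCLikeNormedField]
  infer_instance

instance isManifold_minSmoothness_three : IsManifold (𝓡 3) (minSmoothness ℝ 3) M := by
  rw [minSmoothness_of_isRCLikeNormedField]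
  infer_instance

/-- The vector field `X` is smooth near `p`. -/
def SmoothVFAt (X : Π p : M, TangentSpace (𝓡 3) p) (p : M) : Prop :=
  ∀ᶠ q in 𝓝 p, ContMDiffAt (𝓡 3) ((𝓡 3).prod 𝓘(ℝ, E3)) ∞
    (fun q : M ↦ TotalSpace.mk' E3 q (X q)) q

/-- The function `f` is smooth near `p`. -/
def SmoothFnAt (f : M → ℝ) (p : M) : Prop :=
  ∀ᶠ q in 𝓝 p, ContMDiffAt (𝓡 3) 𝓘(ℝ, ℝ) ∞ f q

variable {X Y Z : Π p : M, TangentSpace (𝓡 3) p} {f h : M → ℝ} {p : M}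

theorem SmoothVFAt.contMDiffAt (hX : SmoothVFAt X p) : ContMDiffAt (𝓡 3)
    ((𝓡 3).prod 𝓘(ℝ, E3)) ∞ (fun q : M ↦ TotalSpace.mk' E3 q (X q)) p := hX.self_of_nhds

/-- Being `C^∞` at a point only gives, for each finite `n`, a neighbourhood where the field is
`C^n`. Building a common neighbourhood into `SmoothVFAt` is what makes this passage to nearby points
possible. -/
theorem SmoothVFAt.eventually (hX : SmoothVFAt X p) : ∀ᶠ q in 𝓝 p, SmoothVFAt X q :=
  eventually_eventually_nhds.2 hX

theorem SmoothVFAt.mdiffAt (hX : SmoothVFAt X p) : MDifferentiableAt (𝓡 3)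
    ((𝓡 3).prod 𝓘(ℝ, E3)) (fun q : M ↦ TotalSpace.mk' E3 q (X q)) p :=
  hX.contMDiffAt.mdifferentiableAt (by simp)

theorem SmoothFnAt.contMDiffAt (hf : SmoothFnAt f p) : ContMDiffAt (𝓡 3) 𝓘(ℝ, ℝ) ∞ f p :=
  hf.self_of_nhds

theorem SmoothFnAt.mdiffAt (hf : SmoothFnAt f p) : MDifferentiableAt (𝓡 3) 𝓘(ℝ, ℝ) f p :=
  hf.contMDiffAt.mdifferentiableAt (by simp)

theorem SmoothFnAt.eventually (hf : SmoothFnAt f p) : ∀ᶠ q in 𝓝 p, SmoothFnAt f q :=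
  eventually_eventually_nhds.2 hf

theorem SmoothVFAt.congr (hX : SmoothVFAt X p) (h : ∀ᶠ q in 𝓝 p, Y q = X q) : SmoothVFAt Y p := by
  filter_upwards [hX, eventually_eventually_nhds.2 h] with q hq hq'
  exact hq.congr_of_eventuallyEq (hq'.mono fun x hx ↦ by simp [hx])

theorem SmoothFnAt.congr (hf : SmoothFnAt f p) (e : ∀ᶠ q in 𝓝 p, h q = f q) : SmoothFnAt h p := by
  filter_upwards [hf, eventually_eventually_nhds.2 e] with q hq hq'
  exact hq.congr_of_eventuallyEq hq'

theorem SmoothVFAt.add (hX : SmoothVFAt X p) (hY : SmoothVFAt Y p) : SmoothVFAt (X + Y) p := by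
  filter_upwards [hX, hY] with q h1 h2 using h1.add_section h2

theorem SmoothVFAt.smul (hf : SmoothFnAt f p) (hX : SmoothVFAt X p) : SmoothVFAt (f • X) p := by
  filter_upwards [hf, hX] with q h1 h2 using h1.smul_section h2

theorem SmoothFnAt.const (c : ℝ) : SmoothFnAt (fun _ : M ↦ c) p :=
  Filter.Eventually.of_forall fun _ ↦ contMDiffAt_const

theorem SmoothFnAt.add (hf : SmoothFnAt f p) (hh : SmoothFnAt h p) :
    SmoothFnAt (fun q ↦ f q + h q) p := by
  filter_upwards [hf, hh] with q h1 h2 using h1.add h2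

theorem SmoothFnAt.mul (hf : SmoothFnAt f p) (hh : SmoothFnAt h p) :
    SmoothFnAt (fun q ↦ f q * h q) p := by
  filter_upwards [hf, hh] with q h1 h2 using h1.mul h2

theorem SmoothFnAt.comp_contDiffAt {F : ℝ → ℝ}
    (hF' : ∀ᶠ y in 𝓝 (f p), ContDiffAt ℝ ∞ F y) (hf : SmoothFnAt f p) :
    SmoothFnAt (fun q ↦ F (f q)) p := by
  filter_upwards [hf, hf.contMDiffAt.continuousAt.eventually hF'] with q h1 h2
  exact h2.contMDiffAt.comp q h1

theorem SmoothVFAt.mlieBracket (hX : SmoothVFAt X p) (hY : SmoothVFAt Y p) :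
    SmoothVFAt (mlieBracket (𝓡 3) X Y) p := by
  have : IsManifold (𝓡 3) (((⊤ : ℕ∞) : WithTop ℕ∞) + 1) M := by
    simpa using (inferInstance : IsManifold (𝓡 3) ∞ M)
  filter_upwards [hX, hY] with q h1 h2
  exact ContMDiffAt.mlieBracket_vectorField (m := ⊤) (n := ⊤) h1 h2 (by simp)

theorem contMDiffAt_mvfderiv_apply (hf : ContMDiffAt (𝓡 3) 𝓘(ℝ, ℝ) ∞ f p)
    (hX : ContMDiffAt (𝓡 3) ((𝓡 3).prod 𝓘(ℝ, E3)) ∞ (fun q : M ↦ TotalSpace.mk' E3 q (X q)) p) :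
    ContMDiffAt (𝓡 3) 𝓘(ℝ, ℝ) ∞ (fun q ↦ mvfderiv (𝓡 3) f q (X q)) p := by
  have h1 := hf.mfderiv_const (m := ∞) (by simp)
  have h2 := ContMDiffAt.clm_apply_of_inCoordinates (E₁ := fun q : M ↦ TangentSpace (𝓡 3) q)
    (E₂ := fun q : ℝ ↦ TangentSpace 𝓘(ℝ, ℝ) q) (b₁ := id) (b₂ := f) (F₁ := E3) (F₂ := ℝ) h1 hX hf
  exact (contMDiff_snd_tangentBundle_modelSpace ℝ 𝓘(ℝ, ℝ)).contMDiffAt.comp p h2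

theorem SmoothFnAt.mvfderiv (hf : SmoothFnAt f p) (hX : SmoothVFAt X p) :
    SmoothFnAt (fun q ↦ mvfderiv (𝓡 3) f q (X q)) p := by
  filter_upwards [hf, hX] with q h1 h2 using contMDiffAt_mvfderiv_apply h1 h2

theorem smoothVFAt_extend (v : TangentSpace (𝓡 3) p) : SmoothVFAt (FiberBundle.extend E3 v) p := by
  obtain ⟨s, hs, h⟩ := FiberBundle.exists_contMDiffOn_extend (I := 𝓡 3) (k := ∞) E3 v
  filter_upwards [eventually_mem_nhds_iff.2 hs] with q hq
  exact h.contMDiffAt hq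

theorem mvfderiv_congr (e : ∀ᶠ q in 𝓝 p, f q = h q) :
    mvfderiv (𝓡 3) f p = mvfderiv (𝓡 3) h p := by
  have e' : f =ᶠ[𝓝 p] h := e
  ext v
  simp only [mvfderiv, e'.mfderiv_eq]
  rfl

theorem mvfderiv_of_const {c : ℝ} (e : ∀ᶠ q in 𝓝 p, f q = c) : mvfderiv (𝓡 3) f p = 0 := by
  rw [mvfderiv_congr e, mvfderiv_const]

theorem mlieBracket_congr {X' Y' : Π p : M, TangentSpace (𝓡 3) p} (hX : ∀ᶠ q in 𝓝 p, X q = X' q)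
    (hY : ∀ᶠ q in 𝓝 p, Y q = Y' q) : mlieBracket (𝓡 3) X Y p = mlieBracket (𝓡 3) X' Y' p :=
  Filter.EventuallyEq.mlieBracket_vectorField_eq hX hY

/-- The Lie bracket acts on functions as the commutator of derivations. -/
theorem mvfderiv_mlieBracket (hf : SmoothFnAt f p) (hX : SmoothVFAt X p) (hY : SmoothVFAt Y p) :
    mvfderiv (𝓡 3) f p (mlieBracket (𝓡 3) X Y p) =
      mvfderiv (𝓡 3) (fun q ↦ mvfderiv (𝓡 3) f q (Y q)) p (X p) -
      mvfderiv (𝓡 3) (fun q ↦ mvfderiv (𝓡 3) f q (X q)) p (Y p) := by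
  have hloc : ∀ {X Z : Π p : M, TangentSpace (𝓡 3) p}, SmoothVFAt X p → SmoothVFAt Z p →
      ∀ᶠ q in 𝓝 p, mlieBracket (𝓡 3) X (f • Z) q =
        ((fun q ↦ mvfderiv (𝓡 3) f q (X q)) • Z + f • mlieBracket (𝓡 3) X Z) q := by
    intro X Z hX hZ
    filter_upwards [hf.eventually, hZ.eventually] with q h1 h2
    exact mlieBracket_smul_right h1.mdiffAt h2.mdiffAt
  obtain ⟨v, hv⟩ : ∃ v : TangentSpace (𝓡 3) p, v ≠ 0 :=
    ⟨(EuclideanSpace.single 0 1 : E3), fun h0 ↦ by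
      have h1 : (EuclideanSpace.single 0 1 : E3) 0 = (0 : E3) 0 := congrArg (fun w : E3 ↦ w 0) h0
      simp at h1⟩
  set Z := FiberBundle.extend E3 v with hZdef
  have hZ : SmoothVFAt Z p := smoothVFAt_extend v
  have hfZ := SmoothVFAt.smul hf hZ
  have second : ∀ {X Y : Π p : M, TangentSpace (𝓡 3) p}, SmoothVFAt X p → SmoothVFAt Y p →
      mlieBracket (𝓡 3) X (mlieBracket (𝓡 3) Y (f • Z)) p =
        mvfderiv (𝓡 3) (fun q ↦ mvfderiv (𝓡 3) f q (Y q)) p (X p) • Z p +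
        mvfderiv (𝓡 3) f p (Y p) • mlieBracket (𝓡 3) X Z p +
        (mvfderiv (𝓡 3) f p (X p) • mlieBracket (𝓡 3) Y Z p +
          f p • mlieBracket (𝓡 3) X (mlieBracket (𝓡 3) Y Z) p) := by
    intro X Y hX hY
    rw [mlieBracket_congr (Filter.Eventually.of_forall fun _ ↦ rfl) (hloc hY hZ),
      mlieBracket_add_right (SmoothVFAt.smul (hf.mvfderiv hY) hZ).mdiffAt
        (SmoothVFAt.smul hf (hY.mlieBracket hZ)).mdiffAt,
      mlieBracket_smul_right (hf.mvfderiv hY).mdiffAt hZ.mdiffAt,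
      mlieBracket_smul_right hf.mdiffAt (hY.mlieBracket hZ).mdiffAt]
  have toC2 : ∀ {X : Π p : M, TangentSpace (𝓡 3) p}, SmoothVFAt X p →
      ContMDiffAt (𝓡 3) ((𝓡 3).prod 𝓘(ℝ, E3)) (minSmoothness ℝ 2)
        (fun q : M ↦ TotalSpace.mk' E3 q (X q)) p := by
    intro X hX
    refine hX.contMDiffAt.of_le ?_
    rw [minSmoothness_of_isRCLikeNormedField]
    exact WithTop.coe_le_coe.2 le_top
  -- The Jacobi identity for `X, Y, fZ` is compared with `f` times that for `X, Y, Z`. After the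
  -- Leibniz rule all terms with brackets of `Z` cancel, leaving `([X, Y]f - X(Yf) + Y(Xf)) Z = 0`
  -- at `p`, where `Z` does not vanish.
  have J := leibniz_identity_mlieBracket_apply (toC2 hX) (toC2 hY) (toC2 hfZ)
  have J' := leibniz_identity_mlieBracket_apply (toC2 hX) (toC2 hY) (toC2 hZ)
  rw [second hX hY, second hY hX, mlieBracket_smul_right hf.mdiffAt hZ.mdiffAt, J'] at J
  have hZp : Z p ≠ 0 := by simpa [hZdef] using hv
  have : (mvfderiv (𝓡 3) f p (mlieBracket (𝓡 3) X Y p) -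
      (mvfderiv (𝓡 3) (fun q ↦ mvfderiv (𝓡 3) f q (Y q)) p (X p) -
      mvfderiv (𝓡 3) (fun q ↦ mvfderiv (𝓡 3) f q (X q)) p (Y p))) • Z p = 0 := by
    rw [sub_smul, sub_smul, sub_eq_zero, ← sub_eq_zero]
    rw [← sub_eq_zero] at J
    rw [← neg_eq_zero, ← J]
    module
  exact sub_eq_zero.1 ((smul_eq_zero.1 this).resolve_right hZp)

end VectorFields

/-! ### Local frames, dual coframes and Christoffel symbols. -/

section Frames

set_option linter.unusedSectionVars false

variable {M : Type*} [TopologicalSpace M] [ChartedSpace E3 M] [IsManifold (𝓡 3) ∞ M]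

/-- `e` is a smooth local frame near `p` and `θ` is the dual coframe. -/
structure IsFrameAt (e : Fin 3 → Π q : M, TangentSpace (𝓡 3) q)
    (θ : Fin 3 → Π q : M, TangentSpace (𝓡 3) q →L[ℝ] ℝ) (p : M) : Prop where
  smooth : ∀ i, SmoothVFAt (e i) p
  mdiff_coeff : ∀ᶠ q in 𝓝 p, ∀ i, ∀ X : Π q : M, TangentSpace (𝓡 3) q,
    MDifferentiableAt (𝓡 3) ((𝓡 3).prod 𝓘(ℝ, E3)) (fun q : M ↦ TotalSpace.mk' E3 q (X q)) q →
    MDifferentiableAt (𝓡 3) 𝓘(ℝ, ℝ) (fun q ↦ θ i q (X q)) q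
  smooth_coeff : ∀ᶠ q in 𝓝 p, ∀ i, ∀ X : Π q : M, TangentSpace (𝓡 3) q,
    SmoothVFAt X q → SmoothFnAt (fun q ↦ θ i q (X q)) q
  dual : ∀ᶠ q in 𝓝 p, ∀ i j, θ i q (e j q) = if i = j then 1 else 0

variable {e : Fin 3 → Π q : M, TangentSpace (𝓡 3) q}
  {θ : Fin 3 → Π q : M, TangentSpace (𝓡 3) q →L[ℝ] ℝ} {p : M}
  {X Y Z : Π q : M, TangentSpace (𝓡 3) q}

theorem IsFrameAt.eventually (h : IsFrameAt e θ p) : ∀ᶠ q in 𝓝 p, IsFrameAt e θ q := by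
  filter_upwards [Filter.eventually_all.2 fun i ↦ (h.smooth i).eventually,
    eventually_eventually_nhds.2 h.mdiff_coeff, eventually_eventually_nhds.2 h.smooth_coeff,
    eventually_eventually_nhds.2 h.dual] with q h1 h2 h3 h4
  exact ⟨h1, h2, h3, h4⟩

/-- A family of three vectors with a dual family of functionals is a basis. -/
theorem eq_sum_of_dual {V : Type*} [AddCommGroup V] [Module ℝ V] (hV : Module.finrank ℝ V = 3)
    {e : Fin 3 → V} {θ : Fin 3 → V →ₗ[ℝ] ℝ} (h : ∀ i j, θ i (e j) = if i = j then 1 else 0)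
    (v : V) : v = ∑ i, θ i v • e i := by
  have hli : LinearIndependent ℝ e := by
    rw [Fintype.linearIndependent_iff]
    intro a ha i
    have := congrArg (θ i) ha
    simpa [h] using this
  have : FiniteDimensional ℝ V := Module.finite_of_finrank_pos (by omega)
  let b := basisOfLinearIndependentOfCardEqFinrank hli (by simp [hV])
  have hb : ∀ i, b i = e i := fun i ↦ by simp [b]
  conv_lhs => rw [← b.sum_repr v]
  refine Finset.sum_congr rfl fun i _ ↦ ?_
  rw [hb]
  congr 1
  conv_rhs => rw [← b.sum_repr v]
  simp [hb, h]

theorem IsFrameAt.eq_sum (h : IsFrameAt e θ p) (v : TangentSpace (𝓡 3) p) :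
    v = ∑ i, θ i p v • e i p :=
  eq_sum_of_dual (V := TangentSpace (𝓡 3) p) (e := fun i ↦ e i p) (θ := fun i ↦ (θ i p).toLinearMap)
    (finrank_euclideanSpace_fin (𝕜 := ℝ) (n := 3)) h.dual.self_of_nhds v

theorem IsFrameAt.mdiffAt_coeff (h : IsFrameAt e θ p) (i : Fin 3)
    (hX : MDifferentiableAt (𝓡 3) ((𝓡 3).prod 𝓘(ℝ, E3)) (fun q : M ↦ TotalSpace.mk' E3 q (X q)) p) :
    MDifferentiableAt (𝓡 3) 𝓘(ℝ, ℝ) (fun q ↦ θ i q (X q)) p :=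
  h.mdiff_coeff.self_of_nhds i X hX

theorem IsFrameAt.smoothFnAt_coeff (h : IsFrameAt e θ p) (i : Fin 3) (hX : SmoothVFAt X p) :
    SmoothFnAt (fun q ↦ θ i q (X q)) p := h.smooth_coeff.self_of_nhds i X hX

/-- A tensorial operation is determined by its values on a frame. -/
theorem IsFrameAt.tensorial_eq_sum (h : IsFrameAt e θ p) {A : Type*} [AddCommGroup A] [Module ℝ A]
    {Φ : (Π q : M, TangentSpace (𝓡 3) q) → A} (hΦ : TensorialAt (𝓡 3) E3 Φ p)
    (hX : MDifferentiableAt (𝓡 3) ((𝓡 3).prod 𝓘(ℝ, E3)) (fun q : M ↦ TotalSpace.mk' E3 q (X q)) p) :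
    Φ X = ∑ i, θ i p (X p) • Φ (e i) := by
  have hi : ∀ i, MDifferentiableAt (𝓡 3) ((𝓡 3).prod 𝓘(ℝ, E3))
      (fun q : M ↦ TotalSpace.mk' E3 q (((fun _ : M ↦ θ i p (X p)) • e i) q)) p := fun i ↦
    (mdifferentiableAt_const (c := θ i p (X p))).smul_section (h.smooth i).mdiffAt
  -- A tensorial operation sees only the value at `p`, so `X` may be replaced by the combination of
  -- the frame fields with coefficients frozen at `p`.
  rw [hΦ.pointwise (σ' := fun q ↦ ∑ i, ((fun _ : M ↦ θ i p (X p)) • e i) q) hX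
    (MDifferentiableAt.sum_section fun i _ ↦ hi i) (by simpa using h.eq_sum (X p)),
    hΦ.sum (fun i ↦ (fun _ : M ↦ θ i p (X p)) • e i) fun i _ ↦ hi i]
  exact Finset.sum_congr rfl fun i _ ↦
    hΦ.smul (f := fun _ ↦ θ i p (X p)) mdifferentiableAt_const (h.smooth i).mdiffAt

theorem IsFrameAt.dual_apply (h : IsFrameAt e θ p) (i j : Fin 3) :
    θ i p (e j p) = if i = j then 1 else 0 := h.dual.self_of_nhds i j

theorem IsFrameAt.coeff_sum (h : IsFrameAt e θ p) (a : Fin 3 → ℝ) (k : Fin 3) :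
    θ k p (∑ i, a i • e i p) = a k := by
  simp [h.dual_apply]

theorem IsFrameAt.mvfderiv_dual (h : IsFrameAt e θ p) (i j : Fin 3) :
    mvfderiv (𝓡 3) (fun q ↦ θ i q (e j q)) p = 0 :=
  mvfderiv_of_const (h.dual.mono fun _ hq ↦ hq i j)

/-- The Christoffel symbols of `D` in the frame `e` are the constants `Γ` near `p`. -/
def HasChristoffelAt (D : Connection M) (e : Fin 3 → Π q : M, TangentSpace (𝓡 3) q)
    (Γ : Fin 3 → Fin 3 → Fin 3 → ℝ) (p : M) : Prop :=
  ∀ᶠ q in 𝓝 p, ∀ i j, D (e j) q (e i q) = ∑ k, Γ i j k • e k q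

/-- The structure functions of the frame `e` are the constants `c` near `p`. -/
def HasStructureConstantsAt (e : Fin 3 → Π q : M, TangentSpace (𝓡 3) q)
    (c : Fin 3 → Fin 3 → Fin 3 → ℝ) (p : M) : Prop :=
  ∀ᶠ q in 𝓝 p, ∀ i j, mlieBracket (𝓡 3) (e i) (e j) q = ∑ k, c i j k • e k q

/-- The Gram matrix of the frame `e` is the constant matrix `G` near `p`. -/
def HasGramAt (g : Π p : M, TangentSpace (𝓡 3) p →L[ℝ] TangentSpace (𝓡 3) p →L[ℝ] ℝ)
    (e : Fin 3 → Π q : M, TangentSpace (𝓡 3) q) (G : Fin 3 → Fin 3 → ℝ) (p : M) : Prop :=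
  ∀ᶠ q in 𝓝 p, ∀ i j, g q (e i q) (e j q) = G i j

variable {D : Connection M} {Γ c : Fin 3 → Fin 3 → Fin 3 → ℝ} {G : Fin 3 → Fin 3 → ℝ}
  {g : Π p : M, TangentSpace (𝓡 3) p →L[ℝ] TangentSpace (𝓡 3) p →L[ℝ] ℝ}

theorem mvfderiv_mul_apply {f h : M → ℝ} (hf : MDifferentiableAt (𝓡 3) 𝓘(ℝ, ℝ) f p)
    (hh : MDifferentiableAt (𝓡 3) 𝓘(ℝ, ℝ) h p) (v : TangentSpace (𝓡 3) p) :
    mvfderiv (𝓡 3) (fun q ↦ f q * h q) p v =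
      f p * mvfderiv (𝓡 3) h p v + h p * mvfderiv (𝓡 3) f p v := by
  rw [mvfderiv_fun_mul hf hh]
  simp

theorem mvfderiv_add_apply {f h : M → ℝ} (hf : MDifferentiableAt (𝓡 3) 𝓘(ℝ, ℝ) f p)
    (hh : MDifferentiableAt (𝓡 3) 𝓘(ℝ, ℝ) h p) (v : TangentSpace (𝓡 3) p) :
    mvfderiv (𝓡 3) (fun q ↦ f q + h q) p v =
      mvfderiv (𝓡 3) f p v + mvfderiv (𝓡 3) h p v := by
  rw [mvfderiv_fun_add hf hh]
  simp

/-- A connection in terms of its Christoffel symbols. -/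
theorem IsFrameAt.coeff_connection (h : IsFrameAt e θ p) (hΓ : HasChristoffelAt D e Γ p)
    (hZ : MDifferentiableAt (𝓡 3) ((𝓡 3).prod 𝓘(ℝ, E3)) (fun q : M ↦ TotalSpace.mk' E3 q (Z q)) p)
    (v : TangentSpace (𝓡 3) p) (k : Fin 3) :
    θ k p (D Z p v) = mvfderiv (𝓡 3) (fun q ↦ θ k q (Z q)) p v
      + ∑ i, ∑ j, θ i p v * θ j p (Z p) * Γ i j k := by
  -- The derivative of the `k`-th component absorbs the Leibniz term of the connection, so the
  -- difference is tensorial in `Z` and can be evaluated on the frame.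
  have hΦ : TensorialAt (𝓡 3) E3 (fun Z : Π q : M, TangentSpace (𝓡 3) q ↦
      θ k p (D Z p v) - mvfderiv (𝓡 3) (fun q ↦ θ k q (Z q)) p v) p := by
    constructor
    · intro f σ hf hσ
      have h1 := D.isCovariantDerivativeOnUniv.leibniz hσ hf
      have h2 := mvfderiv_mul_apply hf (h.mdiffAt_coeff k hσ) v
      simp only [Pi.smul_apply', map_smul, smul_eq_mul, h2]
      rw [h1]
      simp
      ring
    · intro σ σ' hσ hσ'
      have h1 := D.isCovariantDerivativeOnUniv.add hσ hσ'
      have h2 := mvfderiv_add_apply (h.mdiffAt_coeff k hσ) (h.mdiffAt_coeff k hσ') v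
      simp only [Pi.add_apply, map_add, h2]
      rw [h1]
      simp
      ring
  have h3 := h.tensorial_eq_sum hΦ hZ
  rw [sub_eq_iff_eq_add'] at h3
  rw [h3, Finset.sum_comm]
  congr 1
  refine Finset.sum_congr rfl fun j _ ↦ ?_
  rw [h.mvfderiv_dual k j]
  conv_lhs => rw [h.eq_sum v]
  simp only [map_sum, map_smul, hΓ.self_of_nhds]
  simp [h.dual_apply, Finset.mul_sum]
  refine Finset.sum_congr rfl fun i _ ↦ ?_
  ring

end Frames

/-! ### Curvature and Ricci tensor in a frame with constant coefficients. -/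

section FrameCurvature

set_option linter.unusedSectionVars false

variable {M : Type*} [TopologicalSpace M] [ChartedSpace E3 M] [IsManifold (𝓡 3) ∞ M]
  {e : Fin 3 → Π q : M, TangentSpace (𝓡 3) q}
  {θ : Fin 3 → Π q : M, TangentSpace (𝓡 3) q →L[ℝ] ℝ} {p : M}
  {X Y Z : Π q : M, TangentSpace (𝓡 3) q}
  {D : Connection M} {Γ c : Fin 3 → Fin 3 → Fin 3 → ℝ} {G : Fin 3 → Fin 3 → ℝ}
  {g : Π p : M, TangentSpace (𝓡 3) p →L[ℝ] TangentSpace (𝓡 3) p →L[ℝ] ℝ}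

theorem SmoothFnAt.sum {ι : Type*} {s : Finset ι} {f : ι → M → ℝ} (h : ∀ i ∈ s, SmoothFnAt (f i) p) :
    SmoothFnAt (fun q ↦ ∑ i ∈ s, f i q) p := by
  classical
  induction s using Finset.induction_on with
  | empty => simpa using SmoothFnAt.const 0
  | insert a s ha ih =>
    simp only [Finset.sum_insert ha]
    exact (h a (by simp)).add (ih fun i hi ↦ h i (by simp [hi]))

theorem SmoothVFAt.sum_smul {f : Fin 3 → M → ℝ} (h : IsFrameAt e θ p) (hf : ∀ i, SmoothFnAt (f i) p) :
    SmoothVFAt (fun q ↦ ∑ i, f i q • e i q) p := by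
  have := ((SmoothVFAt.smul (hf 0) (h.smooth 0)).add (SmoothVFAt.smul (hf 1) (h.smooth 1))).add
    (SmoothVFAt.smul (hf 2) (h.smooth 2))
  exact this.congr (Filter.Eventually.of_forall fun q ↦ by simp [Fin.sum_univ_three])

theorem HasChristoffelAt.eventually (h : HasChristoffelAt D e Γ p) :
    ∀ᶠ q in 𝓝 p, HasChristoffelAt D e Γ q := eventually_eventually_nhds.2 h

theorem HasStructureConstantsAt.eventually (h : HasStructureConstantsAt e c p) :
    ∀ᶠ q in 𝓝 p, HasStructureConstantsAt e c q := eventually_eventually_nhds.2 h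

theorem HasGramAt.eventually (h : HasGramAt g e G p) :
    ∀ᶠ q in 𝓝 p, HasGramAt g e G q := eventually_eventually_nhds.2 h

theorem IsFrameAt.coeff_connection_frame (h : IsFrameAt e θ p) (hΓ : HasChristoffelAt D e Γ p)
    (hZ : MDifferentiableAt (𝓡 3) ((𝓡 3).prod 𝓘(ℝ, E3)) (fun q : M ↦ TotalSpace.mk' E3 q (Z q)) p)
    (i k : Fin 3) :
    θ k p (D Z p (e i p)) = mvfderiv (𝓡 3) (fun q ↦ θ k q (Z q)) p (e i p)
      + ∑ j, θ j p (Z p) * Γ i j k := by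
  rw [h.coeff_connection hΓ hZ]
  simp [h.dual_apply]

/-- A `Connection` carries no smoothness axiom; here smoothness comes from the explicit formula,
because the Christoffel symbols are constant. -/
theorem IsFrameAt.smoothVFAt_connection_frame (h : IsFrameAt e θ p)
    (hΓ : HasChristoffelAt D e Γ p) (hZ : SmoothVFAt Z p) (i : Fin 3) :
    SmoothVFAt (fun q ↦ D Z q (e i q)) p := by
  refine (SmoothVFAt.sum_smul (f := fun k q ↦ mvfderiv (𝓡 3) (fun q ↦ θ k q (Z q)) q (e i q)
      + ∑ j, θ j q (Z q) * Γ i j k) h fun k ↦ ?_).congr ?_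
  · exact ((h.smoothFnAt_coeff k hZ).mvfderiv (h.smooth i)).add
      (SmoothFnAt.sum fun j _ ↦ (h.smoothFnAt_coeff j hZ).mul (SmoothFnAt.const _))
  · filter_upwards [h.eventually, hΓ.eventually, hZ.eventually] with q h1 h2 h3
    rw [h1.eq_sum (D Z q (e i q))]
    simp only [h1.coeff_connection_frame h2 h3.mdiffAt]

/-- Tensoriality of the curvature in its first two arguments is tested on fields that are merely
differentiable, so this regularity is the one needed to apply `D` a second time. -/
theorem IsFrameAt.mdiffAt_connection (h : IsFrameAt e θ p)
    (hΓ : HasChristoffelAt D e Γ p) (hZ : SmoothVFAt Z p)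
    (hX : MDifferentiableAt (𝓡 3) ((𝓡 3).prod 𝓘(ℝ, E3)) (fun q : M ↦ TotalSpace.mk' E3 q (X q)) p) :
    MDifferentiableAt (𝓡 3) ((𝓡 3).prod 𝓘(ℝ, E3))
      (fun q : M ↦ TotalSpace.mk' E3 q (D Z q (X q))) p := by
  have : MDifferentiableAt (𝓡 3) ((𝓡 3).prod 𝓘(ℝ, E3)) (fun q : M ↦ TotalSpace.mk' E3 q
      (∑ i, ((fun q ↦ θ i q (X q)) • fun q ↦ D Z q (e i q)) q)) p :=
    MDifferentiableAt.sum_section fun i _ ↦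
      (h.mdiffAt_coeff i hX).smul_section (h.smoothVFAt_connection_frame hΓ hZ i).mdiffAt
  refine this.congr_of_eventuallyEq ?_
  filter_upwards [h.eventually] with q hq
  congr 1
  conv_lhs => rw [hq.eq_sum (X q)]
  simp

/-- The components of the curvature tensor in a frame with structure constants `c` and
Christoffel symbols `Γ`. -/
def curvatureCoeff (c Γ : Fin 3 → Fin 3 → Fin 3 → ℝ) (i j l k : Fin 3) : ℝ :=
  ∑ m, (c i j m * Γ m l k - (Γ j l m * Γ i m k - Γ i l m * Γ j m k))

/-- The second derivatives of the components of `Z` cancel against the derivative along `[eᵢ, eⱼ]`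
by `mvfderiv_mlieBracket`, and the terms with first derivatives are symmetric in `i, j`. Only the
constant-coefficient part survives. -/
theorem IsFrameAt.coeff_curvature_frame (h : IsFrameAt e θ p) (hc : HasStructureConstantsAt e c p)
    (hΓ : HasChristoffelAt D e Γ p) (hZ : SmoothVFAt Z p) (i j k : Fin 3) :
    θ k p (curvature D (e i) (e j) Z p) = ∑ l, θ l p (Z p) * curvatureCoeff c Γ i j l k := by
  have second : ∀ i j, θ k p (D (fun q ↦ D Z q (e j q)) p (e i p)) =
      mvfderiv (𝓡 3) (fun q ↦ mvfderiv (𝓡 3) (fun q ↦ θ k q (Z q)) q (e j q)) p (e i p)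
      + ∑ l, mvfderiv (𝓡 3) (fun q ↦ θ l q (Z q)) p (e i p) * Γ j l k
      + ∑ m, (mvfderiv (𝓡 3) (fun q ↦ θ m q (Z q)) p (e j p) + ∑ l, θ l p (Z p) * Γ j l m)
        * Γ i m k := by
    intro i j
    have hW := h.smoothVFAt_connection_frame hΓ hZ j
    rw [h.coeff_connection_frame hΓ hW.mdiffAt]
    have e1 : ∀ᶠ q in 𝓝 p, θ k q (D Z q (e j q)) =
        mvfderiv (𝓡 3) (fun q ↦ θ k q (Z q)) q (e j q) + (θ 0 q (Z q) * Γ j 0 k +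
          (θ 1 q (Z q) * Γ j 1 k + θ 2 q (Z q) * Γ j 2 k)) := by
      filter_upwards [h.eventually, hΓ.eventually, hZ.eventually] with q h1 h2 h3
      rw [h1.coeff_connection_frame h2 h3.mdiffAt, Fin.sum_univ_three, add_assoc (_ * _)]
    have hs := fun l ↦ (h.smoothFnAt_coeff l hZ).mul (SmoothFnAt.const (p := p) (Γ j l k))
    have hmul : ∀ l v, mvfderiv (𝓡 3) (fun q ↦ θ l q (Z q) * Γ j l k) p v =
        mvfderiv (𝓡 3) (fun q ↦ θ l q (Z q)) p v * Γ j l k := by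
      intro l v
      rw [mvfderiv_mul_apply (h.smoothFnAt_coeff l hZ).mdiffAt mdifferentiableAt_const,
        mvfderiv_const]
      simp [mul_comm]
    rw [mvfderiv_congr e1, mvfderiv_add_apply ((h.smoothFnAt_coeff k hZ).mvfderiv (h.smooth j)).mdiffAt
      ((hs 0).add ((hs 1).add (hs 2))).mdiffAt, mvfderiv_add_apply (hs 0).mdiffAt
      ((hs 1).add (hs 2)).mdiffAt, mvfderiv_add_apply (hs 1).mdiffAt (hs 2).mdiffAt]
    simp only [hmul, h.coeff_connection_frame hΓ hZ.mdiffAt, Fin.sum_univ_three]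
    ring
  have hb := mvfderiv_mlieBracket (h.smoothFnAt_coeff k hZ) (h.smooth i) (h.smooth j)
  have hcc : ∀ m, θ m p (mlieBracket (𝓡 3) (e i) (e j) p) = c i j m := fun m ↦ by
    rw [hc.self_of_nhds i j, h.coeff_sum]
  unfold curvature
  rw [map_sub, map_sub, second, second, h.coeff_connection hΓ hZ.mdiffAt, hb]
  simp only [hcc, curvatureCoeff, Fin.sum_univ_three]
  ring

/-- Tensoriality handles `X` and `Y`; the dependence on `Z`, which is differentiated twice, has
already been computed for an arbitrary smooth `Z` in `coeff_curvature_frame`. -/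
theorem IsFrameAt.coeff_curvature (h : IsFrameAt e θ p) (hc : HasStructureConstantsAt e c p)
    (hΓ : HasChristoffelAt D e Γ p)
    (hX : MDifferentiableAt (𝓡 3) ((𝓡 3).prod 𝓘(ℝ, E3)) (fun q : M ↦ TotalSpace.mk' E3 q (X q)) p)
    (hY : MDifferentiableAt (𝓡 3) ((𝓡 3).prod 𝓘(ℝ, E3)) (fun q : M ↦ TotalSpace.mk' E3 q (Y q)) p)
    (hZ : SmoothVFAt Z p) (k : Fin 3) :
    θ k p (curvature D X Y Z p) = ∑ i, ∑ j, ∑ l,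
      θ i p (X p) * θ j p (Y p) * θ l p (Z p) * curvatureCoeff c Γ i j l k := by
  have lz := fun {X : Π q : M, TangentSpace (𝓡 3) q} {f : M → ℝ}
    (hf : MDifferentiableAt (𝓡 3) 𝓘(ℝ, ℝ) f p)
    (hX : MDifferentiableAt (𝓡 3) ((𝓡 3).prod 𝓘(ℝ, E3)) (fun q : M ↦ TotalSpace.mk' E3 q (X q)) p) ↦
    D.isCovariantDerivativeOnUniv.leibniz (h.mdiffAt_connection hΓ hZ hX) hf
  have la := fun {X Y : Π q : M, TangentSpace (𝓡 3) q}
    (hX : MDifferentiableAt (𝓡 3) ((𝓡 3).prod 𝓘(ℝ, E3)) (fun q : M ↦ TotalSpace.mk' E3 q (X q)) p)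
    (hY : MDifferentiableAt (𝓡 3) ((𝓡 3).prod 𝓘(ℝ, E3)) (fun q : M ↦ TotalSpace.mk' E3 q (Y q)) p) ↦
    D.isCovariantDerivativeOnUniv.add (h.mdiffAt_connection hΓ hZ hX) (h.mdiffAt_connection hΓ hZ hY)
  have s1 : ∀ (f : M → ℝ) (X : Π q : M, TangentSpace (𝓡 3) q),
      (fun q ↦ D Z q ((f • X) q)) = f • fun q ↦ D Z q (X q) := fun f X ↦ by ext q; simp
  have s2 : ∀ (X Y : Π q : M, TangentSpace (𝓡 3) q),
      (fun q ↦ D Z q ((X + Y) q)) = (fun q ↦ D Z q (X q)) + fun q ↦ D Z q (Y q) :=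
    fun f X ↦ by ext q; simp
  have t1 : ∀ Y : Π q : M, TangentSpace (𝓡 3) q, TensorialAt (𝓡 3) E3
      (fun X : Π q : M, TangentSpace (𝓡 3) q ↦ θ k p (curvature D X Y Z p)) p := by
    intro Y
    constructor
    · intro f X hf hX
      unfold curvature
      rw [mlieBracket_smul_left hf hX, s1, lz hf hX]
      simp
      ring
    · intro X X' hX hX'
      unfold curvature
      rw [mlieBracket_add_left hX hX', s2, la hX hX']
      simp
      ring
  have t2 : ∀ X : Π q : M, TangentSpace (𝓡 3) q, TensorialAt (𝓡 3) E3
      (fun Y : Π q : M, TangentSpace (𝓡 3) q ↦ θ k p (curvature D X Y Z p)) p := by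
    intro Y
    constructor
    · intro f X hf hX
      unfold curvature
      rw [mlieBracket_smul_right hf hX, s1, lz hf hX]
      simp
      ring
    · intro X X' hX hX'
      unfold curvature
      rw [mlieBracket_add_right hX hX', s2, la hX hX']
      simp
      ring
  rw [h.tensorial_eq_sum (t1 Y) hX]
  refine Finset.sum_congr rfl fun i _ ↦ ?_
  rw [h.tensorial_eq_sum (t2 (e i)) hY, Finset.smul_sum]
  refine Finset.sum_congr rfl fun j _ ↦ ?_
  rw [h.coeff_curvature_frame hc hΓ hZ, smul_eq_mul, smul_eq_mul, Finset.mul_sum, Finset.mul_sum]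
  exact Finset.sum_congr rfl fun l _ ↦ by ring

/-- The Ricci tensor in a frame. -/
theorem IsFrameAt.ricci_eq (h : IsFrameAt e θ p) (hc : HasStructureConstantsAt e c p)
    (hΓ : HasChristoffelAt D e Γ p) (v w : TangentSpace (𝓡 3) p) :
    ricci D p v w = ∑ i, ∑ l, θ i p v * θ l p w * ∑ u, curvatureCoeff c Γ i u l u := by
  have hK : ∀ u : TangentSpace (𝓡 3) p, curvature D (FiberBundle.extend E3 v)
      (FiberBundle.extend E3 u) (FiberBundle.extend E3 w) p =
      ∑ j, θ j p u • ∑ k, (∑ i, ∑ l, θ i p v * θ l p w * curvatureCoeff c Γ i j l k) • e k p := by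
    intro u
    rw [h.eq_sum (curvature D _ _ _ p)]
    simp only [h.coeff_curvature hc hΓ (smoothVFAt_extend v).mdiffAt (smoothVFAt_extend u).mdiffAt
      (smoothVFAt_extend w), FiberBundle.extend_apply_self, Fin.sum_univ_three]
    module
  -- This converts the trace in the standard basis into the trace in the frame: the sum is `θʲ(eₖ)`
  -- expanded in standard coordinates.
  have htr : ∀ j k, ∑ b : Fin 3, θ j p (show TangentSpace (𝓡 3) p from
      EuclideanSpace.single b (1 : ℝ)) * (show E3 from e k p) b = if j = k then 1 else 0 := by
    intro j k
    rw [← h.dual_apply j k]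
    have : e k p = ∑ b : Fin 3, ((show E3 from e k p) b) • (show TangentSpace (𝓡 3) p from
      EuclideanSpace.single b (1 : ℝ)) := by
      have := (EuclideanSpace.basisFun (Fin 3) ℝ).sum_repr (show E3 from e k p)
      simp only [EuclideanSpace.basisFun_apply] at this
      exact this.symm
    conv_rhs => rw [this]
    rw [map_sum]
    refine Finset.sum_congr rfl fun b _ ↦ ?_
    rw [map_smul, smul_eq_mul, mul_comm]
  have key : ∀ b : Fin 3, (show E3 from curvature D (FiberBundle.extend E3 v)
      (FiberBundle.extend E3 (show TangentSpace (𝓡 3) p from EuclideanSpace.single b (1 : ℝ)))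
      (FiberBundle.extend E3 w) p) b =
      ∑ j, ∑ k, (∑ i, ∑ l, θ i p v * θ l p w * curvatureCoeff c Γ i j l k) *
        (θ j p (show TangentSpace (𝓡 3) p from EuclideanSpace.single b (1 : ℝ)) *
          (show E3 from e k p) b) := by
    intro b
    refine (congrArg (fun x : E3 ↦ x b) (hK _)).trans ?_
    have : ∀ (x : Fin 3 → ℝ) (K : Fin 3 → Fin 3 → ℝ) (y : Fin 3 → E3),
        (∑ j, x j • ∑ k, K j k • y k) b = ∑ j, ∑ k, K j k * (x j * y k b) := by
      intro x K y
      simp [Fin.sum_univ_three]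
      ring
    exact this _ (fun j k ↦ ∑ i, ∑ l, θ i p v * θ l p w * curvatureCoeff c Γ i j l k)
      fun k ↦ (show E3 from e k p)
  refine (Finset.sum_congr rfl fun b _ ↦ key b).trans ?_
  rw [Finset.sum_comm]
  refine (Finset.sum_congr rfl fun j _ ↦ Finset.sum_comm.trans
    (Finset.sum_congr rfl fun k _ ↦ by rw [← Finset.mul_sum, htr])).trans ?_
  simp only [Fin.sum_univ_three]
  simp
  ring

end FrameCurvature

/-! ### The Levi-Civita connection of a metric with constant structure functions. -/

section LeviCivita

set_option linter.unusedSectionVars false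

variable {M : Type*} [TopologicalSpace M] [ChartedSpace E3 M] [IsManifold (𝓡 3) ∞ M]
  {e : Fin 3 → Π q : M, TangentSpace (𝓡 3) q}
  {θ : Fin 3 → Π q : M, TangentSpace (𝓡 3) q →L[ℝ] ℝ} {p : M}
  {X Y Z : Π q : M, TangentSpace (𝓡 3) q}
  {D : Connection M} {Γ c : Fin 3 → Fin 3 → Fin 3 → ℝ} {G : Fin 3 → Fin 3 → ℝ}
  {g : Π p : M, TangentSpace (𝓡 3) p →L[ℝ] TangentSpace (𝓡 3) p →L[ℝ] ℝ}

/-- The constants `Γ` are the Christoffel symbols of a torsion-free metric connection, in a frame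
with structure constants `c` and Gram matrix `G`. -/
structure IsLeviCivitaSymbol (c Γ : Fin 3 → Fin 3 → Fin 3 → ℝ) (G : Fin 3 → Fin 3 → ℝ) :
    Prop where
  torsion : ∀ i j k, Γ i j k - Γ j i k = c i j k
  metric : ∀ i j k, ∑ m, Γ i j m * G m k + ∑ m, Γ i k m * G j m = 0

theorem HasGramAt.sum_left (hG : HasGramAt g e G p) (a : Fin 3 → ℝ) (k : Fin 3) :
    g p (∑ m, a m • e m p) (e k p) = ∑ m, a m * G m k := by
  simp [hG.self_of_nhds]

theorem HasGramAt.sum_right (hG : HasGramAt g e G p) (a : Fin 3 → ℝ) (k : Fin 3) :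
    g p (e k p) (∑ m, a m • e m p) = ∑ m, a m * G k m := by
  simp [hG.self_of_nhds]

/-- The Koszul formula in a frame. -/
theorem IsFrameAt.hasChristoffelAt (h : IsFrameAt e θ p) (hc : HasStructureConstantsAt e c p)
    (hG : HasGramAt g e G p) (hg : ∀ p v, (∀ w, g p v w = 0) → v = 0)
    (hgs : ∀ p v w, g p v w = g p w v) (hD : IsLeviCivita g D) (hΓ : IsLeviCivitaSymbol c Γ G) :
    HasChristoffelAt D e Γ p := by
  have hGs : ∀ i j, G i j = G j i := fun i j ↦ by
    rw [← hG.self_of_nhds, ← hG.self_of_nhds, hgs]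
  filter_upwards [h.eventually, hc.eventually, hG.eventually] with q h1 h2 h3
  have htor : ∀ i j, D (e j) q (e i q) - D (e i) q (e j q) = ∑ k, c i j k • e k q := fun i j ↦ by
    rw [← h2.self_of_nhds i j]
    exact (CovariantDerivative.torsion_eq_zero_iff D).1 hD.torsion_eq_zero (h1.smooth i).mdiffAt
      (h1.smooth j).mdiffAt
  have htor' : ∀ i j k, g q (D (e j) q (e i q)) (e k q) - g q (D (e i) q (e j q)) (e k q) =
      ∑ m, c i j m * G m k := fun i j k ↦ by
    rw [← h3.sum_left, ← htor i j]
    simp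
  have hmet : ∀ i j k, g q (D (e j) q (e i q)) (e k q) + g q (D (e k) q (e i q)) (e j q) = 0 := by
    intro i j k
    have := hD.metric (e j) (e k) q (e i q) (h1.smooth j).mdiffAt (h1.smooth k).mdiffAt
    rw [mvfderiv_of_const (h3.mono fun x hx ↦ hx j k), hgs q (e j q)] at this
    exact this.symm
  have hΓ' : ∀ i j k, ∑ m, Γ i j m * G m k - ∑ m, Γ j i m * G m k = ∑ m, c i j m * G m k := by
    intro i j k
    simp only [← hΓ.torsion, sub_mul, Finset.sum_sub_distrib]
  have hΓ'' : ∀ i j k, ∑ m, Γ i j m * G m k + ∑ m, Γ i k m * G m j = 0 := by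
    intro i j k
    rw [← hΓ.metric i j k]
    simp only [hGs j]
  intro i j
  rw [← sub_eq_zero]
  refine hg q _ fun w ↦ ?_
  rw [h1.eq_sum w, map_sum]
  refine Finset.sum_eq_zero fun k _ ↦ ?_
  rw [map_smul, map_sub, sub_apply, h3.sum_left]
  -- Koszul's argument: the torsion and metric identities at the three cyclic permutations of `(i,
  -- j, k)` determine `g(D_{eᵢ} eⱼ, eₖ)`, and the constants `Γ` satisfy the same linear system.
  have := htor' i j k
  have := htor' j k i
  have := htor' k i j
  have := hΓ' i j k
  have := hΓ' j k i
  have := hΓ' k i j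
  have := hmet i j k
  have := hmet j k i
  have := hmet k i j
  have := hΓ'' i j k
  have := hΓ'' j k i
  have := hΓ'' k i j
  have h0 : g q (D (e j) q (e i q)) (e k q) - ∑ m, Γ i j m * G m k = 0 := by linarith
  rw [h0, smul_zero]

/-- The Leibniz terms cancel, so the Lie derivative is tensorial in both arguments; on frame fields
the Gram matrix is constant and only the brackets with `e 0` at the single point `p` enter. -/
theorem IsFrameAt.lieDerivMetric_eq (h : IsFrameAt e θ p) {b : Fin 3 → Fin 3 → ℝ}
    (hb : ∀ i, mlieBracket (𝓡 3) (e 0) (e i) p = ∑ k, b i k • e k p) (hG : HasGramAt g e G p)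
    (hg : ∀ X Y : Π q : M, TangentSpace (𝓡 3) q,
      MDifferentiableAt (𝓡 3) ((𝓡 3).prod 𝓘(ℝ, E3)) (fun q : M ↦ TotalSpace.mk' E3 q (X q)) p →
      MDifferentiableAt (𝓡 3) ((𝓡 3).prod 𝓘(ℝ, E3)) (fun q : M ↦ TotalSpace.mk' E3 q (Y q)) p →
      MDifferentiableAt (𝓡 3) 𝓘(ℝ, ℝ) (fun q ↦ g q (X q) (Y q)) p)
    (v w : TangentSpace (𝓡 3) p) :
    lieDerivMetric g (e 0) (FiberBundle.extend E3 v) (FiberBundle.extend E3 w) p =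
      -∑ i, ∑ j, θ i p v * θ j p w * ∑ m, (b i m * G m j + b j m * G i m) := by
  have t1 : ∀ Y : Π q : M, TangentSpace (𝓡 3) q,
      MDifferentiableAt (𝓡 3) ((𝓡 3).prod 𝓘(ℝ, E3)) (fun q : M ↦ TotalSpace.mk' E3 q (Y q)) p →
      TensorialAt (𝓡 3) E3
      (fun X : Π q : M, TangentSpace (𝓡 3) q ↦ lieDerivMetric g (e 0) X Y p) p := by
    intro Y hY
    constructor
    · intro f X hf hX
      have := mvfderiv_mul_apply hf (hg X Y hX hY) (e 0 p)
      simp only [lieDerivMetric, Pi.smul_apply', map_smul, smul_apply,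
        smul_eq_mul, this, mlieBracket_smul_right hf hX]
      simp
      ring
    · intro X X' hX hX'
      have := mvfderiv_add_apply (hg X Y hX hY) (hg X' Y hX' hY) (e 0 p)
      simp only [lieDerivMetric, Pi.add_apply, map_add, add_apply,
        this, mlieBracket_add_right hX hX']
      ring
  have t2 : ∀ Y : Π q : M, TangentSpace (𝓡 3) q,
      MDifferentiableAt (𝓡 3) ((𝓡 3).prod 𝓘(ℝ, E3)) (fun q : M ↦ TotalSpace.mk' E3 q (Y q)) p →
      TensorialAt (𝓡 3) E3
      (fun X : Π q : M, TangentSpace (𝓡 3) q ↦ lieDerivMetric g (e 0) Y X p) p := by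
    intro Y hY
    constructor
    · intro f X hf hX
      have := mvfderiv_mul_apply hf (hg Y X hY hX) (e 0 p)
      simp only [lieDerivMetric, Pi.smul_apply', map_smul,
        smul_eq_mul, this, mlieBracket_smul_right hf hX]
      simp
      ring
    · intro X X' hX hX'
      have := mvfderiv_add_apply (hg Y X hY hX) (hg Y X' hY hX') (e 0 p)
      simp only [lieDerivMetric, Pi.add_apply, map_add,
        this, mlieBracket_add_right hX hX']
      ring
  have hv := (smoothVFAt_extend v).mdiffAt
  have hw := (smoothVFAt_extend w).mdiffAt
  rw [h.tensorial_eq_sum (t1 _ hw) hv, ← Finset.sum_neg_distrib]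
  refine Finset.sum_congr rfl fun i _ ↦ ?_
  rw [h.tensorial_eq_sum (t2 _ (h.smooth i).mdiffAt) hw, Finset.smul_sum, ← Finset.sum_neg_distrib]
  refine Finset.sum_congr rfl fun j _ ↦ ?_
  rw [lieDerivMetric, mvfderiv_of_const (hG.mono fun x hx ↦ hx i j), hb, hb, hG.sum_left, hG.sum_right, Finset.sum_add_distrib]
  simp
  ring

/-- The covariant derivative at `p` with Christoffel symbols `Γ` in the frame `e`. -/
def frameConnection (e : Fin 3 → Π q : M, TangentSpace (𝓡 3) q)
    (θ : Fin 3 → Π q : M, TangentSpace (𝓡 3) q →L[ℝ] ℝ) (Γ : Fin 3 → Fin 3 → Fin 3 → ℝ)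
    (Y : Π q : M, TangentSpace (𝓡 3) q) (p : M) :
    TangentSpace (𝓡 3) p →L[ℝ] TangentSpace (𝓡 3) p :=
  ∑ k, (mvfderiv (𝓡 3) (fun q ↦ θ k q (Y q)) p
    + ∑ i, ∑ j, (Γ i j k * θ j p (Y p)) • θ i p).smulRight (e k p)

theorem frameConnection_apply (Y : Π q : M, TangentSpace (𝓡 3) q) (v : TangentSpace (𝓡 3) p) :
    frameConnection e θ Γ Y p v = ∑ k, (mvfderiv (𝓡 3) (fun q ↦ θ k q (Y q)) p v
    + ∑ i, ∑ j, Γ i j k * θ j p (Y p) * θ i p v) • e k p := by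
  simp [frameConnection]

theorem IsFrameAt.frameConnection_add (h : IsFrameAt e θ p)
    (hX : MDifferentiableAt (𝓡 3) ((𝓡 3).prod 𝓘(ℝ, E3)) (fun q : M ↦ TotalSpace.mk' E3 q (X q)) p)
    (hY : MDifferentiableAt (𝓡 3) ((𝓡 3).prod 𝓘(ℝ, E3)) (fun q : M ↦ TotalSpace.mk' E3 q (Y q)) p) :
    frameConnection e θ Γ (X + Y) p = frameConnection e θ Γ X p + frameConnection e θ Γ Y p := by
  ext v
  have := fun k ↦ mvfderiv_add_apply (h.mdiffAt_coeff k hX) (h.mdiffAt_coeff k hY) v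
  rw [add_apply]
  simp only [frameConnection_apply, Pi.add_apply, map_add, this]
  rw [← Finset.sum_add_distrib]
  refine Finset.sum_congr rfl fun k _ ↦ ?_
  simp only [mul_add, add_mul, Finset.sum_add_distrib]
  module

theorem IsFrameAt.frameConnection_smul (h : IsFrameAt e θ p) {f : M → ℝ}
    (hX : MDifferentiableAt (𝓡 3) ((𝓡 3).prod 𝓘(ℝ, E3)) (fun q : M ↦ TotalSpace.mk' E3 q (X q)) p)
    (hf : MDifferentiableAt (𝓡 3) 𝓘(ℝ, ℝ) f p) :
    frameConnection e θ Γ (f • X) p = f p • frameConnection e θ Γ X p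
      + (mvfderiv (𝓡 3) f p).smulRight (X p) := by
  ext v
  have := fun k ↦ mvfderiv_mul_apply hf (h.mdiffAt_coeff k hX) v
  rw [add_apply, smul_apply,
    ContinuousLinearMap.smulRight_apply]
  conv_rhs => rw [h.eq_sum (X p)]
  simp only [frameConnection_apply, Pi.smul_apply', map_smul, smul_eq_mul, this]
  rw [Finset.smul_sum, Finset.smul_sum, ← Finset.sum_add_distrib]
  refine Finset.sum_congr rfl fun k _ ↦ ?_
  have : ∑ i, ∑ j, Γ i j k * (f p * θ j p (X p)) * θ i p v =
      f p * ∑ i, ∑ j, Γ i j k * θ j p (X p) * θ i p v := by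
    simp only [Finset.mul_sum]
    exact Finset.sum_congr rfl fun i _ ↦ Finset.sum_congr rfl fun j _ ↦ by ring
  rw [this]
  module

theorem IsFrameAt.frameConnection_frame (h : IsFrameAt e θ p) (i j : Fin 3) :
    frameConnection e θ Γ (e j) p (e i p) = ∑ k, Γ i j k • e k p := by
  rw [frameConnection_apply]
  simp [h.mvfderiv_dual, h.dual_apply]

/-- A metric with frames near every point that have the same constant Gram matrix and structure
constants has a Levi-Civita connection. -/
theorem exists_isLeviCivita (hΓ : IsLeviCivitaSymbol c Γ G)
    (hg : ∀ p, ∀ X Y : Π q : M, TangentSpace (𝓡 3) q,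
      MDifferentiableAt (𝓡 3) ((𝓡 3).prod 𝓘(ℝ, E3)) (fun q : M ↦ TotalSpace.mk' E3 q (X q)) p →
      MDifferentiableAt (𝓡 3) ((𝓡 3).prod 𝓘(ℝ, E3)) (fun q : M ↦ TotalSpace.mk' E3 q (Y q)) p →
      MDifferentiableAt (𝓡 3) 𝓘(ℝ, ℝ) (fun q ↦ g q (X q) (Y q)) p)
    (H : ∀ p, ∃ (e : Fin 3 → Π q : M, TangentSpace (𝓡 3) q)
      (θ : Fin 3 → Π q : M, TangentSpace (𝓡 3) q →L[ℝ] ℝ),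
      IsFrameAt e θ p ∧ HasStructureConstantsAt e c p ∧ HasGramAt g e G p) :
    ∃ D : Connection M, IsLeviCivita g D := by
  choose e θ h hc hG using H
  -- The frame is chosen independently at each point, with no compatibility between choices:
  -- additivity, the Leibniz rule, vanishing torsion and metricity are all conditions at one point,
  -- checked at `p` in the frame chosen for `p`.
  let D : Connection M :=
    { toFun := fun Y p ↦ frameConnection (e p) (θ p) Γ Y p
      isCovariantDerivativeOnUniv :=
        { add := fun {X Y p} hX hY _ ↦ (h p).frameConnection_add hX hY
          leibniz := fun {X f p} hX hf _ ↦ (h p).frameConnection_smul hX hf } }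
  have hD : ∀ Y p, D Y p = frameConnection (e p) (θ p) Γ Y p := fun _ _ ↦ rfl
  have hfr : ∀ p i j, D (e p j) p (e p i p) = ∑ k, Γ i j k • e p k p := fun p i j ↦
    (h p).frameConnection_frame i j
  refine ⟨D, ?_, ?_⟩
  · ext p v w
    rw [(h p).eq_sum v, (h p).eq_sum w]
    have : ∀ i j, D.torsion p (e p i p) (e p j p) = 0 := fun i j ↦ by
      rw [CovariantDerivative.torsion_apply D ((h p).smooth i).mdiffAt ((h p).smooth j).mdiffAt,
        hfr, hfr, (hc p).self_of_nhds, ← Finset.sum_sub_distrib, ← Finset.sum_sub_distrib]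
      exact Finset.sum_eq_zero fun k _ ↦ by rw [← hΓ.torsion]; module
    simp [this]
  · intro X Y p v hX hY
    have t1 : ∀ Y : Π q : M, TangentSpace (𝓡 3) q,
        MDifferentiableAt (𝓡 3) ((𝓡 3).prod 𝓘(ℝ, E3)) (fun q : M ↦ TotalSpace.mk' E3 q (Y q)) p →
        TensorialAt (𝓡 3) E3 (fun X : Π q : M, TangentSpace (𝓡 3) q ↦
          mvfderiv (𝓡 3) (fun q ↦ g q (X q) (Y q)) p v - (g p (D X p v) (Y p)
            + g p (X p) (D Y p v))) p := by
      intro Y hY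
      constructor
      · intro f X hf hX
        have := mvfderiv_mul_apply hf (hg p X Y hX hY) v
        have h2 := (h p).frameConnection_smul (Γ := Γ) hX hf
        rw [← hD, ← hD] at h2
        rw [h2]
        simp only [Pi.smul_apply', map_smul, smul_apply, smul_eq_mul, this]
        simp
        ring
      · intro X X' hX hX'
        have := mvfderiv_add_apply (hg p X Y hX hY) (hg p X' Y hX' hY) v
        have h2 := (h p).frameConnection_add (Γ := Γ) hX hX'
        rw [← hD, ← hD, ← hD] at h2
        rw [h2]
        simp only [Pi.add_apply, map_add, add_apply, this]
        ring
    have t2 : ∀ Y : Π q : M, TangentSpace (𝓡 3) q,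
        MDifferentiableAt (𝓡 3) ((𝓡 3).prod 𝓘(ℝ, E3)) (fun q : M ↦ TotalSpace.mk' E3 q (Y q)) p →
        TensorialAt (𝓡 3) E3 (fun X : Π q : M, TangentSpace (𝓡 3) q ↦
          mvfderiv (𝓡 3) (fun q ↦ g q (Y q) (X q)) p v - (g p (D Y p v) (X p)
            + g p (Y p) (D X p v))) p := by
      intro Y hY
      constructor
      · intro f X hf hX
        have := mvfderiv_mul_apply hf (hg p Y X hY hX) v
        have h2 := (h p).frameConnection_smul (Γ := Γ) hX hf
        rw [← hD, ← hD] at h2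
        rw [h2]
        simp only [Pi.smul_apply', map_smul, smul_eq_mul, this]
        simp
        ring
      · intro X X' hX hX'
        have := mvfderiv_add_apply (hg p Y X hY hX) (hg p Y X' hY hX') v
        have h2 := (h p).frameConnection_add (Γ := Γ) hX hX'
        rw [← hD, ← hD, ← hD] at h2
        rw [h2]
        simp only [Pi.add_apply, map_add, add_apply, this]
        ring
    rw [← sub_eq_zero, (h p).tensorial_eq_sum (t1 Y hY) hX]
    refine Finset.sum_eq_zero fun i _ ↦ ?_
    rw [(h p).tensorial_eq_sum (t2 _ ((h p).smooth i).mdiffAt) hY]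
    refine smul_eq_zero_of_right _ (Finset.sum_eq_zero fun j _ ↦ smul_eq_zero_of_right _ ?_)
    rw [mvfderiv_of_const ((hG p).mono fun x hx ↦ hx i j), zero_apply, zero_sub, neg_eq_zero,
      (h p).eq_sum v]
    simp only [map_sum, map_smul, hfr, sum_apply,
      smul_apply, (hG p).self_of_nhds, smul_eq_mul]
    rw [← Finset.sum_add_distrib]
    refine Finset.sum_eq_zero fun l _ ↦ ?_
    rw [← mul_add, hΓ.metric, mul_zero]

end LeviCivita

/-! ### Adapted null frames of a paracontact metric structure. -/

section AdaptedFrames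

set_option linter.unusedSectionVars false

variable {M : Type*} [TopologicalSpace M] [ChartedSpace E3 M] [IsManifold (𝓡 3) ∞ M]
  {S : ParacontactMetricStructure M} {s : ℝ} {p : M}
  {X Y E₁ E₂ : Π q : M, TangentSpace (𝓡 3) q}

namespace ParacontactMetricStructure

theorem g_ξ (S : ParacontactMetricStructure M) (p : M) (v : TangentSpace (𝓡 3) p) :
    S.g p (S.ξ p) v = S.η p v := by
  have := S.compatible p (S.ξ p) v
  rw [S.φ_ξ, S.η_ξ] at this
  simp at this
  linarith

theorem g_φ_left (S : ParacontactMetricStructure M) (p : M) (v w : TangentSpace (𝓡 3) p) :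
    S.g p (S.φ p v) w = - S.g p v (S.φ p w) := by
  have := S.compatible p v (S.φ p w)
  rw [S.φ_φ, S.η_φ, map_sub, map_smul, S.g_symm p _ (S.ξ p), S.g_ξ, S.η_φ] at this
  simpa using this

/-- The hypothesis `s * s = 1` encodes `s = ±1`, so that both eigenvalues of `φ` are treated at
once. -/
theorem η_eq_zero_of_φ_eq (S : ParacontactMetricStructure M) {v : TangentSpace (𝓡 3) p}
    (hs : s * s = 1) (hv : S.φ p v = s • v) : S.η p v = 0 := by
  have := S.η_φ p v
  rw [hv, map_smul, smul_eq_mul] at this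
  have h2 : s * s * S.η p v = 0 := by rw [mul_assoc, this, mul_zero]
  rwa [hs, one_mul] at h2

/-- On `ker η` the tensor `φ` is an anti-isometry, whereas on an eigenvector it multiplies `g(v, v)`
by `s² = 1`; hence eigenvectors are null. -/
theorem g_self_eq_zero_of_φ_eq (S : ParacontactMetricStructure M) {v : TangentSpace (𝓡 3) p}
    (hs : s * s = 1) (hv : S.φ p v = s • v) : S.g p v v = 0 := by
  have := S.compatible p v v
  rw [hv, S.η_eq_zero_of_φ_eq hs hv] at this
  simp only [map_smul, smul_apply, smul_eq_mul] at this
  rw [← mul_assoc, hs] at this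
  linarith

theorem smoothVFAt_φ (S : ParacontactMetricStructure M) (hX : SmoothVFAt X p) :
    SmoothVFAt (fun q ↦ S.φ q (X q)) p :=
  hX.mono fun _ hq ↦ ContMDiffAt.clm_bundle_apply S.φ_smooth.contMDiffAt hq

theorem smoothVFAt_ξ (S : ParacontactMetricStructure M) : SmoothVFAt S.ξ p :=
  Filter.Eventually.of_forall fun _ ↦ S.ξ_smooth.contMDiffAt

theorem mdiffAt_η (S : ParacontactMetricStructure M)
    (hX : MDifferentiableAt (𝓡 3) ((𝓡 3).prod 𝓘(ℝ, E3)) (fun q : M ↦ TotalSpace.mk' E3 q (X q)) p) :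
    MDifferentiableAt (𝓡 3) 𝓘(ℝ, ℝ) (fun q ↦ S.η q (X q)) p := by
  have := MDifferentiableAt.clm_bundle_apply (E₂ := Bundle.Trivial M ℝ)
    (S.η_smooth.contMDiffAt.mdifferentiableAt (by simp)) hX
  exact (mdifferentiableAt_section (𝓡 3) (E := Bundle.Trivial M ℝ) (F := ℝ) (fun q ↦ S.η q (X q))).1 this

theorem smoothFnAt_η (S : ParacontactMetricStructure M) (hX : SmoothVFAt X p) :
    SmoothFnAt (fun q ↦ S.η q (X q)) p := by
  filter_upwards [hX] with q hq
  have := ContMDiffAt.clm_bundle_apply (E₂ := Bundle.Trivial M ℝ) S.η_smooth.contMDiffAt hq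
  exact contMDiffAt_section .. |>.1 this

theorem mdiffAt_g (S : ParacontactMetricStructure M)
    (hX : MDifferentiableAt (𝓡 3) ((𝓡 3).prod 𝓘(ℝ, E3)) (fun q : M ↦ TotalSpace.mk' E3 q (X q)) p)
    (hY : MDifferentiableAt (𝓡 3) ((𝓡 3).prod 𝓘(ℝ, E3)) (fun q : M ↦ TotalSpace.mk' E3 q (Y q)) p) :
    MDifferentiableAt (𝓡 3) 𝓘(ℝ, ℝ) (fun q ↦ S.g q (X q) (Y q)) p := by
  have := MDifferentiableAt.clm_bundle_apply₂ (E₃ := Bundle.Trivial M ℝ)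
    (S.g_smooth.contMDiffAt.mdifferentiableAt (by simp)) hX hY
  exact mdifferentiableAt_section .. |>.1 this

theorem smoothFnAt_g (S : ParacontactMetricStructure M) (hX : SmoothVFAt X p)
    (hY : SmoothVFAt Y p) : SmoothFnAt (fun q ↦ S.g q (X q) (Y q)) p := by
  filter_upwards [hX, hY] with q hq hq'
  have := ContMDiffAt.clm_bundle_apply₂ (E₃ := Bundle.Trivial M ℝ) S.g_smooth.contMDiffAt hq hq'
  exact contMDiffAt_section .. |>.1 this

end ParacontactMetricStructure

/-- `E₁` and `E₂` are smooth null eigenvector fields of `φ`, normalised by `g(E₁, E₂) = 2`. -/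
structure IsAdaptedAt (S : ParacontactMetricStructure M) (s : ℝ)
    (E₁ E₂ : Π q : M, TangentSpace (𝓡 3) q) (p : M) : Prop where
  sq : s * s = 1
  smooth₁ : SmoothVFAt E₁ p
  smooth₂ : SmoothVFAt E₂ p
  eqs : ∀ᶠ q in 𝓝 p, S.φ q (E₁ q) = s • E₁ q ∧ S.φ q (E₂ q) = -s • E₂ q ∧
    S.g q (E₁ q) (E₂ q) = 2

/-- The frame `(ξ, E₁, E₂)`. -/
def adaptedFrame (S : ParacontactMetricStructure M) (E₁ E₂ : Π q : M, TangentSpace (𝓡 3) q) :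
    Fin 3 → Π q : M, TangentSpace (𝓡 3) q := ![S.ξ, E₁, E₂]

/-- The coframe dual to `(ξ, E₁, E₂)`. -/
def adaptedCoframe (S : ParacontactMetricStructure M) (E₁ E₂ : Π q : M, TangentSpace (𝓡 3) q) :
    Fin 3 → Π q : M, TangentSpace (𝓡 3) q →L[ℝ] ℝ :=
  ![S.η, fun q ↦ (1 / 2 : ℝ) • S.g q (E₂ q), fun q ↦ (1 / 2 : ℝ) • S.g q (E₁ q)]

/-- The Gram matrix of an adapted frame. -/
def adaptedGram : Fin 3 → Fin 3 → ℝ := ![![1, 0, 0], ![0, 0, 2], ![0, 2, 0]]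

theorem IsAdaptedAt.eventually (h : IsAdaptedAt S s E₁ E₂ p) :
    ∀ᶠ q in 𝓝 p, IsAdaptedAt S s E₁ E₂ q := by
  filter_upwards [h.smooth₁.eventually, h.smooth₂.eventually, eventually_eventually_nhds.2 h.eqs]
    with q h1 h2 h3 using ⟨h.sq, h1, h2, h3⟩

theorem IsAdaptedAt.φ₁ (h : IsAdaptedAt S s E₁ E₂ p) : S.φ p (E₁ p) = s • E₁ p :=
  h.eqs.self_of_nhds.1

theorem IsAdaptedAt.φ₂ (h : IsAdaptedAt S s E₁ E₂ p) : S.φ p (E₂ p) = -s • E₂ p :=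
  h.eqs.self_of_nhds.2.1

theorem IsAdaptedAt.g₁₂ (h : IsAdaptedAt S s E₁ E₂ p) : S.g p (E₁ p) (E₂ p) = 2 :=
  h.eqs.self_of_nhds.2.2

theorem IsAdaptedAt.g₁₁ (h : IsAdaptedAt S s E₁ E₂ p) : S.g p (E₁ p) (E₁ p) = 0 :=
  S.g_self_eq_zero_of_φ_eq h.sq h.φ₁

theorem IsAdaptedAt.g₂₂ (h : IsAdaptedAt S s E₁ E₂ p) : S.g p (E₂ p) (E₂ p) = 0 :=
  S.g_self_eq_zero_of_φ_eq (by linarith [h.sq]) h.φ₂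

theorem IsAdaptedAt.η₁ (h : IsAdaptedAt S s E₁ E₂ p) : S.η p (E₁ p) = 0 :=
  S.η_eq_zero_of_φ_eq h.sq h.φ₁

theorem IsAdaptedAt.η₂ (h : IsAdaptedAt S s E₁ E₂ p) : S.η p (E₂ p) = 0 :=
  S.η_eq_zero_of_φ_eq (by linarith [h.sq]) h.φ₂

theorem IsAdaptedAt.swap (h : IsAdaptedAt S s E₁ E₂ p) : IsAdaptedAt S (-s) E₂ E₁ p :=
  ⟨by linarith [h.sq], h.smooth₂, h.smooth₁, h.eqs.mono fun q hq ↦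
    ⟨hq.2.1, by rw [neg_neg]; exact hq.1, by rw [S.g_symm]; exact hq.2.2⟩⟩

theorem IsAdaptedAt.hasGramAt (h : IsAdaptedAt S s E₁ E₂ p) :
    HasGramAt S.g (adaptedFrame S E₁ E₂) adaptedGram p := by
  filter_upwards [h.eventually] with q hq i j
  fin_cases i <;> fin_cases j
  · exact (S.g_ξ q _).trans (S.η_ξ q)
  · exact (S.g_ξ q _).trans hq.η₁
  · exact (S.g_ξ q _).trans hq.η₂
  · exact (S.g_symm q _ _).trans ((S.g_ξ q _).trans hq.η₁)
  · exact hq.g₁₁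
  · exact hq.g₁₂
  · exact (S.g_symm q _ _).trans ((S.g_ξ q _).trans hq.η₂)
  · exact (S.g_symm q _ _).trans hq.g₁₂
  · exact hq.g₂₂

theorem IsAdaptedAt.isFrameAt (h : IsAdaptedAt S s E₁ E₂ p) :
    IsFrameAt (adaptedFrame S E₁ E₂) (adaptedCoframe S E₁ E₂) p where
  smooth i := by
    fin_cases i
    exacts [S.smoothVFAt_ξ, h.smooth₁, h.smooth₂]
  mdiff_coeff := by
    filter_upwards [h.eventually] with q hq i X hX
    fin_cases i
    · exact S.mdiffAt_η hX
    · exact (mdifferentiableAt_const (c := (1 / 2 : ℝ))).mul (S.mdiffAt_g hq.smooth₂.mdiffAt hX)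
    · exact (mdifferentiableAt_const (c := (1 / 2 : ℝ))).mul (S.mdiffAt_g hq.smooth₁.mdiffAt hX)
  smooth_coeff := by
    filter_upwards [h.eventually] with q hq i X hX
    fin_cases i
    · exact S.smoothFnAt_η hX
    · exact (SmoothFnAt.const (1 / 2)).mul (S.smoothFnAt_g hq.smooth₂ hX)
    · exact (SmoothFnAt.const (1 / 2)).mul (S.smoothFnAt_g hq.smooth₁ hX)
  dual := by
    filter_upwards [h.eventually] with q hq i j
    have h12 : (1 / 2 : ℝ) * S.g q (E₁ q) (E₂ q) = 1 := by rw [hq.g₁₂]; norm_num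
    have half : ∀ {x : ℝ}, x = 0 → (1 / 2 : ℝ) * x = 0 := fun hx ↦ by rw [hx, mul_zero]
    fin_cases i <;> fin_cases j
    · exact S.η_ξ q
    · exact hq.η₁
    · exact hq.η₂
    · exact half ((S.g_symm q _ _).trans ((S.g_ξ q _).trans hq.η₂))
    · exact (congrArg (fun x ↦ (1 / 2 : ℝ) * x) (S.g_symm q _ _)).trans h12
    · exact half hq.g₂₂
    · exact half ((S.g_symm q _ _).trans ((S.g_ξ q _).trans hq.η₁))
    · exact half hq.g₁₁
    · exact h12

/-- From `φ³ = φ`, the operators `φ² ± φ` map every vector field to an eigenvector field, which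
gives smooth eigenvector fields without any choice of eigenbasis. Since `φ p ≠ 0`, one sign yields a
nonzero eigenvector `v₁`, and nondegeneracy provides `w` with `g(v₁, w) ≠ 0`. Only the component of
`w` in the opposite eigenspace pairs with `v₁`, so its projection can be rescaled to reach `g(E₁,
E₂) = 2`. -/
theorem exists_isAdaptedAt (S : ParacontactMetricStructure M) (p : M) :
    ∃ s E₁ E₂, IsAdaptedAt S s E₁ E₂ p := by
  have hφ3 : ∀ q (v : TangentSpace (𝓡 3) q), S.φ q (S.φ q (S.φ q v)) = S.φ q v := fun q v ↦ by
    rw [S.φ_φ, S.η_φ, zero_smul, sub_zero]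
  obtain ⟨v, hv⟩ : ∃ v, S.φ p v ≠ 0 := by
    by_contra! hcon
    have h1 : ∀ v, v = S.η p v • S.ξ p := fun v ↦ by
      have := S.φ_φ p v
      rw [hcon v, map_zero] at this
      exact (sub_eq_zero.1 this.symm)
    have h2 := finrank_le_one (R := ℝ) (S.ξ p) fun w ↦ ⟨S.η p w, (h1 w).symm⟩
    have h3 : Module.finrank ℝ (TangentSpace (𝓡 3) p) = 3 :=
      finrank_euclideanSpace_fin (𝕜 := ℝ) (n := 3)
    omega
  obtain ⟨s, hs, hne⟩ : ∃ s : ℝ, s * s = 1 ∧ S.φ p v + s • S.φ p (S.φ p v) ≠ 0 := by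
    by_contra! hcon
    have h1 := hcon 1 (by norm_num)
    have h2 := hcon (-1) (by norm_num)
    apply hv
    have h3 : (2 : ℝ) • S.φ p v = 0 := by
      rw [← add_zero (0 : TangentSpace (𝓡 3) p)]
      nth_rw 1 [← h1]
      rw [← h2]
      module
    simpa using h3
  set v₁ := S.φ p v + s • S.φ p (S.φ p v) with hv₁
  have hφv₁ : S.φ p v₁ = s • v₁ := by
    rw [hv₁, map_add, map_smul, hφ3, smul_add, smul_smul, hs, one_smul, add_comm]
  obtain ⟨w, hw⟩ : ∃ w, S.g p v₁ w ≠ 0 := by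
    by_contra! hcon
    exact hne (S.g_nondegenerate p _ hcon)
  have proj : ∀ {X : Π q : M, TangentSpace (𝓡 3) q} {r : ℝ}, r * r = 1 → SmoothVFAt X p →
      SmoothVFAt (fun q ↦ S.φ q (S.φ q (X q)) + r • S.φ q (X q)) p ∧
      ∀ q, S.φ q (S.φ q (S.φ q (X q)) + r • S.φ q (X q)) =
        r • (S.φ q (S.φ q (X q)) + r • S.φ q (X q)) := by
    intro X r hr hX
    refine ⟨(S.smoothVFAt_φ (S.smoothVFAt_φ hX)).add
      ((S.smoothVFAt_φ hX).smul (SmoothFnAt.const r)), fun q ↦ ?_⟩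
    rw [map_add, map_smul, hφ3, smul_add, smul_smul, hr, one_smul, add_comm]
  obtain ⟨hs1, he1⟩ := proj hs (smoothVFAt_extend v₁)
  obtain ⟨hs2, he2⟩ := proj (r := -s) (by linarith) (smoothVFAt_extend w)
  set F₁ := fun q ↦ S.φ q (S.φ q (FiberBundle.extend E3 v₁ q)) + s • S.φ q (FiberBundle.extend E3 v₁ q)
  set F₂ := fun q ↦ S.φ q (S.φ q (FiberBundle.extend E3 w q)) + -s • S.φ q (FiberBundle.extend E3 w q)
  have hg : S.g p (F₁ p) (F₂ p) ≠ 0 := by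
    have h1 : F₁ p = (2 : ℝ) • v₁ := by
      simp only [F₁, FiberBundle.extend_apply_self, hφv₁, map_smul, smul_smul, hs]
      module
    have h2 : S.g p v₁ (F₂ p) = 2 * S.g p v₁ w := by
      have e1 := S.g_φ_left p v₁ w
      rw [hφv₁, map_smul, smul_apply, smul_eq_mul] at e1
      simp only [F₂, FiberBundle.extend_apply_self]
      rw [S.φ_φ, map_add, map_sub, map_smul, map_smul, S.g_symm p _ (S.ξ p), S.g_ξ,
        S.η_eq_zero_of_φ_eq hs hφv₁]
      simp only [smul_eq_mul]
      linear_combination (-s) * e1 + S.g p v₁ w * hs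
    rw [h1, map_smul, smul_apply, h2]
    simp [hw]
  have hfn := S.smoothFnAt_g hs1 hs2
  have hne : ∀ᶠ q in 𝓝 p, S.g q (F₁ q) (F₂ q) ≠ 0 :=
    hfn.contMDiffAt.continuousAt.eventually_ne hg
  have hinv : SmoothFnAt (fun q ↦ 2 * (S.g q (F₁ q) (F₂ q))⁻¹) p :=
    (SmoothFnAt.const 2).mul (SmoothFnAt.comp_contDiffAt
      ((eventually_ne_nhds hg).mono fun y hy ↦ contDiffAt_inv ℝ hy) hfn)
  refine ⟨s, F₁, _, hs, hs1, hs2.smul hinv, ?_⟩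
  filter_upwards [hne] with q hq
  refine ⟨he1 q, ?_, ?_⟩
  · rw [Pi.smul_apply', map_smul, he2, smul_comm]
  · rw [Pi.smul_apply', map_smul, smul_eq_mul]
    field_simp

end AdaptedFrames

/-! ### Pulling back frames and brackets by local diffeomorphisms and local equivalences. -/

section Pullback

set_option linter.unusedSectionVars false

variable {M : Type*} [TopologicalSpace M] [ChartedSpace E3 M] [IsManifold (𝓡 3) ∞ M]
  {N : Type*} [TopologicalSpace N] [ChartedSpace E3 N] [IsManifold (𝓡 3) ∞ N]
  {S : ParacontactMetricStructure M} {T : ParacontactMetricStructure N} {s : ℝ} {p : M}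

/-- `F` is a diffeomorphism between open sets. -/
structure IsLocalDiffeo (F : OpenPartialHomeomorph M N) : Prop where
  contMDiffOn : ContMDiffOn (𝓡 3) (𝓡 3) ∞ F F.source
  contMDiffOn_symm : ContMDiffOn (𝓡 3) (𝓡 3) ∞ F.symm F.target

/-- `F` is a diffeomorphism between open sets that preserves the structure tensors. -/
structure IsLocalEquiv (S : ParacontactMetricStructure M) (T : ParacontactMetricStructure N)
    (F : OpenPartialHomeomorph M N) : Prop extends IsLocalDiffeo F where
  preserves : ∀ x ∈ F.source, PreservesAt S T F x

variable {F : OpenPartialHomeomorph M N}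

theorem IsLocalDiffeo.contMDiffAt (h : IsLocalDiffeo F) (hp : p ∈ F.source) :
    ContMDiffAt (𝓡 3) (𝓡 3) ∞ F p :=
  h.contMDiffOn.contMDiffAt (F.open_source.mem_nhds hp)

theorem IsLocalDiffeo.symm (h : IsLocalDiffeo F) : IsLocalDiffeo F.symm :=
  ⟨h.contMDiffOn_symm, by simpa using h.contMDiffOn⟩

theorem IsLocalDiffeo.mdifferentiable (h : IsLocalDiffeo F) : F.MDifferentiable (𝓡 3) (𝓡 3) :=
  ⟨h.contMDiffOn.mdifferentiableOn (by simp), h.contMDiffOn_symm.mdifferentiableOn (by simp)⟩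

theorem IsLocalDiffeo.isInvertible (h : IsLocalDiffeo F) (hp : p ∈ F.source) :
    (mfderiv (𝓡 3) (𝓡 3) F p).IsInvertible :=
  ⟨h.mdifferentiable.mfderiv hp, rfl⟩

theorem eventually_mem_source (hp : p ∈ F.source) : ∀ᶠ q in 𝓝 p, q ∈ F.source :=
  F.open_source.mem_nhds hp

theorem IsLocalDiffeo.mfderiv_mpullback (h : IsLocalDiffeo F) (hp : p ∈ F.source)
    (X : Π q : N, TangentSpace (𝓡 3) q) :
    mfderiv (𝓡 3) (𝓡 3) F p (mpullback (𝓡 3) (𝓡 3) F X p) = X (F p) := by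
  rw [mpullback_apply]
  exact (h.isInvertible hp).self_apply_inverse _

theorem IsLocalDiffeo.smoothVFAt_mpullback (h : IsLocalDiffeo F) (hp : p ∈ F.source)
    {X : Π q : N, TangentSpace (𝓡 3) q} (hX : SmoothVFAt X (F p)) :
    SmoothVFAt (mpullback (𝓡 3) (𝓡 3) F X) p := by
  filter_upwards [eventually_mem_source hp, (F.continuousAt hp).eventually hX] with q hq h2
  exact ContMDiffAt.mpullback_vectorField_preimage (n := ∞) h2 (h.contMDiffAt hq)
    (h.isInvertible hq) (by simp)

theorem IsLocalDiffeo.mfderiv_mlieBracket (h : IsLocalDiffeo F) (hp : p ∈ F.source)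
    {X Y : Π q : N, TangentSpace (𝓡 3) q} (hX : SmoothVFAt X (F p)) (hY : SmoothVFAt Y (F p)) :
    mfderiv (𝓡 3) (𝓡 3) F p (mlieBracket (𝓡 3) (mpullback (𝓡 3) (𝓡 3) F X)
      (mpullback (𝓡 3) (𝓡 3) F Y) p) = mlieBracket (𝓡 3) X Y (F p) := by
  have : minSmoothness ℝ 2 ≤ ∞ := by
    rw [minSmoothness_of_isRCLikeNormedField]
    exact WithTop.coe_le_coe.2 le_top
  rw [← mpullback_mlieBracket hX.mdiffAt hY.mdiffAt (h.contMDiffAt hp) this,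
    h.mfderiv_mpullback hp]

theorem IsLocalDiffeo.trans {O : Type*} [TopologicalSpace O] [ChartedSpace E3 O]
    [IsManifold (𝓡 3) ∞ O] {F' : OpenPartialHomeomorph N O} (h : IsLocalDiffeo F)
    (h' : IsLocalDiffeo F') : IsLocalDiffeo (F.trans F') where
  contMDiffOn := by
    rw [OpenPartialHomeomorph.trans_source]
    exact h'.contMDiffOn.comp (h.contMDiffOn.mono inter_subset_left) fun x hx ↦ hx.2
  contMDiffOn_symm := by
    rw [OpenPartialHomeomorph.trans_target]
    exact h.contMDiffOn_symm.comp (h'.contMDiffOn_symm.mono inter_subset_left) fun x hx ↦ hx.2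

theorem IsLocalDiffeo.mfderiv_trans {O : Type*} [TopologicalSpace O] [ChartedSpace E3 O]
    [IsManifold (𝓡 3) ∞ O] {F' : OpenPartialHomeomorph N O} (h : IsLocalDiffeo F)
    (h' : IsLocalDiffeo F') (hp : p ∈ (F.trans F').source) (v : TangentSpace (𝓡 3) p) :
    mfderiv (𝓡 3) (𝓡 3) (F.trans F') p v =
      mfderiv (𝓡 3) (𝓡 3) F' (F p) (mfderiv (𝓡 3) (𝓡 3) F p v) := by
  rw [OpenPartialHomeomorph.trans_source] at hp
  exact congrArg (fun L ↦ L v) (mfderiv_comp p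
    ((h'.contMDiffAt hp.2).mdifferentiableAt (by simp))
    ((h.contMDiffAt hp.1).mdifferentiableAt (by simp)))

/-- Pulling back a frame by a local diffeomorphism. -/
theorem IsLocalDiffeo.isFrameAt (h : IsLocalDiffeo F) (hp : p ∈ F.source)
    {e : Fin 3 → Π q : N, TangentSpace (𝓡 3) q}
    {θ : Fin 3 → Π q : N, TangentSpace (𝓡 3) q →L[ℝ] ℝ} (he : IsFrameAt e θ (F p)) :
    IsFrameAt (fun i ↦ mpullback (𝓡 3) (𝓡 3) F (e i))
      (fun i q ↦ (θ i (F q)).comp (mfderiv (𝓡 3) (𝓡 3) F q)) p := by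
  -- The push-forward of `X` is its pullback under `F.symm`; this reduces the regularity of the
  -- pulled-back coframe on `X` to that of the given coframe on a field of `N`.
  have key : ∀ {q} (_ : q ∈ F.source) (X : Π q : M, TangentSpace (𝓡 3) q),
      ∀ᶠ x in 𝓝 q, mfderiv (𝓡 3) (𝓡 3) F x (X x) =
        mpullback (𝓡 3) (𝓡 3) F.symm X (F x) := by
    intro q hq X
    filter_upwards [eventually_mem_source hq] with x hx
    apply (h.symm.isInvertible (F.map_source hx)).injective
    rw [h.symm.mfderiv_mpullback (F.map_source hx)]
    have h1 := congrArg (fun L ↦ L (X x)) (h.mdifferentiable.symm_comp_deriv hx)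
    refine Eq.trans h1 ?_
    have : ∀ (a b : M) (_ : a = b), (show E3 from X a) = X b := by
      rintro a _ rfl
      rfl
    exact this _ _ (F.left_inv hx).symm
  refine ⟨fun i ↦ h.smoothVFAt_mpullback hp (he.smooth i), ?_, ?_, ?_⟩
  · filter_upwards [eventually_mem_source hp, (F.continuousAt hp).eventually he.mdiff_coeff]
      with q hq hθ i X hX
    have h1 : MDifferentiableAt (𝓡 3) ((𝓡 3).prod 𝓘(ℝ, E3))
        (fun x ↦ TotalSpace.mk' E3 x (mpullback (𝓡 3) (𝓡 3) F.symm X x)) (F q) :=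
      MDifferentiableAt.mpullback_vectorField (n := ∞) (by rwa [F.left_inv hq])
        (h.symm.contMDiffAt (F.map_source hq)) (h.symm.isInvertible (F.map_source hq))
        (WithTop.coe_le_coe.2 le_top)
    refine ((hθ i _ h1).comp q
      ((h.contMDiffAt hq).mdifferentiableAt (by simp))).congr_of_eventuallyEq ?_
    filter_upwards [key hq X] with x hx
    exact congrArg (θ i (F x)) hx
  · filter_upwards [eventually_mem_source hp, (F.continuousAt hp).eventually he.smooth_coeff]
      with q hq hθ i X hX
    have hX' : SmoothVFAt X (F.symm (F q)) := by rwa [F.left_inv hq]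
    have h1 := hθ i _ (h.symm.smoothVFAt_mpullback (F.map_source hq) hX')
    filter_upwards [(F.continuousAt hq).eventually h1, eventually_mem_source hq,
      eventually_eventually_nhds.2 (key hq X)] with x hx hx1 hx2
    refine (hx.comp x (h.contMDiffAt hx1)).congr_of_eventuallyEq ?_
    filter_upwards [hx2] with y hy
    exact congrArg (θ i (F y)) hy
  · filter_upwards [eventually_mem_source hp, (F.continuousAt hp).eventually he.dual]
      with q hq hd i j
    exact (congrArg (θ i (F q)) (h.mfderiv_mpullback hq (e j))).trans (hd i j)

theorem IsLocalDiffeo.hasStructureConstantsAt (h : IsLocalDiffeo F) (hp : p ∈ F.source)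
    {e : Fin 3 → Π q : N, TangentSpace (𝓡 3) q} (he : ∀ i, SmoothVFAt (e i) (F p))
    {c : Fin 3 → Fin 3 → Fin 3 → ℝ} (hc : HasStructureConstantsAt e c (F p)) :
    HasStructureConstantsAt (fun i ↦ mpullback (𝓡 3) (𝓡 3) F (e i)) c p := by
  filter_upwards [eventually_mem_source hp, (F.continuousAt hp).eventually
    (Filter.eventually_all.2 fun i ↦ (he i).eventually),
    (F.continuousAt hp).eventually hc] with q hq he hc i j
  apply (h.isInvertible hq).injective
  rw [h.mfderiv_mlieBracket hq (he i) (he j), hc, map_sum]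
  exact Finset.sum_congr rfl fun k _ ↦ by rw [map_smul, h.mfderiv_mpullback hq]

theorem IsLocalEquiv.isAdaptedAt (h : IsLocalEquiv S T F) (hp : p ∈ F.source)
    {E₁ E₂ : Π q : N, TangentSpace (𝓡 3) q} (hE : IsAdaptedAt T s E₁ E₂ (F p)) :
    IsAdaptedAt S s (mpullback (𝓡 3) (𝓡 3) F E₁) (mpullback (𝓡 3) (𝓡 3) F E₂) p := by
  refine ⟨hE.sq, h.smoothVFAt_mpullback hp hE.smooth₁, h.smoothVFAt_mpullback hp hE.smooth₂, ?_⟩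
  filter_upwards [eventually_mem_source hp, (F.continuousAt hp).eventually hE.eventually]
    with q hq hE
  have hP := h.preserves q hq
  refine ⟨?_, ?_, ?_⟩
  · apply (h.isInvertible hq).injective
    rw [← hP.map_φ, map_smul, h.mfderiv_mpullback hq, hE.φ₁]
  · apply (h.isInvertible hq).injective
    rw [← hP.map_φ, map_smul, h.mfderiv_mpullback hq, hE.φ₂]
  · rw [← hP.map_g, h.mfderiv_mpullback hq, h.mfderiv_mpullback hq, hE.g₁₂]

theorem IsLocalEquiv.mfderiv_adaptedFrame (h : IsLocalEquiv S T F) (hp : p ∈ F.source)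
    {E₁ E₂ : Π q : N, TangentSpace (𝓡 3) q} (i : Fin 3) :
    mfderiv (𝓡 3) (𝓡 3) F p (adaptedFrame S (mpullback (𝓡 3) (𝓡 3) F E₁)
      (mpullback (𝓡 3) (𝓡 3) F E₂) i p) = adaptedFrame T E₁ E₂ i (F p) := by
  fin_cases i
  · exact (h.preserves p hp).map_ξ
  · exact h.mfderiv_mpullback hp E₁
  · exact h.mfderiv_mpullback hp E₂

/-- The adapted frame of `S` contains the Reeb field of `S` itself rather than a pullback; near `p`
it agrees with the pullback of the Reeb field of `T` because `F` preserves the structure. -/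
theorem IsLocalEquiv.mfderiv_mlieBracket_adaptedFrame (h : IsLocalEquiv S T F) (hp : p ∈ F.source)
    {E₁ E₂ : Π q : N, TangentSpace (𝓡 3) q} (hE : IsAdaptedAt T s E₁ E₂ (F p)) (i j : Fin 3) :
    mfderiv (𝓡 3) (𝓡 3) F p (mlieBracket (𝓡 3) (adaptedFrame S (mpullback (𝓡 3) (𝓡 3) F E₁)
      (mpullback (𝓡 3) (𝓡 3) F E₂) i) (adaptedFrame S (mpullback (𝓡 3) (𝓡 3) F E₁)
      (mpullback (𝓡 3) (𝓡 3) F E₂) j) p) =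
    mlieBracket (𝓡 3) (adaptedFrame T E₁ E₂ i) (adaptedFrame T E₁ E₂ j) (F p) := by
  have key : ∀ i, ∀ᶠ q in 𝓝 p, adaptedFrame S (mpullback (𝓡 3) (𝓡 3) F E₁)
      (mpullback (𝓡 3) (𝓡 3) F E₂) i q = mpullback (𝓡 3) (𝓡 3) F (adaptedFrame T E₁ E₂ i) q := by
    intro i
    filter_upwards [eventually_mem_source hp] with q hq
    apply (h.isInvertible hq).injective
    rw [h.mfderiv_adaptedFrame hq, h.mfderiv_mpullback hq]
  rw [mlieBracket_congr (key i) (key j)]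
  exact h.mfderiv_mlieBracket hp (hE.isFrameAt.smooth i) (hE.isFrameAt.smooth j)

theorem IsLocalEquiv.hasStructureConstantsAt (h : IsLocalEquiv S T F) (hp : p ∈ F.source)
    {E₁ E₂ : Π q : N, TangentSpace (𝓡 3) q} (hE : IsAdaptedAt T s E₁ E₂ (F p))
    {c : Fin 3 → Fin 3 → Fin 3 → ℝ}
    (hc : HasStructureConstantsAt (adaptedFrame T E₁ E₂) c (F p)) :
    HasStructureConstantsAt (adaptedFrame S (mpullback (𝓡 3) (𝓡 3) F E₁)
      (mpullback (𝓡 3) (𝓡 3) F E₂)) c p := by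
  filter_upwards [eventually_mem_source hp, (F.continuousAt hp).eventually hE.eventually,
    (F.continuousAt hp).eventually hc] with q hq hE hc i j
  apply (h.isInvertible hq).injective
  rw [h.mfderiv_mlieBracket_adaptedFrame hq hE, hc, map_sum]
  exact Finset.sum_congr rfl fun k _ ↦ by rw [map_smul, h.mfderiv_adaptedFrame hq]

theorem ParacontactMetricStructure.IsHomogeneous.exists_isLocalEquiv (hS : S.IsHomogeneous)
    (p q : M) : ∃ F : OpenPartialHomeomorph M M, p ∈ F.source ∧ F p = q ∧ IsLocalEquiv S S F := by
  obtain ⟨f, hf, hp⟩ := hS p q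
  exact ⟨f.toHomeomorph.toOpenPartialHomeomorph, mem_univ _, hf,
    ⟨f.contMDiff.contMDiffOn, f.symm.contMDiff.contMDiffOn⟩, fun x _ ↦ hp x⟩

theorem IsLocalEquiv.trans {O : Type*} [TopologicalSpace O] [ChartedSpace E3 O]
    [IsManifold (𝓡 3) ∞ O] {U : ParacontactMetricStructure O} {F' : OpenPartialHomeomorph N O}
    (h : IsLocalEquiv S T F) (h' : IsLocalEquiv T U F') : IsLocalEquiv S U (F.trans F') where
  toIsLocalDiffeo := h.toIsLocalDiffeo.trans h'.toIsLocalDiffeo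
  preserves x hx := by
    have hd' := h.toIsLocalDiffeo.mfderiv_trans h'.toIsLocalDiffeo hx
    rw [OpenPartialHomeomorph.trans_source] at hx
    have h1 := h.preserves x hx.1
    have h2 := h'.preserves (F x) hx.2
    refine ⟨fun v ↦ ?_, ?_, fun v ↦ ?_, fun v w ↦ ?_⟩
    · exact ((congrArg (U.φ (F' (F x))) (hd' v)).trans (h2.map_φ _)).trans
        ((congrArg _ (h1.map_φ v)).trans (hd' _).symm)
    · exact (hd' _).trans ((congrArg _ h1.map_ξ).trans h2.map_ξ)
    · exact (congrArg (U.η (F' (F x))) (hd' v)).trans ((h2.map_η _).trans (h1.map_η v))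
    · exact (congrArg₂ (fun a b ↦ U.g (F' (F x)) a b) (hd' v) (hd' w)).trans
        ((h2.map_g _ _).trans (h1.map_g v w))

end Pullback

/-! ### The brackets of an adapted frame and the Lie derivative of the metric. -/

section Brackets

set_option linter.unusedSectionVars false

variable {M : Type*} [TopologicalSpace M] [ChartedSpace E3 M] [IsManifold (𝓡 3) ∞ M]
  {S : ParacontactMetricStructure M} {s : ℝ} {p : M}
  {X Y E₁ E₂ : Π q : M, TangentSpace (𝓡 3) q}

theorem ParacontactMetricStructure.η_mlieBracket (S : ParacontactMetricStructure M)
    (hX : SmoothVFAt X p) (hY : SmoothVFAt Y p) :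
    S.η p (mlieBracket (𝓡 3) X Y p) = mvfderiv (𝓡 3) (fun q ↦ S.η q (Y q)) p (X p)
      - mvfderiv (𝓡 3) (fun q ↦ S.η q (X q)) p (Y p) - 2 * S.g p (X p) (S.φ p (Y p)) := by
  rw [S.paracontact X Y p hX.mdiffAt hY.mdiffAt]
  ring

theorem ParacontactMetricStructure.η_mlieBracket_ξ (S : ParacontactMetricStructure M)
    (hX : SmoothVFAt X p) :
    S.η p (mlieBracket (𝓡 3) S.ξ X p) = mvfderiv (𝓡 3) (fun q ↦ S.η q (X q)) p (S.ξ p) := by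
  rw [S.η_mlieBracket S.smoothVFAt_ξ hX, S.g_ξ, S.η_φ,
    mvfderiv_of_const (Filter.Eventually.of_forall S.η_ξ)]
  simp

theorem ParacontactMetricStructure.η_mlieBracket_ξ_of_η_const (S : ParacontactMetricStructure M)
    (hX : SmoothVFAt X p) {c : ℝ} (h : ∀ᶠ q in 𝓝 p, S.η q (X q) = c) :
    S.η p (mlieBracket (𝓡 3) S.ξ X p) = 0 := by
  rw [S.η_mlieBracket_ξ hX, mvfderiv_of_const h]
  rfl

/-- As `η(E₁) = η(E₂) = 0`, the contact condition gives `η([E₁, E₂]) = -2 g(E₁, φE₂) = 2s g(E₁,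
E₂)`. -/
theorem IsAdaptedAt.η_mlieBracket (h : IsAdaptedAt S s E₁ E₂ p) :
    S.η p (mlieBracket (𝓡 3) E₁ E₂ p) = 4 * s := by
  rw [S.η_mlieBracket h.smooth₁ h.smooth₂, mvfderiv_of_const (h.eventually.mono fun q hq ↦ hq.η₂),
    mvfderiv_of_const (h.eventually.mono fun q hq ↦ hq.η₁), h.φ₂, map_smul, h.g₁₂]
  simp
  ring

theorem IsAdaptedAt.eq_sum (h : IsAdaptedAt S s E₁ E₂ p) (v : TangentSpace (𝓡 3) p) :
    v = S.η p v • S.ξ p + (1 / 2 * S.g p (E₂ p) v) • E₁ p + (1 / 2 * S.g p (E₁ p) v) • E₂ p := by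
  conv_lhs => rw [h.isFrameAt.eq_sum v, Fin.sum_univ_three]
  rfl

theorem leibniz_mlieBracket {U V W : Π q : M, TangentSpace (𝓡 3) q} (hU : SmoothVFAt U p)
    (hV : SmoothVFAt V p) (hW : SmoothVFAt W p) :
    mlieBracket (𝓡 3) U (mlieBracket (𝓡 3) V W) p = mlieBracket (𝓡 3) (mlieBracket (𝓡 3) U V) W p
      + mlieBracket (𝓡 3) V (mlieBracket (𝓡 3) U W) p := by
  have toC2 : ∀ {X : Π p : M, TangentSpace (𝓡 3) p}, SmoothVFAt X p →
      ContMDiffAt (𝓡 3) ((𝓡 3).prod 𝓘(ℝ, E3)) (minSmoothness ℝ 2)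
        (fun q : M ↦ TotalSpace.mk' E3 q (X q)) p := by
    intro X hX
    refine hX.contMDiffAt.of_le ?_
    rw [minSmoothness_of_isRCLikeNormedField]
    exact WithTop.coe_le_coe.2 le_top
  exact leibniz_identity_mlieBracket_apply (toC2 hU) (toC2 hV) (toC2 hW)

/-- `g([ξ, E₁], E₂) + g([ξ, E₂], E₁) = 0`, by the `ξ`-component of the Jacobi identity. -/
theorem IsAdaptedAt.g_mlieBracket_add (h : IsAdaptedAt S s E₁ E₂ p) :
    S.g p (E₁ p) (mlieBracket (𝓡 3) S.ξ E₂ p) = - S.g p (E₂ p) (mlieBracket (𝓡 3) S.ξ E₁ p) := by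
  have hξ := S.smoothVFAt_ξ (p := p)
  -- The left side is `η([ξ, [E₁, E₂]]) = ξ(4s) = 0`. The remaining two terms express that `ξ`
  -- preserves `dη`, which makes the bracket with `ξ` trace-free on `ker η`.
  have J := congrArg (S.η p) (leibniz_mlieBracket hξ h.smooth₁ h.smooth₂)
  have e1 : ∀ᶠ q in 𝓝 p, S.η q (mlieBracket (𝓡 3) S.ξ E₁ q) = 0 := by
    filter_upwards [h.eventually] with q hq
    exact S.η_mlieBracket_ξ_of_η_const hq.smooth₁ (hq.eventually.mono fun _ h ↦ h.η₁)
  have e2 : ∀ᶠ q in 𝓝 p, S.η q (mlieBracket (𝓡 3) S.ξ E₂ q) = 0 := by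
    filter_upwards [h.eventually] with q hq
    exact S.η_mlieBracket_ξ_of_η_const hq.smooth₂ (hq.eventually.mono fun _ h ↦ h.η₂)
  rw [S.η_mlieBracket_ξ_of_η_const (h.smooth₁.mlieBracket h.smooth₂)
      (h.eventually.mono fun _ h ↦ h.η_mlieBracket), map_add,
    S.η_mlieBracket (hξ.mlieBracket h.smooth₁) h.smooth₂,
    S.η_mlieBracket h.smooth₁ (hξ.mlieBracket h.smooth₂), mvfderiv_of_const e1,
    mvfderiv_of_const e2, mvfderiv_of_const (h.eventually.mono fun _ h ↦ h.η₁),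
    mvfderiv_of_const (h.eventually.mono fun _ h ↦ h.η₂)] at J
  have e3 := S.g_φ_left p (E₁ p) (mlieBracket (𝓡 3) S.ξ E₂ p)
  rw [h.φ₁, map_smul, smul_apply, smul_eq_mul] at e3
  rw [h.φ₂, map_smul, smul_eq_mul, S.g_symm p _ (E₂ p)] at J
  simp only [zero_apply] at J
  linear_combination (-s / 2) * J + s * e3 + (S.g p (E₁ p) (mlieBracket (𝓡 3) S.ξ E₂ p)
    + S.g p (E₂ p) (mlieBracket (𝓡 3) S.ξ E₁ p)) * (-h.sq)

/-- The structure constants of an adapted frame. -/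
def adaptedConst (s P α β A B : ℝ) : Fin 3 → Fin 3 → Fin 3 → ℝ :=
  ![![![0, 0, 0], ![0, P, α], ![0, β, -P]],
    ![![0, -P, -α], ![0, 0, 0], ![4 * s, A, B]],
    ![![0, -β, P], ![-(4 * s), -A, -B], ![0, 0, 0]]]

/-- The function `g(E, [ξ, E]) / 2`. -/
def selfBracket (S : ParacontactMetricStructure M) (E : Π q : M, TangentSpace (𝓡 3) q) (q : M) : ℝ :=
  1 / 2 * S.g q (E q) (mlieBracket (𝓡 3) S.ξ E q)

theorem IsAdaptedAt.mlieBracket_ξ₁ (h : IsAdaptedAt S s E₁ E₂ p) :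
    mlieBracket (𝓡 3) S.ξ E₁ p = (1 / 2 * S.g p (E₂ p) (mlieBracket (𝓡 3) S.ξ E₁ p)) • E₁ p
      + selfBracket S E₁ p • E₂ p := by
  conv_lhs => rw [h.eq_sum (mlieBracket (𝓡 3) S.ξ E₁ p),
    S.η_mlieBracket_ξ_of_η_const h.smooth₁ (h.eventually.mono fun _ h ↦ h.η₁), zero_smul, zero_add]
  rfl

theorem IsAdaptedAt.mlieBracket_ξ₂ (h : IsAdaptedAt S s E₁ E₂ p) :
    mlieBracket (𝓡 3) S.ξ E₂ p = selfBracket S E₂ p • E₁ p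
      + (-(1 / 2 * S.g p (E₂ p) (mlieBracket (𝓡 3) S.ξ E₁ p))) • E₂ p := by
  conv_lhs => rw [h.eq_sum (mlieBracket (𝓡 3) S.ξ E₂ p),
    S.η_mlieBracket_ξ_of_η_const h.smooth₂ (h.eventually.mono fun _ h ↦ h.η₂), zero_smul, zero_add,
    h.g_mlieBracket_add, mul_neg]
  rfl

theorem IsAdaptedAt.mlieBracket₁₂ (h : IsAdaptedAt S s E₁ E₂ p) :
    mlieBracket (𝓡 3) E₁ E₂ p = (4 * s) • S.ξ p
      + (1 / 2 * S.g p (E₂ p) (mlieBracket (𝓡 3) E₁ E₂ p)) • E₁ p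
      + (1 / 2 * S.g p (E₁ p) (mlieBracket (𝓡 3) E₁ E₂ p)) • E₂ p := by
  conv_lhs => rw [h.eq_sum (mlieBracket (𝓡 3) E₁ E₂ p), h.η_mlieBracket]

theorem mlieBracket_adaptedFrame {P α β A B : ℝ}
    (h01 : mlieBracket (𝓡 3) S.ξ E₁ p = P • E₁ p + α • E₂ p)
    (h02 : mlieBracket (𝓡 3) S.ξ E₂ p = β • E₁ p + (-P) • E₂ p)
    (h12 : mlieBracket (𝓡 3) E₁ E₂ p = (4 * s) • S.ξ p + A • E₁ p + B • E₂ p) (i j : Fin 3) :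
    mlieBracket (𝓡 3) (adaptedFrame S E₁ E₂ i) (adaptedFrame S E₁ E₂ j) p =
      ∑ k, adaptedConst s P α β A B i j k • adaptedFrame S E₁ E₂ k p := by
  rw [Fin.sum_univ_three]
  have h3 : ∀ x y z : ℝ, x • adaptedFrame S E₁ E₂ 0 p + y • adaptedFrame S E₁ E₂ 1 p +
    z • adaptedFrame S E₁ E₂ 2 p = x • S.ξ p + y • E₁ p + z • E₂ p := fun _ _ _ ↦ rfl
  rw [h3]
  have hz : ∀ x : TangentSpace (𝓡 3) p, x = 0 →
    x = (0 : ℝ) • S.ξ p + (0 : ℝ) • E₁ p + (0 : ℝ) • E₂ p := fun x hx ↦ by rw [hx]; module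
  fin_cases i <;> fin_cases j
  · exact hz _ (by simp)
  · exact h01.trans (by change _ = (0 : ℝ) • S.ξ p + P • E₁ p + α • E₂ p; module)
  · exact h02.trans (by change _ = (0 : ℝ) • S.ξ p + β • E₁ p + (-P) • E₂ p; module)
  · exact mlieBracket_swap_apply.trans ((congrArg Neg.neg h01).trans
      (by change _ = (0 : ℝ) • S.ξ p + (-P) • E₁ p + (-α) • E₂ p; module))
  · exact hz _ (by simp)
  · exact h12
  · exact mlieBracket_swap_apply.trans ((congrArg Neg.neg h02).trans
      (by change _ = (0 : ℝ) • S.ξ p + (-β) • E₁ p + P • E₂ p; module))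
  · exact mlieBracket_swap_apply.trans ((congrArg Neg.neg h12).trans
      (by change _ = (-(4 * s)) • S.ξ p + (-A) • E₁ p + (-B) • E₂ p; module))
  · exact hz _ (by simp)

/-- The Lie derivative of the metric along the Reeb field. -/
theorem IsAdaptedAt.lieDerivMetric_eq (h : IsAdaptedAt S s E₁ E₂ p) (v w : TangentSpace (𝓡 3) p) :
    lieDerivMetric S.g S.ξ (FiberBundle.extend E3 v) (FiberBundle.extend E3 w) p =
      -(4 * selfBracket S E₁ p * (adaptedCoframe S E₁ E₂ 1 p v * adaptedCoframe S E₁ E₂ 1 p w)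
      + 4 * selfBracket S E₂ p *
        (adaptedCoframe S E₁ E₂ 2 p v * adaptedCoframe S E₁ E₂ 2 p w)) := by
  have := h.isFrameAt.lieDerivMetric_eq (mlieBracket_adaptedFrame h.mlieBracket_ξ₁ h.mlieBracket_ξ₂
    h.mlieBracket₁₂ 0) h.hasGramAt (fun X Y hX hY ↦ S.mdiffAt_g hX hY) v w
  refine this.trans ?_
  simp only [Fin.sum_univ_three, adaptedConst, adaptedGram]
  simp
  ring

/-- Since the hypothesis covers the frame with `E₁`, `E₂` exchanged and `s` replaced by `-s`, both
self-brackets vanish. They are the only components of `𝓛_ξ g`, so the soliton equation becomes the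
Einstein equation. -/
theorem isEinstein_of_selfBracket_eq_zero (h : ∀ (p : M) (s : ℝ)
      (E₁ E₂ : Π q : M, TangentSpace (𝓡 3) q), IsAdaptedAt S s E₁ E₂ p → selfBracket S E₂ p = 0)
    (hS : S.IsRicciSoliton) : S.IsEinstein := by
  obtain ⟨D, hD, c, hc⟩ := hS
  refine ⟨D, hD, c, fun p v w ↦ ?_⟩
  obtain ⟨s, E₁, E₂, hE⟩ := exists_isAdaptedAt S p
  have := hc p v w
  rw [hE.lieDerivMetric_eq, h p s E₁ E₂ hE, h p _ E₂ E₁ hE.swap] at this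
  simpa using this

/-- Structure constants from bracket functions that are constant near `p`. -/
theorem IsAdaptedAt.hasStructureConstantsAt (h : IsAdaptedAt S s E₁ E₂ p) {P α β A B : ℝ}
    (hP : ∀ᶠ q in 𝓝 p, 1 / 2 * S.g q (E₂ q) (mlieBracket (𝓡 3) S.ξ E₁ q) = P)
    (hα : ∀ᶠ q in 𝓝 p, selfBracket S E₁ q = α) (hβ : ∀ᶠ q in 𝓝 p, selfBracket S E₂ q = β)
    (hA : ∀ᶠ q in 𝓝 p, 1 / 2 * S.g q (E₂ q) (mlieBracket (𝓡 3) E₁ E₂ q) = A)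
    (hB : ∀ᶠ q in 𝓝 p, 1 / 2 * S.g q (E₁ q) (mlieBracket (𝓡 3) E₁ E₂ q) = B) :
    HasStructureConstantsAt (adaptedFrame S E₁ E₂) (adaptedConst s P α β A B) p := by
  filter_upwards [h.eventually, hP, hα, hβ, hA, hB] with q h hP hα hβ hA hB
  refine mlieBracket_adaptedFrame ?_ ?_ ?_
  · rw [← hP, ← hα]; exact h.mlieBracket_ξ₁
  · rw [← hP, ← hβ]; exact h.mlieBracket_ξ₂
  · rw [← hA, ← hB]; exact h.mlieBracket₁₂

end Brackets

/-! ### Homogeneity and constant structure functions. -/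

section Homogeneous

set_option linter.unusedSectionVars false

variable {M : Type*} [TopologicalSpace M] [ChartedSpace E3 M] [IsManifold (𝓡 3) ∞ M]
  {S : ParacontactMetricStructure M} {s : ℝ} {p : M}
  {X E₁ E₂ F₁ F₂ : Π q : M, TangentSpace (𝓡 3) q}

/-- In `[ξ, tX] = ξ(t) X + t [ξ, X]` the derivative of `t` is killed by `g(X, X) = 0`. The quadratic
scaling allows a nonzero self-bracket to be normalised. -/
theorem selfBracket_smul (hX : SmoothVFAt X p) (h0 : S.g p (X p) (X p) = 0) {t : M → ℝ}
    (ht : SmoothFnAt t p) : selfBracket S (t • X) p = t p * t p * selfBracket S X p := by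
  rw [selfBracket, mlieBracket_smul_right ht.mdiffAt hX.mdiffAt, selfBracket]
  simp [h0]
  ring

theorem ParacontactMetricStructure.g_eq_zero_of_φ_eq (S : ParacontactMetricStructure M)
    {v w : TangentSpace (𝓡 3) p} (hs : s * s = 1) (hv : S.φ p v = s • v) (hw : S.φ p w = s • w) :
    S.g p v w = 0 := by
  have := S.compatible p v w
  rw [hv, hw, S.η_eq_zero_of_φ_eq hs hv] at this
  simp only [map_smul, smul_apply, smul_eq_mul] at this
  rw [← mul_assoc, hs] at this
  linarith

theorem IsAdaptedAt.eq_smul (h : IsAdaptedAt S s E₁ E₂ p) (h' : IsAdaptedAt S s F₁ F₂ p) :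
    F₁ p = (1 / 2 * S.g p (E₂ p) (F₁ p)) • E₁ p ∧ F₂ p = (1 / 2 * S.g p (E₁ p) (F₂ p)) • E₂ p := by
  have e1 := h.eq_sum (F₁ p)
  have e2 := h.eq_sum (F₂ p)
  rw [h'.η₁, S.g_eq_zero_of_φ_eq h.sq h.φ₁ h'.φ₁] at e1
  rw [h'.η₂, S.g_eq_zero_of_φ_eq (by linarith [h.sq]) h.φ₂ h'.φ₂] at e2
  constructor
  · refine e1.trans ?_
    simp
  · refine e2.trans ?_
    simp

/-- A continuous function with values in `{1, -1}` is locally constant. -/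
theorem eventually_eq_of_mul_self {f : M → ℝ} (hf : ContinuousAt f p)
    (h : ∀ᶠ q in 𝓝 p, f q * f q = f p * f p) : ∀ᶠ q in 𝓝 p, f q = f p := by
  by_cases h0 : f p = 0
  · filter_upwards [h] with q hq
    rw [h0, mul_zero] at hq
    rw [h0, mul_self_eq_zero.1 hq]
  · have h1 : ∀ᶠ q in 𝓝 p, f q ≠ -f p := by
      refine hf.eventually_ne fun h2 ↦ h0 ?_
      linarith
    filter_upwards [h, h1] with q hq hne
    exact (mul_self_eq_mul_self_iff.1 hq).resolve_right hne

/-- Eigenvectors for the same eigenvalue are proportional, so `F₂ = t E₂`; equality of the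
self-brackets forces `t² = 1`, and by continuity `t` is a constant sign. The normalisation `g(F₁,
F₂) = 2` then gives `F₁` the factor `t⁻¹ = t`. A normalised frame is therefore rigid up to a common
sign. -/
theorem IsAdaptedAt.eq_sign_smul (h : IsAdaptedAt S s E₁ E₂ p) (h' : IsAdaptedAt S s F₁ F₂ p)
    {b : ℝ} (hb : b ≠ 0) (hE : ∀ᶠ q in 𝓝 p, selfBracket S E₂ q = b)
    (hF : ∀ᶠ q in 𝓝 p, selfBracket S F₂ q = b) :
    ∃ ε : ℝ, ε * ε = 1 ∧ ∀ᶠ q in 𝓝 p, F₁ q = ε • E₁ q ∧ F₂ q = ε • E₂ q := by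
  set t : M → ℝ := fun q ↦ 1 / 2 * S.g q (E₁ q) (F₂ q) with ht_def
  have ht : SmoothFnAt t p := (SmoothFnAt.const _).mul (S.smoothFnAt_g h.smooth₁ h'.smooth₂)
  have hF2 : ∀ᶠ q in 𝓝 p, F₂ q = t q • E₂ q := by
    filter_upwards [h.eventually, h'.eventually] with q h h' using (h.eq_smul h').2
  have ht2 : ∀ᶠ q in 𝓝 p, t q * t q = 1 := by
    filter_upwards [h.eventually, ht.eventually, hE, hF, eventually_eventually_nhds.2 hF2]
      with q h ht hE hF hF2
    have h1 := selfBracket_smul h.smooth₂ h.g₂₂ ht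
    have h2 : selfBracket S (t • E₂) q = selfBracket S F₂ q := by
      rw [selfBracket, selfBracket, mlieBracket_congr (Filter.Eventually.of_forall fun _ ↦ rfl)
        (hF2.mono fun x hx ↦ hx), hF2.self_of_nhds]
      rfl
    rw [← h2, h1, hE] at hF
    exact mul_right_cancel₀ hb (hF.trans (one_mul b).symm)
  refine ⟨t p, ht2.self_of_nhds, ?_⟩
  have htc := eventually_eq_of_mul_self ht.contMDiffAt.continuousAt
    (ht2.mono fun q hq ↦ hq.trans ht2.self_of_nhds.symm)
  filter_upwards [h.eventually, h'.eventually, hF2, htc] with q h h' hF2 htc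
  rw [htc] at hF2
  refine ⟨?_, hF2⟩
  have h1 := h'.g₁₂
  rw [hF2, map_smul, smul_eq_mul, S.g_symm] at h1
  have h2 := (h.eq_smul h').1
  rw [show 1 / 2 * S.g q (E₂ q) (F₁ q) = t p by
    linear_combination (1 / 2 * t p) * h1 - (1 / 2 * S.g q (E₂ q) (F₁ q)) * ht2.self_of_nhds] at h2
  exact h2

/-- Multiplying `E₂` by `|β|^(-1/2)` and `E₁` by `|β|^(1/2)`, where `β` is the self-bracket of `E₂`,
replaces `β` by its sign `σ`, which is the witness for `b`. -/
theorem exists_isAdaptedAt_selfBracket_const (h : IsAdaptedAt S s E₁ E₂ p)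
    (h0 : selfBracket S E₂ p ≠ 0) : ∃ F₁ F₂ b, IsAdaptedAt S s F₁ F₂ p ∧ b ≠ 0 ∧
      ∀ᶠ q in 𝓝 p, selfBracket S F₂ q = b := by
  have hs : SmoothFnAt (selfBracket S E₂) p :=
    (SmoothFnAt.const _).mul (S.smoothFnAt_g h.smooth₂ (S.smoothVFAt_ξ.mlieBracket h.smooth₂))
  obtain ⟨σ, hσ, hpos⟩ : ∃ σ : ℝ, σ * σ = 1 ∧ 0 < σ * selfBracket S E₂ p := by
    rcases lt_or_gt_of_ne h0 with h | h
    · exact ⟨-1, by norm_num, by linarith⟩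
    · exact ⟨1, by norm_num, by linarith⟩
  have hp : ∀ᶠ y in 𝓝 (selfBracket S E₂ p), 0 < σ * y :=
    (isOpen_lt continuous_const (continuous_const.mul continuous_id)).mem_nhds hpos
  have hu : SmoothFnAt (fun q ↦ Real.sqrt (σ * selfBracket S E₂ q)) p := by
    refine SmoothFnAt.comp_contDiffAt (F := fun y ↦ Real.sqrt (σ * y)) ?_ hs
    filter_upwards [hp] with y hy
    exact (Real.contDiffAt_sqrt hy.ne').comp y (contDiffAt_const.mul contDiffAt_id)
  have ht : SmoothFnAt (fun q ↦ (Real.sqrt (σ * selfBracket S E₂ q))⁻¹) p := by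
    refine SmoothFnAt.comp_contDiffAt (F := fun y ↦ y⁻¹) ?_ hu
    filter_upwards [eventually_ne_nhds (Real.sqrt_pos.2 hpos).ne'] with y hy
    exact contDiffAt_inv ℝ hy
  have hpos' := hs.contMDiffAt.continuousAt.eventually hp
  refine ⟨_, _, σ, ⟨h.sq, h.smooth₁.smul hu, h.smooth₂.smul ht, ?_⟩, ?_, ?_⟩
  · filter_upwards [h.eventually, hpos'] with q h hq
    refine ⟨?_, ?_, ?_⟩
    · rw [Pi.smul_apply', map_smul, h.φ₁, smul_comm]
    · rw [Pi.smul_apply', map_smul, h.φ₂, smul_comm]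
    · rw [Pi.smul_apply', Pi.smul_apply', map_smul, map_smul, smul_apply, h.g₁₂,
        smul_eq_mul, smul_eq_mul, ← mul_assoc, inv_mul_cancel₀ (Real.sqrt_pos.2 hq).ne', one_mul]
  · rintro rfl
    norm_num at hσ
  · filter_upwards [h.eventually, hpos', ht.eventually] with q h hq ht
    rw [selfBracket_smul h.smooth₂ h.g₂₂ ht]
    have hq0 : selfBracket S E₂ q ≠ 0 := fun h0 ↦ by
      rw [h0, mul_zero] at hq
      exact hq.false
    rw [← mul_inv, Real.mul_self_sqrt hq.le, mul_inv, mul_assoc, inv_mul_cancel₀ hq0, mul_one]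
    exact inv_eq_of_mul_eq_one_left hσ

theorem mlieBracket_const_smul_congr {X Y X' Y' : Π q : M, TangentSpace (𝓡 3) q} {a b : ℝ}
    (hX : SmoothVFAt X p) (hY : SmoothVFAt Y p) (eX : ∀ᶠ q in 𝓝 p, X' q = a • X q)
    (eY : ∀ᶠ q in 𝓝 p, Y' q = b • Y q) :
    mlieBracket (𝓡 3) X' Y' p = (a * b) • mlieBracket (𝓡 3) X Y p := by
  have hY' : SmoothVFAt (b • Y) p := SmoothVFAt.smul (SmoothFnAt.const b) hY
  rw [mlieBracket_congr (X' := a • X) (Y' := b • Y) eX eY, mlieBracket_const_smul_left hX.mdiffAt,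
    mlieBracket_const_smul_right hY.mdiffAt, smul_smul]

/-- Once the self-bracket of `E₂` is a nonzero constant, an automorphism taking `p` to `q` pulls the
frame back to itself up to a sign `ε`. The coefficients of `[ξ, E₁]` are even in this sign, so they
agree at `p` and `q`. Those of `[E₁, E₂]` along `E₁` and `E₂` are odd, so only their squares agree;
since `ε` may depend on `q`, continuity is used to conclude that they too are locally constant. -/
theorem ParacontactMetricStructure.IsHomogeneous.exists_hasStructureConstantsAt
    (hS : S.IsHomogeneous) (h : IsAdaptedAt S s E₁ E₂ p) (h0 : selfBracket S E₂ p ≠ 0) :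
    ∃ (F₁ F₂ : Π q : M, TangentSpace (𝓡 3) q) (P α β A B : ℝ), IsAdaptedAt S s F₁ F₂ p ∧ β ≠ 0 ∧
      HasStructureConstantsAt (adaptedFrame S F₁ F₂) (adaptedConst s P α β A B) p := by
  obtain ⟨E₁, E₂, b, h, hb, hβ⟩ := exists_isAdaptedAt_selfBracket_const h h0
  have hξ := S.smoothVFAt_ξ (p := p)
  have key : ∀ᶠ q in 𝓝 p, ∃ ε : ℝ, ε * ε = 1 ∧
      1 / 2 * S.g q (E₂ q) (mlieBracket (𝓡 3) S.ξ E₁ q) =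
        1 / 2 * S.g p (E₂ p) (mlieBracket (𝓡 3) S.ξ E₁ p) ∧
      selfBracket S E₁ q = selfBracket S E₁ p ∧
      1 / 2 * S.g q (E₂ q) (mlieBracket (𝓡 3) E₁ E₂ q) =
        ε * (1 / 2 * S.g p (E₂ p) (mlieBracket (𝓡 3) E₁ E₂ p)) ∧
      1 / 2 * S.g q (E₁ q) (mlieBracket (𝓡 3) E₁ E₂ q) =
        ε * (1 / 2 * S.g p (E₁ p) (mlieBracket (𝓡 3) E₁ E₂ p)) := by
    filter_upwards [h.eventually, eventually_eventually_nhds.2 hβ] with q hq hβq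
    obtain ⟨F, hpF, rfl, hF⟩ := hS.exists_isLocalEquiv p q
    have h' := hF.isAdaptedAt hpF hq
    have gF : ∀ x ∈ F.source, ∀ X Y : Π q : M, TangentSpace (𝓡 3) q, S.g x
        (mpullback (𝓡 3) (𝓡 3) F X x) (mpullback (𝓡 3) (𝓡 3) F Y x) = S.g (F x) (X (F x)) (Y (F x)) :=
      fun x hx X Y ↦ by
        rw [← (hF.preserves x hx).map_g, hF.mfderiv_mpullback hx, hF.mfderiv_mpullback hx]
    have gF' : ∀ x ∈ F.source, ∀ (X : Π q : M, TangentSpace (𝓡 3) q) (v : TangentSpace (𝓡 3) x),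
        S.g x (mpullback (𝓡 3) (𝓡 3) F X x) v =
          S.g (F x) (X (F x)) (mfderiv (𝓡 3) (𝓡 3) F x v) := fun x hx X v ↦ by
        rw [← (hF.preserves x hx).map_g, hF.mfderiv_mpullback hx]
    have bF := fun x (hx : x ∈ F.source) (hE : IsAdaptedAt S s E₁ E₂ (F x)) ↦
      hF.mfderiv_mlieBracket_adaptedFrame hx hE
    have hβ' : ∀ᶠ x in 𝓝 p, selfBracket S (mpullback (𝓡 3) (𝓡 3) F E₂) x = b := by
      filter_upwards [eventually_mem_source hpF, (F.continuousAt hpF).eventually hβq,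
        (F.continuousAt hpF).eventually hq.eventually] with x hx h1 h2
      rw [← h1, selfBracket, selfBracket, gF' x hx]
      congr 2
      exact bF x hx h2 0 2
    obtain ⟨ε, hε, heq⟩ := h.eq_sign_smul h' hb hβ hβ'
    have b01 := bF p hpF hq 0 1
    have b12 := bF p hpF hq 1 2
    have e01 : mlieBracket (𝓡 3) S.ξ (mpullback (𝓡 3) (𝓡 3) F E₁) p =
        (1 * ε) • mlieBracket (𝓡 3) S.ξ E₁ p :=
      mlieBracket_const_smul_congr hξ h.smooth₁ (Filter.Eventually.of_forall fun _ ↦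
        (one_smul ℝ _).symm) (heq.mono fun _ h ↦ h.1)
    have e12 : mlieBracket (𝓡 3) (mpullback (𝓡 3) (𝓡 3) F E₁) (mpullback (𝓡 3) (𝓡 3) F E₂) p =
        (ε * ε) • mlieBracket (𝓡 3) E₁ E₂ p :=
      mlieBracket_const_smul_congr h.smooth₁ h.smooth₂ (heq.mono fun _ h ↦ h.1)
        (heq.mono fun _ h ↦ h.2)
    have E1 := heq.self_of_nhds.1
    have E2 := heq.self_of_nhds.2
    change mfderiv (𝓡 3) (𝓡 3) F p (mlieBracket (𝓡 3) S.ξ (mpullback (𝓡 3) (𝓡 3) F E₁) p) =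
      mlieBracket (𝓡 3) S.ξ E₁ (F p) at b01
    change mfderiv (𝓡 3) (𝓡 3) F p (mlieBracket (𝓡 3) (mpullback (𝓡 3) (𝓡 3) F E₁)
      (mpullback (𝓡 3) (𝓡 3) F E₂) p) = mlieBracket (𝓡 3) E₁ E₂ (F p) at b12
    refine ⟨ε, hε, ?_, ?_, ?_, ?_⟩
    · rw [← b01, ← gF' p hpF, E2, e01]
      simp only [map_smul, smul_apply, smul_eq_mul]
      linear_combination (1 / 2 * S.g p (E₂ p) (mlieBracket (𝓡 3) S.ξ E₁ p)) * hε
    · rw [selfBracket, selfBracket, ← b01, ← gF' p hpF, E1, e01]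
      simp only [map_smul, smul_apply, smul_eq_mul]
      linear_combination (1 / 2 * S.g p (E₁ p) (mlieBracket (𝓡 3) S.ξ E₁ p)) * hε
    · rw [← b12, ← gF' p hpF, E2, e12]
      simp only [map_smul, smul_apply, smul_eq_mul]
      linear_combination (1 / 2 * ε * S.g p (E₂ p) (mlieBracket (𝓡 3) E₁ E₂ p)) * hε
    · rw [← b12, ← gF' p hpF, E1, e12]
      simp only [map_smul, smul_apply, smul_eq_mul]
      linear_combination (1 / 2 * ε * S.g p (E₁ p) (mlieBracket (𝓡 3) E₁ E₂ p)) * hε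
  have cont : ∀ {X : Π q : M, TangentSpace (𝓡 3) q}, SmoothVFAt X p →
      ContinuousAt (fun q ↦ 1 / 2 * S.g q (X q) (mlieBracket (𝓡 3) E₁ E₂ q)) p := fun hX ↦
    ((SmoothFnAt.const (1 / 2)).mul
      (S.smoothFnAt_g hX (h.smooth₁.mlieBracket h.smooth₂))).contMDiffAt.continuousAt
  refine ⟨E₁, E₂, _, _, b, _, _, h, hb, h.hasStructureConstantsAt
    (key.mono fun q ⟨ε, h0, h1, h2, h3, h4⟩ ↦ h1) (key.mono fun q ⟨ε, h0, h1, h2, h3, h4⟩ ↦ h2) hβ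
    (eventually_eq_of_mul_self (cont h.smooth₂) (key.mono fun q ⟨ε, h0, h1, h2, h3, h4⟩ ↦ ?_))
    (eventually_eq_of_mul_self (cont h.smooth₁) (key.mono fun q ⟨ε, h0, h1, h2, h3, h4⟩ ↦ ?_))⟩
  · simp only [h3]
    linear_combination (1 / 2 * S.g p (E₂ p) (mlieBracket (𝓡 3) E₁ E₂ p)) ^ 2 * h0
  · simp only [h4]
    linear_combination (1 / 2 * S.g p (E₁ p) (mlieBracket (𝓡 3) E₁ E₂ p)) ^ 2 * h0

end Homogeneous

/-! ### The soliton equation as an algebraic system. -/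

section Soliton

set_option linter.unusedSectionVars false

variable {M : Type*} [TopologicalSpace M] [ChartedSpace E3 M] [IsManifold (𝓡 3) ∞ M]
  {S : ParacontactMetricStructure M} {s P α β A B : ℝ} {p : M} {D : Connection M}
  {E₁ E₂ : Π q : M, TangentSpace (𝓡 3) q}

theorem forall_fin_three {Q : Fin 3 → Prop} : (∀ i, Q i) ↔ Q 0 ∧ Q 1 ∧ Q 2 := by
  simp [Fin.forall_fin_succ]

/-- The Christoffel symbols of the Levi-Civita connection in an adapted frame. -/
def adaptedSymbol (s P α β A B : ℝ) : Fin 3 → Fin 3 → Fin 3 → ℝ :=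
  ![![![0, 0, 0], ![0, P - s, 0], ![0, 0, s - P]],
    ![![0, -s, -α], ![2 * α, -B, 0], ![2 * s, 0, B]],
    ![![0, -β, s], ![-(2 * s), -A, 0], ![2 * β, 0, A]]]

theorem isLeviCivitaSymbol_adapted : IsLeviCivitaSymbol (adaptedConst s P α β A B)
    (adaptedSymbol s P α β A B) adaptedGram where
  torsion := by
    simp only [forall_fin_three]
    refine ⟨⟨?_, ?_, ?_⟩, ⟨?_, ?_, ?_⟩, ?_, ?_, ?_⟩ <;> refine ⟨?_, ?_, ?_⟩ <;>
      simp [adaptedConst, adaptedSymbol] <;> ring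
  metric := by
    simp only [forall_fin_three, Fin.sum_univ_three]
    refine ⟨⟨?_, ?_, ?_⟩, ⟨?_, ?_, ?_⟩, ?_, ?_, ?_⟩ <;> refine ⟨?_, ?_, ?_⟩ <;>
      simp [adaptedGram, adaptedSymbol] <;> ring

/-- The components of the Ricci tensor in an adapted frame. -/
def adaptedRicci (s P α β A B : ℝ) : Fin 3 → Fin 3 → ℝ :=
  ![![-2 - 2 * α * β, -P * B - α * A, -P * A + β * B],
    ![-2 * α * A, 4 * α * s - 4 * α * P, 4 + 2 * A * B - 4 * P * s],
    ![2 * β * B, 4 + 2 * A * B - 4 * P * s, -4 * β * s + 4 * β * P]]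

/-- The Jacobi identity is not imposed on the constants, so `adaptedRicci` is not symmetric as
written; it becomes symmetric under the Jacobi relations `A P + B β = 0` and `A α = B P`. -/
theorem sum_curvatureCoeff_adapted (hs : s * s = 1) (i l : Fin 3) :
    ∑ u, curvatureCoeff (adaptedConst s P α β A B) (adaptedSymbol s P α β A B) i u l u =
      adaptedRicci s P α β A B i l := by
  simp only [curvatureCoeff, Fin.sum_univ_three]
  revert i l
  simp only [forall_fin_three]
  refine ⟨⟨?_, ?_, ?_⟩, ⟨?_, ?_, ?_⟩, ?_, ?_, ?_⟩ <;>
    simp [adaptedConst, adaptedSymbol, adaptedRicci]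
  all_goals grind

theorem IsAdaptedAt.ricci_eq (h : IsAdaptedAt S s E₁ E₂ p)
    (hc : HasStructureConstantsAt (adaptedFrame S E₁ E₂) (adaptedConst s P α β A B) p)
    (hD : IsLeviCivita S.g D) (v w : TangentSpace (𝓡 3) p) :
    ricci D p v w = ∑ i, ∑ l, adaptedCoframe S E₁ E₂ i p v * adaptedCoframe S E₁ E₂ l p w *
      adaptedRicci s P α β A B i l := by
  rw [h.isFrameAt.ricci_eq hc (h.isFrameAt.hasChristoffelAt hc h.hasGramAt S.g_nondegenerate
    S.g_symm hD isLeviCivitaSymbol_adapted)]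
  simp only [sum_curvatureCoeff_adapted h.sq]

theorem IsAdaptedAt.ricci_frame (h : IsAdaptedAt S s E₁ E₂ p)
    (hc : HasStructureConstantsAt (adaptedFrame S E₁ E₂) (adaptedConst s P α β A B) p)
    (hD : IsLeviCivita S.g D) (i j : Fin 3) :
    ricci D p (adaptedFrame S E₁ E₂ i p) (adaptedFrame S E₁ E₂ j p) =
      adaptedRicci s P α β A B i j := by
  rw [h.ricci_eq hc hD]
  simp [h.isFrameAt.dual_apply]

theorem selfBracket_eq (h : IsAdaptedAt S s E₁ E₂ p)
    (hc : HasStructureConstantsAt (adaptedFrame S E₁ E₂) (adaptedConst s P α β A B) p) :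
    selfBracket S E₁ p = α ∧ selfBracket S E₂ p = β := by
  have h01 := congrArg (adaptedCoframe S E₁ E₂ 2 p) (hc.self_of_nhds 0 1)
  have h02 := congrArg (adaptedCoframe S E₁ E₂ 1 p) (hc.self_of_nhds 0 2)
  rw [h.isFrameAt.coeff_sum] at h01 h02
  exact ⟨h01, h02⟩

theorem IsAdaptedAt.g_eq (h : IsAdaptedAt S s E₁ E₂ p) (v w : TangentSpace (𝓡 3) p) :
    S.g p v w = ∑ i, ∑ l, adaptedCoframe S E₁ E₂ i p v * adaptedCoframe S E₁ E₂ l p w *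
      adaptedGram i l := by
  conv_lhs => rw [h.isFrameAt.eq_sum v, h.isFrameAt.eq_sum w]
  simp only [map_sum, map_smul, sum_apply, smul_apply, smul_eq_mul, h.hasGramAt.self_of_nhds]
  simp only [Fin.sum_univ_three]
  ring

/-- The component `(2,2)` gives `β (P - s - 1) = 0`, after which `(1,1)` reads `-8α = 0`. The
component `(2,0)` is `2βB = 0`. Now `(0,0)` says that the soliton constant is `-2`, so `(1,2)`
becomes `4 - 4s(1 + s) = -4`, that is `s = 1`, and `(0,2)` leaves `A = 0`. -/
theorem ParacontactMetricStructure.IsRicciSoliton.constants_eq (hS : S.IsRicciSoliton)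
    (h : IsAdaptedAt S s E₁ E₂ p) (hβ : β ≠ 0)
    (hc : HasStructureConstantsAt (adaptedFrame S E₁ E₂) (adaptedConst s P α β A B) p) :
    s = 1 ∧ P = 2 ∧ α = 0 ∧ A = 0 ∧ B = 0 := by
  obtain ⟨D, hD, c, hsol⟩ := hS
  have key : ∀ i j, -(4 * α * ((if 1 = i then 1 else 0) * (if 1 = j then 1 else 0))
      + 4 * β * ((if 2 = i then 1 else 0) * (if 2 = j then 1 else 0)))
      + adaptedRicci s P α β A B i j = c * adaptedGram i j := by
    intro i j
    have := hsol p (adaptedFrame S E₁ E₂ i p) (adaptedFrame S E₁ E₂ j p)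
    rwa [h.lieDerivMetric_eq, h.ricci_frame hc hD, h.hasGramAt.self_of_nhds, (selfBracket_eq h hc).1,
      (selfBracket_eq h hc).2, h.isFrameAt.dual_apply, h.isFrameAt.dual_apply,
      h.isFrameAt.dual_apply, h.isFrameAt.dual_apply] at this
  have h00 := key 0 0
  have h02 := key 0 2
  have h11 := key 1 1
  have h12 := key 1 2
  have h20 := key 2 0
  have h22 := key 2 2
  simp [adaptedRicci, adaptedGram] at h00 h02 h11 h12 h20 h22
  have hs := h.sq
  have hP : P = 1 + s := by
    have : 4 * β * (P - s - 1) = 0 := by linear_combination h22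
    rcases mul_eq_zero.1 this with h | h
    · exact absurd h (by positivity)
    · linarith
  have hα : α = 0 := by
    have : α * 8 = 0 := by
      subst hP
      linear_combination -h11
    linarith
  have hB : B = 0 := h20.resolve_left hβ
  subst hα hB hP
  have hs1 : s = 1 := by linear_combination -h12 / 4 + h00 / 2 - hs
  subst hs1
  refine ⟨rfl, by norm_num, rfl, ?_, rfl⟩
  linarith

/-- Near `p` there is an adapted frame with `[ξ, E₁] = 2 E₁`, `[ξ, E₂] = β E₁ - 2 E₂` and
`[E₁, E₂] = 4 ξ`. -/
def HasNormalFrameAt (S : ParacontactMetricStructure M) (β : ℝ) (p : M) : Prop :=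
  ∃ E₁ E₂, IsAdaptedAt S 1 E₁ E₂ p ∧
    HasStructureConstantsAt (adaptedFrame S E₁ E₂) (adaptedConst 1 2 0 β 0 0) p

theorem ParacontactMetricStructure.IsHomogeneous.exists_hasNormalFrameAt (hS : S.IsHomogeneous)
    (hsol : S.IsNontrivialRicciSoliton) : ∃ β p, β ≠ 0 ∧ HasNormalFrameAt S β p := by
  obtain ⟨p, s, E₁, E₂, hE, h0⟩ : ∃ (p : M) (s : ℝ) (E₁ E₂ : Π q : M, TangentSpace (𝓡 3) q),
      IsAdaptedAt S s E₁ E₂ p ∧ selfBracket S E₂ p ≠ 0 := by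
    by_contra! hcon
    exact hsol.2 (isEinstein_of_selfBracket_eq_zero hcon hsol.1)
  obtain ⟨F₁, F₂, P, α, β, A, B, hF, hβ, hc⟩ := hS.exists_hasStructureConstantsAt hE h0
  obtain ⟨rfl, rfl, rfl, rfl, rfl⟩ := hsol.1.constants_eq hF hβ hc
  exact ⟨β, p, hβ, F₁, F₂, hF, hc⟩

/-- For these constants `ϱ = -2 g + 4β θ² ⊗ θ²`, and `𝓛_ξ g = -4β θ² ⊗ θ²` cancels the second term;
hence the soliton constant `-2`. The metric is not Einstein because `ϱ(E₂, E₂) = 4β` on a null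
vector. This last evaluation requires a point of `M`. -/
theorem isNontrivialRicciSoliton_of_hasNormalFrameAt [Nonempty M] (hβ : β ≠ 0)
    (h : ∀ p, HasNormalFrameAt S β p) : S.IsNontrivialRicciSoliton := by
  constructor
  · obtain ⟨D, hD⟩ := exists_isLeviCivita (g := S.g)
      (isLeviCivitaSymbol_adapted (s := 1) (P := 2) (α := 0) (β := β) (A := 0) (B := 0))
      (fun p X Y hX hY ↦ S.mdiffAt_g hX hY) fun p ↦ by
        obtain ⟨E₁, E₂, hE, hc⟩ := h p
        exact ⟨_, _, hE.isFrameAt, hc, hE.hasGramAt⟩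
    refine ⟨D, hD, -2, fun p v w ↦ ?_⟩
    obtain ⟨E₁, E₂, hE, hc⟩ := h p
    rw [hE.lieDerivMetric_eq, hE.ricci_eq hc hD, hE.g_eq, (selfBracket_eq hE hc).1,
      (selfBracket_eq hE hc).2]
    simp only [Fin.sum_univ_three, adaptedRicci, adaptedGram]
    simp
    ring
  · rintro ⟨D, hD, c, hein⟩
    obtain ⟨p⟩ := ‹Nonempty M›
    obtain ⟨E₁, E₂, hE, hc⟩ := h p
    have := hein p (adaptedFrame S E₁ E₂ 2 p) (adaptedFrame S E₁ E₂ 2 p)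
    rw [hE.ricci_frame hc hD, hE.hasGramAt.self_of_nhds] at this
    simp [adaptedRicci, adaptedGram] at this
    apply hβ
    linarith

theorem IsLocalEquiv.hasNormalFrameAt {N : Type*} [TopologicalSpace N] [ChartedSpace E3 N]
    [IsManifold (𝓡 3) ∞ N] {T : ParacontactMetricStructure N} {F : OpenPartialHomeomorph M N}
    (h : IsLocalEquiv S T F) (hp : p ∈ F.source) (hN : HasNormalFrameAt T β (F p)) :
    HasNormalFrameAt S β p := by
  obtain ⟨E₁, E₂, hE, hc⟩ := hN
  exact ⟨_, _, h.isAdaptedAt hp hE, h.hasStructureConstantsAt hp hE hc⟩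

end Soliton

/-! ### Smoothness on `SL(2, ℝ)` in terms of matrix entries. -/

/-- A map into `ℝ³` is smooth if its coordinates are. -/
theorem contMDiffAt_of_coord {N : Type*} [TopologicalSpace N] [ChartedSpace E3 N] {f : N → E3}
    {p : N} (h : ∀ i, ContMDiffAt (𝓡 3) 𝓘(ℝ, ℝ) ∞ (fun q ↦ f q i) p) :
    ContMDiffAt (𝓡 3) 𝓘(ℝ, E3) ∞ f p :=
  (EuclideanSpace.equiv (Fin 3) ℝ).symm.contDiff.contMDiff.contMDiffAt.comp p
    (contMDiffAt_pi_space.2 h)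

namespace SL2R

/-- The matrix entries as functions on `SL(2, ℝ)`. -/
def entry (i j : Fin 2) (g : SL2R) : ℝ := g.1 i j

theorem chartAt_eq (g : SL2R) : (g ∈ chartA.source ∧ chartAt E3 g = chartA) ∨
    (g ∈ chartC.source ∧ chartAt E3 g = chartC) := by
  have h0 := mem_chart_source E3 g
  have h : chartAt E3 g = chartA ∨ chartAt E3 g = chartC := chart_mem_atlas E3 g
  rcases h with h | h
  · exact Or.inl ⟨h ▸ h0, h⟩
  · exact Or.inr ⟨h ▸ h0, h⟩

theorem contMDiffAt_chartAt (g : SL2R) : ContMDiffAt (𝓡 3) 𝓘(ℝ, E3) ∞ (chartAt E3 g) g :=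
  contMDiffAt_extChartAt (I := 𝓡 3) (x := g)

theorem contDiff_coord (i : Fin 3) : ContDiff ℝ ∞ (fun x : E3 ↦ x i) := by fun_prop

/-- In each chart three entries are coordinates, and the determinant condition makes the fourth a
rational function with nonvanishing denominator. -/
theorem contMDiffAt_entry (i j : Fin 2) (g : SL2R) : ContMDiffAt (𝓡 3) 𝓘(ℝ, ℝ) ∞ (entry i j) g := by
  have hc := contMDiffAt_chartAt g
  have main : ∀ f : E3 → ℝ, ContDiffAt ℝ ∞ f (chartAt E3 g g) →
      (∀ x ∈ (chartAt E3 g).source, entry i j x = f (chartAt E3 g x)) →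
      ContMDiffAt (𝓡 3) 𝓘(ℝ, ℝ) ∞ (entry i j) g := by
    intro f hf he
    refine (ContMDiffAt.comp g hf.contMDiffAt hc).congr_of_eventuallyEq ?_
    filter_upwards [(chartAt E3 g).open_source.mem_nhds (mem_chart_source E3 g)] with x hx
      using he x hx
  have hdiv : ∀ (f : E3 → ℝ) (x : E3), x 0 ≠ 0 → ContDiff ℝ ∞ f →
      ContDiffAt ℝ ∞ (fun x ↦ f x / x 0) x := fun f x hx hf ↦
    hf.contDiffAt.div (contDiff_coord 0).contDiffAt hx
  rcases chartAt_eq g with ⟨hg, hch⟩ | ⟨hg, hch⟩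
  · rw [hch] at main
    have hx : ∀ x ∈ chartA.source, x.1 1 1 = (1 + x.1 0 1 * x.1 1 0) / x.1 0 0 := by
      intro x hx
      have hx : x.1 0 0 ≠ 0 := hx
      rw [eq_div_iff hx]
      linarith [det_eq x]
    fin_cases i <;> fin_cases j
    · exact main (fun x ↦ x 0) (contDiff_coord 0).contDiffAt fun x _ ↦ rfl
    · exact main (fun x ↦ x 1) (contDiff_coord 1).contDiffAt fun x _ ↦ rfl
    · exact main (fun x ↦ x 2) (contDiff_coord 2).contDiffAt fun x _ ↦ rfl
    · exact main (fun x ↦ (1 + x 1 * x 2) / x 0) (hdiv _ _ hg (by fun_prop)) hx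
  · rw [hch] at main
    have hx : ∀ x ∈ chartC.source, x.1 0 1 = (x.1 0 0 * x.1 1 1 - 1) / x.1 1 0 := by
      intro x hx
      have hx : x.1 1 0 ≠ 0 := hx
      rw [eq_div_iff hx]
      linarith [det_eq x]
    fin_cases i <;> fin_cases j
    · exact main (fun x ↦ x 1) (contDiff_coord 1).contDiffAt fun x _ ↦ rfl
    · exact main (fun x ↦ (x 1 * x 2 - 1) / x 0) (hdiv _ _ hg (by fun_prop)) hx
    · exact main (fun x ↦ x 0) (contDiff_coord 0).contDiffAt fun x _ ↦ rfl
    · exact main (fun x ↦ x 2) (contDiff_coord 2).contDiffAt fun x _ ↦ rfl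

theorem chartAt_apply (g : SL2R) (k : Fin 3) :
    ∃ i j, ∀ x, (show E3 from chartAt E3 g x) k = entry i j x := by
  rcases chartAt_eq g with ⟨-, h⟩ | ⟨-, h⟩ <;> rw [h] <;> fin_cases k
  exacts [⟨0, 0, fun _ ↦ rfl⟩, ⟨0, 1, fun _ ↦ rfl⟩, ⟨1, 0, fun _ ↦ rfl⟩, ⟨1, 0, fun _ ↦ rfl⟩,
    ⟨0, 0, fun _ ↦ rfl⟩, ⟨1, 1, fun _ ↦ rfl⟩]

section Maps

variable {N : Type*} [TopologicalSpace N] [ChartedSpace E3 N] {f : N → SL2R} {p : N}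

/-- A map into `SL(2, ℝ)` is smooth if the matrix entries are. -/
theorem contMDiffAt_of_entry (h : ∀ i j, ContMDiffAt (𝓡 3) 𝓘(ℝ, ℝ) ∞ (fun q ↦ entry i j (f q)) p) :
    ContMDiffAt (𝓡 3) (𝓡 3) ∞ f p := by
  have hcont : ContinuousAt f p := by
    have hi : Topology.IsInducing (fun g : SL2R ↦ g.1) := ⟨rfl⟩
    rw [hi.continuousAt_iff]
    exact continuousAt_pi.2 fun i ↦ continuousAt_pi.2 fun j ↦ (h i j).continuousAt
  rw [contMDiffAt_iff_target]
  refine ⟨hcont, ?_⟩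
  refine contMDiffAt_of_coord fun k ↦ ?_
  obtain ⟨i, j, hij⟩ := chartAt_apply (f p) k
  exact (h i j).congr_of_eventuallyEq (Filter.Eventually.of_forall fun q ↦ hij (f q))

end Maps

theorem mvfderiv_chartAt (g : SL2R) (k : Fin 3) (i j : Fin 2)
    (h : ∀ x, (show E3 from chartAt E3 g x) k = entry i j x) {q : SL2R}
    (hq : q ∈ (chartAt E3 g).source) (v : TangentSpace (𝓡 3) q) :
    (show E3 from mfderiv (𝓡 3) 𝓘(ℝ, E3) (extChartAt (𝓡 3) g) q v) k =
      mvfderiv (𝓡 3) (entry i j) q v := by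
  have h1 : MDifferentiableAt (𝓡 3) 𝓘(ℝ, E3) (extChartAt (𝓡 3) g) q :=
    mdifferentiableAt_extChartAt hq
  have h2 : HasMFDerivAt 𝓘(ℝ, E3) 𝓘(ℝ, ℝ) (fun x : E3 ↦ x k) (extChartAt (𝓡 3) g q)
      (EuclideanSpace.proj k : E3 →L[ℝ] ℝ) :=
    ((EuclideanSpace.proj k : E3 →L[ℝ] ℝ).hasFDerivAt).hasMFDerivAt
  have h3 := h2.comp q h1.hasMFDerivAt
  have h4 : ((fun x : E3 ↦ x k) ∘ (extChartAt (𝓡 3) g)) = entry i j := funext h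
  rw [h4] at h3
  exact congrArg (fun L ↦ L v) h3.mfderiv.symm

/-- Tangent vectors are determined by the derivatives of the matrix entries. -/
theorem ext_mvfderiv_entry {g : SL2R} {v w : TangentSpace (𝓡 3) g}
    (h : ∀ i j, mvfderiv (𝓡 3) (entry i j) g v = mvfderiv (𝓡 3) (entry i j) g w) : v = w := by
  have hinj := (isInvertible_mfderiv_extChartAt (I := 𝓡 3) (mem_extChartAt_source g)).injective
  apply hinj
  refine PiLp.ext fun k ↦ ?_
  obtain ⟨i, j, hij⟩ := chartAt_apply g k
  exact (mvfderiv_chartAt g k i j hij (mem_chart_source E3 g) v).trans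
    ((h i j).trans (mvfderiv_chartAt g k i j hij (mem_chart_source E3 g) w).symm)

/-- A vector field on `SL(2, ℝ)` is smooth if the derivatives of the matrix entries are. -/
theorem contMDiffAt_vectorField {X : Π g : SL2R, TangentSpace (𝓡 3) g} {p : SL2R}
    (h : ∀ i j, ContMDiffAt (𝓡 3) 𝓘(ℝ, ℝ) ∞ (fun g ↦ mvfderiv (𝓡 3) (entry i j) g (X g)) p) :
    ContMDiffAt (𝓡 3) ((𝓡 3).prod 𝓘(ℝ, E3)) ∞ (fun q : SL2R ↦ TotalSpace.mk' E3 q (X q)) p := by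
  rw [contMDiffAt_section]
  have h1 : ContMDiffAt (𝓡 3) 𝓘(ℝ, E3) ∞ (fun q : SL2R ↦ (show E3 from
      mfderiv (𝓡 3) 𝓘(ℝ, E3) (extChartAt (𝓡 3) p) q (X q))) p := by
    refine contMDiffAt_of_coord fun k ↦ ?_
    obtain ⟨i, j, hij⟩ := chartAt_apply p k
    refine (h i j).congr_of_eventuallyEq ?_
    filter_upwards [(chartAt E3 p).open_source.mem_nhds (mem_chart_source E3 p)] with q hq
      using mvfderiv_chartAt p k i j hij hq (X q)
  refine h1.congr_of_eventuallyEq ?_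
  filter_upwards [(chartAt E3 p).open_source.mem_nhds (mem_chart_source E3 p)] with q hq
  have := congrArg (fun L ↦ L (X q))
    (TangentBundle.continuousLinearMapAt_trivializationAt (I := 𝓡 3) hq)
  refine Eq.trans ?_ this
  have hb : q ∈ (trivializationAt E3 (TangentSpace (𝓡 3)) p).baseSet := by simpa using hq
  exact ((trivializationAt E3 (TangentSpace (𝓡 3)) p).continuousLinearMapAt_apply_of_mem ℝ hb _).symm

end SL2R

/-! ### Tangent vectors and left-invariant fields of `SL(2, ℝ)` as matrices. -/

namespace SL2R

/-- The derivative of the inclusion into the matrices. -/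
def matDeriv (g : SL2R) (v : TangentSpace (𝓡 3) g) : Matrix (Fin 2) (Fin 2) ℝ :=
  Matrix.of fun i j ↦ mvfderiv (𝓡 3) (entry i j) g v

theorem matDeriv_injective {g : SL2R} {v w : TangentSpace (𝓡 3) g}
    (h : matDeriv g v = matDeriv g w) : v = w :=
  ext_mvfderiv_entry fun i j ↦ congrFun (congrFun h i) j

theorem matDeriv_add (g : SL2R) (v w : TangentSpace (𝓡 3) g) :
    matDeriv g (v + w) = matDeriv g v + matDeriv g w := by
  ext i j
  simp [matDeriv]

theorem matDeriv_smul (g : SL2R) (c : ℝ) (v : TangentSpace (𝓡 3) g) :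
    matDeriv g (c • v) = c • matDeriv g v := by
  ext i j
  simp [matDeriv]

theorem mdifferentiableAt_entry (i j : Fin 2) (g : SL2R) :
    MDifferentiableAt (𝓡 3) 𝓘(ℝ, ℝ) (entry i j) g :=
  (contMDiffAt_entry i j g).mdifferentiableAt (by simp)

theorem smoothFnAt_entry (i j : Fin 2) (g : SL2R) : SmoothFnAt (entry i j) g :=
  Filter.Eventually.of_forall fun g ↦ contMDiffAt_entry i j g

theorem mvfderiv_linear_combination {N : Type*} [TopologicalSpace N] [ChartedSpace E3 N]
    [IsManifold (𝓡 3) ∞ N] {f h : N → ℝ} {p : N}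
    (hf : MDifferentiableAt (𝓡 3) 𝓘(ℝ, ℝ) f p) (hh : MDifferentiableAt (𝓡 3) 𝓘(ℝ, ℝ) h p) (a b : ℝ)
    (v : TangentSpace (𝓡 3) p) : mvfderiv (𝓡 3) (fun q ↦ a * f q + b * h q) p v =
      a * mvfderiv (𝓡 3) f p v + b * mvfderiv (𝓡 3) h p v := by
  have hc : ∀ {f : N → ℝ} (_ : MDifferentiableAt (𝓡 3) 𝓘(ℝ, ℝ) f p) (c : ℝ),
      MDifferentiableAt (𝓡 3) 𝓘(ℝ, ℝ) (fun q ↦ c * f q) p := fun hf c ↦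
    (mdifferentiableAt_const (c := c)).mul hf
  rw [mvfderiv_add_apply (hc hf a) (hc hh b),
    mvfderiv_mul_apply mdifferentiableAt_const hf, mvfderiv_mul_apply mdifferentiableAt_const hh,
    mvfderiv_const, mvfderiv_const]
  simp

theorem entry_mul (a b : SL2R) (i j : Fin 2) :
    entry i j (a * b) = entry i 0 a * entry 0 j b + entry i 1 a * entry 1 j b := by
  simp [entry, Matrix.mul_apply]

theorem contMDiffAt_mul_left (a g : SL2R) : ContMDiffAt (𝓡 3) (𝓡 3) ∞ (fun b ↦ a * b) g := by
  refine contMDiffAt_of_entry fun i j ↦ ?_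
  simp only [entry_mul]
  exact (contMDiffAt_const.mul (contMDiffAt_entry 0 j g)).add
    (contMDiffAt_const.mul (contMDiffAt_entry 1 j g))

/-- The chain rule for the matrix entries. -/
theorem mvfderiv_entry_comp {N : Type*} [TopologicalSpace N] [ChartedSpace E3 N] {f : N → SL2R}
    {p : N} (hf : MDifferentiableAt (𝓡 3) (𝓡 3) f p) (v : TangentSpace (𝓡 3) p) (i j : Fin 2) :
    mvfderiv (𝓡 3) (entry i j) (f p) (mfderiv (𝓡 3) (𝓡 3) f p v) =
      mvfderiv (𝓡 3) (fun q ↦ entry i j (f q)) p v := by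
  have := mfderiv_comp p (mdifferentiableAt_entry i j (f p)) hf
  exact (congrArg (fun L ↦ L v) this).symm

theorem matDeriv_mul_left (a g : SL2R) (v : TangentSpace (𝓡 3) g) :
    matDeriv (a * g) (mfderiv (𝓡 3) (𝓡 3) (fun b ↦ a * b) g v) = a.1 * matDeriv g v := by
  ext i j
  have h1 := mvfderiv_entry_comp ((contMDiffAt_mul_left a g).mdifferentiableAt (by simp)) v i j
  simp only [entry_mul] at h1
  rw [mvfderiv_linear_combination (mdifferentiableAt_entry 0 j g) (mdifferentiableAt_entry 1 j g)]
    at h1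
  refine h1.trans ?_
  simp [matDeriv, Matrix.mul_apply, entry]

/-- This is the derivative of `ad - bc = 1` at the identity. -/
theorem matDeriv_one_trace (v : TangentSpace (𝓡 3) (1 : SL2R)) : (matDeriv 1 v).trace = 0 := by
  have hd := fun i j ↦ smoothFnAt_entry i j (1 : SL2R)
  have h : mvfderiv (𝓡 3) (fun g : SL2R ↦ entry 0 0 g * entry 1 1 g + -1 * (entry 0 1 g * entry 1 0 g))
      1 v = 0 := by
    rw [mvfderiv_of_const (Filter.Eventually.of_forall fun g ↦ (by
      simpa [entry, sub_eq_add_neg] using det_eq g :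
      entry 0 0 g * entry 1 1 g + -1 * (entry 0 1 g * entry 1 0 g) = 1))]
    rfl
  rw [mvfderiv_add_apply ((hd 0 0).mul (hd 1 1)).mdiffAt
      ((SmoothFnAt.const _).mul ((hd 0 1).mul (hd 1 0))).mdiffAt,
    mvfderiv_mul_apply mdifferentiableAt_const ((hd 0 1).mul (hd 1 0)).mdiffAt, mvfderiv_const,
    mvfderiv_mul_apply (hd 0 0).mdiffAt (hd 1 1).mdiffAt,
    mvfderiv_mul_apply (hd 0 1).mdiffAt (hd 1 0).mdiffAt] at h
  simp [entry] at h
  rw [Matrix.trace_fin_two]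
  simpa [matDeriv, add_comm] using h

/-- The chart around `1` allows three entries to be prescribed freely; trace zero on both sides then
forces the fourth. -/
theorem exists_matDeriv_one (X : Matrix (Fin 2) (Fin 2) ℝ) (hX : X.trace = 0) :
    ∃ v : TangentSpace (𝓡 3) (1 : SL2R), matDeriv 1 v = X := by
  obtain ⟨v, hv⟩ := (isInvertible_mfderiv_extChartAt (I := 𝓡 3)
    (mem_extChartAt_source (1 : SL2R))).surjective (!₂[X 0 0, X 0 1, X 1 0] : E3)
  have hch : chartAt E3 (1 : SL2R) = chartA := if_pos (by simp)
  have key : ∀ k i j, (∀ x, (show E3 from chartAt E3 (1 : SL2R) x) k = entry i j x) →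
      mvfderiv (𝓡 3) (entry i j) 1 v = (!₂[X 0 0, X 0 1, X 1 0] : E3) k := fun k i j h ↦
    (mvfderiv_chartAt 1 k i j h (mem_chart_source E3 1) v).symm.trans
      (congrArg (fun x : E3 ↦ x k) hv)
  have h00 := key 0 0 0 fun x ↦ by rw [hch]; rfl
  have h01 := key 1 0 1 fun x ↦ by rw [hch]; rfl
  have h10 := key 2 1 0 fun x ↦ by rw [hch]; rfl
  refine ⟨v, ?_⟩
  have ht := matDeriv_one_trace v
  rw [Matrix.trace_fin_two] at ht hX
  have h11 : matDeriv 1 v 1 1 = X 1 1 := by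
    have : matDeriv 1 v 0 0 = X 0 0 := h00
    linarith
  ext i j
  fin_cases i <;> fin_cases j
  exacts [h00, h01, h10, h11]

theorem matDeriv_mulInvariantVectorField (x : GroupLieAlgebra (𝓡 3) SL2R) (g : SL2R) :
    matDeriv g (mulInvariantVectorField x g) = g.1 * matDeriv 1 x := by
  have h := matDeriv_mul_left g 1 x
  -- The tangent spaces at `g * 1` and `g` are the same copy of `ℝ³`, so the equality of base points
  -- is handled by transport.
  have h2 : ∀ (a b : SL2R) (e : a = b) (v : E3), matDeriv a v = matDeriv b v := by
    rintro a _ rfl v; rfl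
  exact (h2 _ _ (mul_one g).symm _).trans h

theorem mvfderiv_entry_mulInvariantVectorField (x : GroupLieAlgebra (𝓡 3) SL2R) (g : SL2R)
    (i j : Fin 2) : mvfderiv (𝓡 3) (entry i j) g (mulInvariantVectorField x g) =
      entry i 0 g * matDeriv 1 x 0 j + entry i 1 g * matDeriv 1 x 1 j := by
  have := congrFun (congrFun (matDeriv_mulInvariantVectorField x g) i) j
  rwa [Matrix.mul_apply, Fin.sum_univ_two] at this

theorem smoothVFAt_mulInvariantVectorField (x : GroupLieAlgebra (𝓡 3) SL2R) (g : SL2R) :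
    SmoothVFAt (mulInvariantVectorField x) g := by
  refine Filter.Eventually.of_forall fun g ↦ contMDiffAt_vectorField fun i j ↦ ?_
  simp only [mvfderiv_entry_mulInvariantVectorField]
  exact ((contMDiffAt_entry i 0 g).mul contMDiffAt_const).add
    ((contMDiffAt_entry i 1 g).mul contMDiffAt_const)

/-- A left-invariant field acts on the matrix of entries as right multiplication by its matrix, so
the second derivative along `x` and then `y` is `g · x · y`; the commutator formula for derivations
gives the bracket. -/
theorem matDeriv_mlieBracket (x y : GroupLieAlgebra (𝓡 3) SL2R) (g : SL2R) :
    matDeriv g (mlieBracket (𝓡 3) (mulInvariantVectorField x) (mulInvariantVectorField y) g) =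
      g.1 * (matDeriv 1 x * matDeriv 1 y - matDeriv 1 y * matDeriv 1 x) := by
  ext i j
  have second : ∀ x y : GroupLieAlgebra (𝓡 3) SL2R, mvfderiv (𝓡 3) (fun q ↦
      mvfderiv (𝓡 3) (entry i j) q (mulInvariantVectorField y q)) g (mulInvariantVectorField x g) =
      (entry i 0 g * matDeriv 1 x 0 0 + entry i 1 g * matDeriv 1 x 1 0) * matDeriv 1 y 0 j +
      (entry i 0 g * matDeriv 1 x 0 1 + entry i 1 g * matDeriv 1 x 1 1) * matDeriv 1 y 1 j := by
    intro x y
    simp only [mvfderiv_entry_mulInvariantVectorField, mul_comm (entry _ _ _)]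
    rw [mvfderiv_linear_combination (mdifferentiableAt_entry i 0 g) (mdifferentiableAt_entry i 1 g),
      mvfderiv_entry_mulInvariantVectorField, mvfderiv_entry_mulInvariantVectorField]
    ring
  have := mvfderiv_mlieBracket (smoothFnAt_entry i j g) (smoothVFAt_mulInvariantVectorField x g)
    (smoothVFAt_mulInvariantVectorField y g)
  rw [second, second] at this
  refine this.trans ?_
  simp [Matrix.mul_apply, Fin.sum_univ_two, entry]
  ring

theorem matDeriv_bracket (x y : GroupLieAlgebra (𝓡 3) SL2R) :
    matDeriv 1 ⁅x, y⁆ = matDeriv 1 x * matDeriv 1 y - matDeriv 1 y * matDeriv 1 x := by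
  rw [GroupLieAlgebra.bracket_def, matDeriv_mlieBracket]
  simp

theorem mlieBracket_mulInvariantVectorField (x y : GroupLieAlgebra (𝓡 3) SL2R) (g : SL2R) :
    mlieBracket (𝓡 3) (mulInvariantVectorField x) (mulInvariantVectorField y) g =
      mulInvariantVectorField ⁅x, y⁆ g := by
  apply matDeriv_injective
  rw [matDeriv_mlieBracket, matDeriv_mulInvariantVectorField, matDeriv_bracket]

theorem mulInvariantVectorField_one (x : GroupLieAlgebra (𝓡 3) SL2R) :
    mulInvariantVectorField x 1 = x := by
  apply matDeriv_injective
  rw [matDeriv_mulInvariantVectorField]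
  simp

end SL2R

/-! ### Normal frames of the left-invariant structures of type `a₁`. -/

section LeftInvariant

open SL2R

variable {S : ParacontactMetricStructure SL2R}

theorem ParacontactMetricStructure.IsLeftInvariant.φ_apply (h : S.IsLeftInvariant)
    (x : GroupLieAlgebra (𝓡 3) SL2R) (g : SL2R) :
    S.φ g (mulInvariantVectorField x g) = mulInvariantVectorField (S.φ 1 x) g := by
  have tr : ∀ (a b : SL2R) (_ : a = b) (w : E3), (show E3 from S.φ a w) = S.φ b w := by
    rintro a _ rfl w; rfl
  exact (tr _ _ (mul_one g).symm _).trans ((h g 1).map_φ x)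

theorem ParacontactMetricStructure.IsLeftInvariant.ξ_apply (h : S.IsLeftInvariant)
    (g : SL2R) :
    mulInvariantVectorField (S.ξ 1) g = S.ξ g := by
  have tr : ∀ (a b : SL2R) (_ : a = b), (show E3 from S.ξ a) = S.ξ b := by
    rintro a _ rfl; rfl
  exact (h g 1).map_ξ.trans (tr _ _ (mul_one g))

theorem ParacontactMetricStructure.IsLeftInvariant.g_apply (h : S.IsLeftInvariant)
    (x y : GroupLieAlgebra (𝓡 3) SL2R) (g : SL2R) :
    S.g g (mulInvariantVectorField x g) (mulInvariantVectorField y g) = S.g 1 x y := by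
  have tr : ∀ (a b : SL2R) (_ : a = b) (v w : E3), S.g a v w = S.g b v w := by
    rintro a _ rfl v w; rfl
  exact (tr _ _ (mul_one g).symm _ _).trans ((h g 1).map_g x y)

end LeftInvariant

open SL2R in
/-- The structures of type `a₁` have normal frames. -/
theorem ParacontactMetricStructure.HasBrackets.hasNormalFrameAt
    {S : ParacontactMetricStructure SL2R} {a₁ : ℝ} (h : S.HasBrackets a₁) (g : SL2R) :
    HasNormalFrameAt S (-2 * a₁) g := by
  obtain ⟨hinv, ξ, e, φe, hξ, hφe, hη, hg, h1, h2, h3⟩ := h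
  have hadd : ∀ (x y : GroupLieAlgebra (𝓡 3) SL2R) g, mulInvariantVectorField (x + y) g =
      mulInvariantVectorField x g + mulInvariantVectorField y g := fun x y g ↦
    congrFun (mulInvariantVectorField_add x y) g
  have hsmul : ∀ (c : ℝ) (x : GroupLieAlgebra (𝓡 3) SL2R) g, mulInvariantVectorField (c • x) g =
      c • mulInvariantVectorField x g := fun c x g ↦ congrFun (mulInvariantVectorField_smul c x) g
  have hφφe : S.φ 1 φe = e := by rw [hφe, S.φ_φ, hη]; simp
  have hgφ : S.g 1 φe φe = -1 := by rw [hφe, S.compatible, hg, hη]; simp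
  -- The null directions `e ± φe` are the eigenvectors of `φ` for `±1`. The given brackets yield
  -- `[ξ, e + φe] = 2 (e + φe)` and `[ξ, e - φe] = -2a₁ (e + φe) - 2 (e - φe)`, whence `β = -2a₁`;
  -- also `[e + φe, e - φe] = -2 [e, φe] = 4 ξ`.
  set x₁ : GroupLieAlgebra (𝓡 3) SL2R := e + φe with hx₁
  set x₂ : GroupLieAlgebra (𝓡 3) SL2R := e + (-1 : ℝ) • φe with hx₂
  have hφ₁ : S.φ 1 x₁ = (1 : ℝ) • x₁ := by
    refine (map_add (S.φ 1) e φe).trans ?_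
    rw [hφφe, ← hφe, hx₁]
    module
  have hφ₂ : S.φ 1 x₂ = (-1 : ℝ) • x₂ := by
    refine (map_add (S.φ 1) e ((-1 : ℝ) • φe)).trans ?_
    rw [map_smul, hφφe, ← hφe, hx₂]
    module
  have hg₁₂ : S.g 1 x₁ x₂ = 2 := by
    have e1 : S.g 1 x₁ x₂ = S.g 1 e x₂ + S.g 1 φe x₂ :=
      congrArg (fun L ↦ L x₂) (map_add (S.g 1) e φe)
    have e2 : ∀ v, S.g 1 v x₂ = S.g 1 v e + S.g 1 v ((-1 : ℝ) • φe) := fun v ↦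
      map_add (S.g 1 v) e _
    rw [e1, e2, e2, map_smul, map_smul, S.g_symm 1 φe e, hg, hgφ]
    simp
    ring
  have m1 := congrArg (matDeriv 1) h1
  have m2 := congrArg (matDeriv 1) h2
  have m3 := congrArg (matDeriv 1) h3
  simp only [matDeriv_bracket, matDeriv_add, matDeriv_smul] at m1 m2 m3
  have hb₁ : ⁅ξ, x₁⁆ = (2 : ℝ) • x₁ := by
    apply matDeriv_injective
    simp only [matDeriv_bracket, matDeriv_add, matDeriv_smul, hx₁]
    rw [mul_add, add_mul, add_sub_add_comm, m1, m2]
    module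
  have hb₂ : ⁅ξ, x₂⁆ = (-2 * a₁) • x₁ + (-2 : ℝ) • x₂ := by
    apply matDeriv_injective
    simp only [matDeriv_bracket, matDeriv_add, matDeriv_smul, hx₁, hx₂]
    rw [mul_add, add_mul, add_sub_add_comm, m1, mul_smul_comm, smul_mul_assoc, ← smul_sub, m2]
    module
  have hb₁₂ : ⁅x₁, x₂⁆ = (4 : ℝ) • ξ := by
    apply matDeriv_injective
    simp only [matDeriv_bracket, matDeriv_add, matDeriv_smul, hx₁, hx₂]
    rw [show (4 : ℝ) • matDeriv 1 ξ = (-2 : ℝ) • (-2 : ℝ) • matDeriv 1 ξ by module, ← m3]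
    simp only [mul_add, add_mul, mul_smul_comm, smul_mul_assoc]
    module
  have hξ' : ∀ q, S.ξ q = mulInvariantVectorField ξ q := fun q ↦ by
    rw [hξ]; exact (hinv.ξ_apply q).symm
  have hbξ : ∀ x : GroupLieAlgebra (𝓡 3) SL2R, ∀ q,
      mlieBracket (𝓡 3) S.ξ (mulInvariantVectorField x) q = mulInvariantVectorField ⁅ξ, x⁆ q :=
    fun x q ↦ by
      rw [mlieBracket_congr (Filter.Eventually.of_forall hξ') (Filter.Eventually.of_forall
        fun _ ↦ rfl), mlieBracket_mulInvariantVectorField]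
  refine ⟨mulInvariantVectorField x₁, mulInvariantVectorField x₂, ⟨by norm_num,
    smoothVFAt_mulInvariantVectorField x₁ g, smoothVFAt_mulInvariantVectorField x₂ g,
    Filter.Eventually.of_forall fun q ↦ ⟨?_, ?_, ?_⟩⟩, Filter.Eventually.of_forall fun q ↦
    mlieBracket_adaptedFrame ?_ ?_ ?_⟩
  · rw [hinv.φ_apply, hφ₁, hsmul]
  · rw [hinv.φ_apply, hφ₂, hsmul]
  · rw [hinv.g_apply, hg₁₂]
  · rw [hbξ, hb₁, hsmul]
    module
  · rw [hbξ, hb₂, hadd, hsmul, hsmul]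
  · rw [mlieBracket_mulInvariantVectorField, hb₁₂, hsmul, hξ']
    module

/-! ### Smoothness of tensor fields tested on vector fields, and the exterior derivative in a frame.
-/

section HomBundle

set_option linter.unusedSectionVars false

variable {M : Type*} [TopologicalSpace M] [ChartedSpace E3 M] [IsManifold (𝓡 3) ∞ M] {p : M}

/-- A map into the continuous linear maps on `ℝ³` is smooth if its values on the standard basis
are. -/
theorem contMDiffAt_clm_of_basis {F : Type*} [NormedAddCommGroup F] [NormedSpace ℝ F]
    {L : M → E3 →L[ℝ] F}
    (h : ∀ i, ContMDiffAt (𝓡 3) 𝓘(ℝ, F) ∞ (fun q ↦ L q (EuclideanSpace.single i (1 : ℝ))) p) :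
    ContMDiffAt (𝓡 3) 𝓘(ℝ, E3 →L[ℝ] F) ∞ L p := by
  have hL : L = fun q ↦ ∑ i, ContinuousLinearMap.smulRightL ℝ E3 F
      (EuclideanSpace.proj i : E3 →L[ℝ] ℝ) (L q (EuclideanSpace.single i (1 : ℝ))) := by
    funext q
    ext v
    have hv : v = ∑ i, v i • EuclideanSpace.single i (1 : ℝ) := by
      ext j
      simp [Pi.single_apply]
    conv_lhs => rw [hv]
    simp [map_sum]
  rw [hL]
  exact contMDiffAt_finsetSum fun i _ ↦
    (ContinuousLinearMap.contDiff _).contMDiff.contMDiffAt.comp p (h i)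

variable {F : Type*} [NormedAddCommGroup F] [NormedSpace ℝ F] {E : M → Type*}
  [∀ q, AddCommGroup (E q)] [∀ q, Module ℝ (E q)] [∀ q, TopologicalSpace (E q)]
  [∀ q, IsTopologicalAddGroup (E q)] [∀ q, ContinuousSMul ℝ (E q)]
  [TopologicalSpace (TotalSpace F E)] [FiberBundle F E] [VectorBundle ℝ F E]

/-- A field of linear maps is smooth if it maps smooth vector fields to smooth sections. -/
theorem contMDiffAt_hom_of_smoothVFAt {A : Π q : M, TangentSpace (𝓡 3) q →L[ℝ] E q}
    (h : ∀ X : Π q : M, TangentSpace (𝓡 3) q, SmoothVFAt X p →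
      ContMDiffAt (𝓡 3) ((𝓡 3).prod 𝓘(ℝ, F)) ∞ (fun q ↦ TotalSpace.mk' F q (A q (X q))) p) :
    ContMDiffAt (𝓡 3) ((𝓡 3).prod 𝓘(ℝ, E3 →L[ℝ] F)) ∞
      (fun q : M ↦ TotalSpace.mk' (E3 →L[ℝ] F)
        (E := fun q : M ↦ TangentSpace (𝓡 3) q →L[ℝ] E q) q (A q)) p := by
  rw [contMDiffAt_hom_bundle]
  refine ⟨contMDiffAt_id, contMDiffAt_clm_of_basis fun i ↦ ?_⟩
  -- The test field has constant coordinates in the trivialisation at `p`, so its image reads off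
  -- one column of the coordinate expression of `A`.
  let X : Π q : M, TangentSpace (𝓡 3) q := fun q ↦
    (trivializationAt E3 (TangentSpace (𝓡 3)) p).symm q (EuclideanSpace.single i (1 : ℝ))
  have hX : SmoothVFAt X p := by
    have hp : p ∈ (trivializationAt E3 (TangentSpace (𝓡 3)) p).baseSet :=
      FiberBundle.mem_baseSet_trivializationAt' p
    refine (smoothVFAt_extend (X p)).congr (Filter.Eventually.of_forall fun q ↦ ?_)
    simp only [FiberBundle.extend, X]
    congr 1
    exact congrArg Prod.snd ((trivializationAt E3 (TangentSpace (𝓡 3)) p).apply_mk_symm hp _).symm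
  have h1 := (contMDiffAt_totalSpace.1 (h X hX)).2
  refine h1.congr_of_eventuallyEq ?_
  filter_upwards [(trivializationAt F E p).open_baseSet.mem_nhds
    (FiberBundle.mem_baseSet_trivializationAt' p),
    (trivializationAt E3 (TangentSpace (𝓡 3)) p).open_baseSet.mem_nhds
    (FiberBundle.mem_baseSet_trivializationAt' p)] with q hq hq'
  simp only [ContinuousLinearMap.inCoordinates, ContinuousLinearMap.comp_apply]
  rw [Trivialization.continuousLinearMapAt_apply_of_mem _ _ hq, Trivialization.symmL_apply _ hq']

theorem contMDiffAt_oneForm_of_smoothVFAt {θ : Π q : M, TangentSpace (𝓡 3) q →L[ℝ] ℝ}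
    (h : ∀ X : Π q : M, TangentSpace (𝓡 3) q, SmoothVFAt X p →
      ContMDiffAt (𝓡 3) 𝓘(ℝ, ℝ) ∞ (fun q ↦ θ q (X q)) p) :
    ContMDiffAt (𝓡 3) ((𝓡 3).prod 𝓘(ℝ, E3 →L[ℝ] ℝ)) ∞
      (fun q : M ↦ TotalSpace.mk' (E3 →L[ℝ] ℝ)
        (E := fun q : M ↦ TangentSpace (𝓡 3) q →L[ℝ] ℝ) q (θ q)) p :=
  contMDiffAt_hom_of_smoothVFAt (E := Bundle.Trivial M ℝ) fun X hX ↦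
    (contMDiffAt_section ..).2 (h X hX)

theorem contMDiffAt_bilinearForm_of_smoothVFAt
    {g : Π q : M, TangentSpace (𝓡 3) q →L[ℝ] TangentSpace (𝓡 3) q →L[ℝ] ℝ}
    (h : ∀ X Y : Π q : M, TangentSpace (𝓡 3) q, SmoothVFAt X p → SmoothVFAt Y p →
      ContMDiffAt (𝓡 3) 𝓘(ℝ, ℝ) ∞ (fun q ↦ g q (X q) (Y q)) p) :
    ContMDiffAt (𝓡 3) ((𝓡 3).prod 𝓘(ℝ, E3 →L[ℝ] E3 →L[ℝ] ℝ)) ∞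
      (fun q : M ↦ TotalSpace.mk' (E3 →L[ℝ] E3 →L[ℝ] ℝ)
        (E := fun q : M ↦ TangentSpace (𝓡 3) q →L[ℝ] TangentSpace (𝓡 3) q →L[ℝ] ℝ) q (g q)) p :=
  contMDiffAt_hom_of_smoothVFAt (E := fun q : M ↦ TangentSpace (𝓡 3) q →L[ℝ] ℝ) fun X hX ↦
    contMDiffAt_oneForm_of_smoothVFAt fun Y hY ↦ h X Y hX hY

/-- Smooth frames whose coframe is smooth on smooth vector fields. -/
theorem isFrameAt_of_smooth {e : Fin 3 → Π q : M, TangentSpace (𝓡 3) q}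
    {θ : Fin 3 → Π q : M, TangentSpace (𝓡 3) q →L[ℝ] ℝ} (he : ∀ i, SmoothVFAt (e i) p)
    (hθ : ∀ i q (X : Π q : M, TangentSpace (𝓡 3) q), SmoothVFAt X q →
      SmoothFnAt (fun q ↦ θ i q (X q)) q)
    (h : ∀ q i j, θ i q (e j q) = if i = j then 1 else 0) : IsFrameAt e θ p where
  smooth := he
  mdiff_coeff := Filter.Eventually.of_forall fun q i X hX ↦ by
    have := MDifferentiableAt.clm_bundle_apply (E₂ := Bundle.Trivial M ℝ)
      ((contMDiffAt_oneForm_of_smoothVFAt fun X hX ↦ (hθ i q X hX).contMDiffAt).mdifferentiableAt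
        (by simp)) hX
    exact (mdifferentiableAt_section ..).1 this
  smooth_coeff := Filter.Eventually.of_forall fun q i X hX ↦ hθ i q X hX
  dual := Filter.Eventually.of_forall h

/-- The exterior derivative of a one-form (up to the factor `2`) is determined by its values on a
frame. -/
theorem IsFrameAt.extDeriv_eq {e : Fin 3 → Π q : M, TangentSpace (𝓡 3) q}
    {θ : Fin 3 → Π q : M, TangentSpace (𝓡 3) q →L[ℝ] ℝ} (h : IsFrameAt e θ p)
    {X Y : Π q : M, TangentSpace (𝓡 3) q}
    (hX : MDifferentiableAt (𝓡 3) ((𝓡 3).prod 𝓘(ℝ, E3)) (fun q : M ↦ TotalSpace.mk' E3 q (X q)) p)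
    (hY : MDifferentiableAt (𝓡 3) ((𝓡 3).prod 𝓘(ℝ, E3)) (fun q : M ↦ TotalSpace.mk' E3 q (Y q)) p)
    (k : Fin 3) :
    mvfderiv (𝓡 3) (fun q ↦ θ k q (Y q)) p (X p) - mvfderiv (𝓡 3) (fun q ↦ θ k q (X q)) p (Y p)
      - θ k p (mlieBracket (𝓡 3) X Y p) =
    -∑ i, ∑ j, θ i p (X p) * θ j p (Y p) * θ k p (mlieBracket (𝓡 3) (e i) (e j) p) := by
  have t1 : ∀ Y : Π q : M, TangentSpace (𝓡 3) q,
      MDifferentiableAt (𝓡 3) ((𝓡 3).prod 𝓘(ℝ, E3)) (fun q : M ↦ TotalSpace.mk' E3 q (Y q)) p →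
      TensorialAt (𝓡 3) E3 (fun X : Π q : M, TangentSpace (𝓡 3) q ↦
        mvfderiv (𝓡 3) (fun q ↦ θ k q (Y q)) p (X p) - mvfderiv (𝓡 3) (fun q ↦ θ k q (X q)) p (Y p)
        - θ k p (mlieBracket (𝓡 3) X Y p)) p := by
    intro Y hY
    constructor
    · intro f X hf hX
      have h1 := mvfderiv_mul_apply hf (h.mdiffAt_coeff k hX) (Y p)
      have h2 := mlieBracket_smul_left (I := 𝓡 3) (W := Y) hf hX
      simp only [Pi.smul_apply', map_smul, smul_eq_mul, h1, h2, map_add]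
      ring
    · intro X X' hX hX'
      have h1 := mvfderiv_add_apply (h.mdiffAt_coeff k hX) (h.mdiffAt_coeff k hX') (Y p)
      have h2 := mlieBracket_add_left (I := 𝓡 3) (W := Y) hX hX'
      simp only [Pi.add_apply, map_add, h1, h2]
      ring
  have t2 : ∀ X : Π q : M, TangentSpace (𝓡 3) q,
      MDifferentiableAt (𝓡 3) ((𝓡 3).prod 𝓘(ℝ, E3)) (fun q : M ↦ TotalSpace.mk' E3 q (X q)) p →
      TensorialAt (𝓡 3) E3 (fun Y : Π q : M, TangentSpace (𝓡 3) q ↦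
        mvfderiv (𝓡 3) (fun q ↦ θ k q (Y q)) p (X p) - mvfderiv (𝓡 3) (fun q ↦ θ k q (X q)) p (Y p)
        - θ k p (mlieBracket (𝓡 3) X Y p)) p := by
    intro X hX
    constructor
    · intro f Y hf hY
      have h1 := mvfderiv_mul_apply hf (h.mdiffAt_coeff k hY) (X p)
      have h2 := mlieBracket_smul_right (I := 𝓡 3) (V := X) hf hY
      simp only [Pi.smul_apply', map_smul, smul_eq_mul, h1, h2, map_add]
      ring
    · intro Y Y' hY hY'
      have h1 := mvfderiv_add_apply (h.mdiffAt_coeff k hY) (h.mdiffAt_coeff k hY') (X p)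
      have h2 := mlieBracket_add_right (I := 𝓡 3) (V := X) hY hY'
      simp only [Pi.add_apply, map_add, h1, h2]
      ring
  rw [h.tensorial_eq_sum (t1 Y hY) hX, ← Finset.sum_neg_distrib]
  refine Finset.sum_congr rfl fun i _ ↦ ?_
  rw [h.tensorial_eq_sum (t2 _ (h.smooth i).mdiffAt) hY, Finset.smul_sum, ← Finset.sum_neg_distrib]
  refine Finset.sum_congr rfl fun j _ ↦ ?_
  rw [h.mvfderiv_dual, h.mvfderiv_dual]
  simp only [zero_apply, smul_eq_mul]
  ring

end HomBundle

/-! ### The explicit left-invariant paracontact structures on `SL(2, ℝ)`. -/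

namespace SL2R

/-- A basis of the trace-free matrices. -/
def basisMat (β : ℝ) : Fin 3 → Matrix (Fin 2) (Fin 2) ℝ :=
  ![!![1, 0; 0, -1], !![0, 1; 0, 0], !![0, β / 4; 4, 0]]

variable {β : ℝ}

theorem basisMat_trace (β : ℝ) (i : Fin 3) : (basisMat β i).trace = 0 := by
  fin_cases i <;> simp [basisMat, Matrix.trace_fin_two]

/-- In the standard basis `H, E, F` of `sl(2, ℝ)` the three matrices are `H`, `E` and `4F + (β/4)
E`. The multiple of `E` in the last one produces the term `βE` in its bracket with `H`, and the
factor `4` produces `[E, 4F] = 4H`. -/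
theorem basisMat_commutator (β : ℝ) (i j : Fin 3) :
    basisMat β i * basisMat β j - basisMat β j * basisMat β i =
      ∑ k, adaptedConst 1 2 0 β 0 0 i j k • basisMat β k := by
  fin_cases i <;> fin_cases j <;> ext k l <;> fin_cases k <;> fin_cases l <;>
    simp [basisMat, adaptedConst, Fin.sum_univ_three] <;> ring

/-- The tangent vectors at `1` with the matrices `basisMat β`. -/
def basisVec (β : ℝ) (i : Fin 3) : GroupLieAlgebra (𝓡 3) SL2R :=
  (exists_matDeriv_one _ (basisMat_trace β i)).choose

theorem matDeriv_basisVec (β : ℝ) (i : Fin 3) : matDeriv 1 (basisVec β i) = basisMat β i :=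
  (exists_matDeriv_one _ (basisMat_trace β i)).choose_spec

/-- The entries of the Maurer-Cartan form. -/
def maurerCartan (i j : Fin 2) (g : SL2R) : TangentSpace (𝓡 3) g →L[ℝ] ℝ :=
  (g⁻¹).1 i 0 • mvfderiv (𝓡 3) (entry 0 j) g + (g⁻¹).1 i 1 • mvfderiv (𝓡 3) (entry 1 j) g

theorem maurerCartan_apply (i j : Fin 2) (g : SL2R) (v : TangentSpace (𝓡 3) g) :
    maurerCartan i j g v = ((g⁻¹).1 * matDeriv g v) i j := by
  simp [maurerCartan, Matrix.mul_apply, matDeriv]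

theorem maurerCartan_mul_left (i j : Fin 2) (a g : SL2R) (v : TangentSpace (𝓡 3) g) :
    maurerCartan i j (a * g) (mfderiv (𝓡 3) (𝓡 3) (fun b ↦ a * b) g v) = maurerCartan i j g v := by
  have h : ((a * g)⁻¹).1 * a.1 = (g⁻¹).1 := by
    rw [← Matrix.SpecialLinearGroup.coe_mul]
    rw [mul_inv_rev, inv_mul_cancel_right]
  rw [maurerCartan_apply, maurerCartan_apply, matDeriv_mul_left, ← mul_assoc, h]

theorem maurerCartan_mulInvariantVectorField (i j : Fin 2) (x : GroupLieAlgebra (𝓡 3) SL2R)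
    (g : SL2R) : maurerCartan i j g (mulInvariantVectorField x g) = matDeriv 1 x i j := by
  have h : (g⁻¹).1 * g.1 = 1 := by
    rw [← Matrix.SpecialLinearGroup.coe_mul, inv_mul_cancel, Matrix.SpecialLinearGroup.coe_one]
  rw [maurerCartan_apply, matDeriv_mulInvariantVectorField, ← mul_assoc, h, one_mul]

theorem smoothFnAt_inv_entry (i j : Fin 2) (g : SL2R) :
    SmoothFnAt (fun g : SL2R ↦ (g⁻¹).1 i j) g := by
  have key : ∀ {f : SL2R → ℝ}, SmoothFnAt f g → (∀ g : SL2R, (g⁻¹).1 i j = f g) →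
      SmoothFnAt (fun g : SL2R ↦ (g⁻¹).1 i j) g := fun hf h ↦
    hf.congr (Filter.Eventually.of_forall h)
  have neg : ∀ k l, SmoothFnAt (fun g ↦ -1 * entry k l g) g := fun k l ↦
    (SmoothFnAt.const (-1)).mul (smoothFnAt_entry k l g)
  have hadj : ∀ g : SL2R, (g⁻¹).1 = !![g.1 1 1, -g.1 0 1; -g.1 1 0, g.1 0 0] := fun g ↦ by
    rw [Matrix.SpecialLinearGroup.coe_inv, Matrix.adjugate_fin_two]
  fin_cases i <;> fin_cases j
  · exact key (smoothFnAt_entry 1 1 g) fun g ↦ by rw [hadj]; rfl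
  · exact key (neg 0 1) fun g ↦ by rw [hadj]; simp [entry]
  · exact key (neg 1 0) fun g ↦ by rw [hadj]; simp [entry]
  · exact key (smoothFnAt_entry 0 0 g) fun g ↦ by rw [hadj]; rfl

theorem smoothFnAt_maurerCartan (i j : Fin 2) {g : SL2R} {X : Π g : SL2R, TangentSpace (𝓡 3) g}
    (hX : SmoothVFAt X g) : SmoothFnAt (fun g ↦ maurerCartan i j g (X g)) g :=
  ((smoothFnAt_inv_entry i 0 g).mul ((smoothFnAt_entry 0 j g).mvfderiv hX)).add
    ((smoothFnAt_inv_entry i 1 g).mul ((smoothFnAt_entry 1 j g).mvfderiv hX))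

/-- The left-invariant frame with the matrices `basisMat β`. -/
def frame (β : ℝ) (i : Fin 3) : Π g : SL2R, TangentSpace (𝓡 3) g :=
  mulInvariantVectorField (basisVec β i)

/-- The left-invariant coframe dual to `frame β`. -/
def coframe (β : ℝ) : Fin 3 → Π g : SL2R, TangentSpace (𝓡 3) g →L[ℝ] ℝ :=
  ![maurerCartan 0 0, fun g ↦ maurerCartan 0 1 g + (-(β / 16)) • maurerCartan 1 0 g,
    fun g ↦ (1 / 4 : ℝ) • maurerCartan 1 0 g]

/-- The matrix `a H + b E + c (4F + (β/4) E)` has `(0,1)` entry `b + βc/4` and `(1,0)` entry `4c`;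
solving for `b` and `c` explains the factors `-β/16` and `1/4` in `coframe`. -/
theorem coframe_frame (β : ℝ) (g : SL2R) (i j : Fin 3) :
    coframe β i g (frame β j g) = if i = j then 1 else 0 := by
  have h := fun k l ↦ maurerCartan_mulInvariantVectorField k l (basisVec β j) g
  simp only [matDeriv_basisVec] at h
  fin_cases i
  · refine (h 0 0).trans ?_
    fin_cases j <;> simp [basisMat]
  · refine (congrArg₂ (fun x y ↦ x + (-(β / 16)) * y) (h 0 1) (h 1 0)).trans ?_
    fin_cases j <;> simp [basisMat]
    ring
  · refine (congrArg (fun x ↦ 1 / 4 * x) (h 1 0)).trans ?_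
    fin_cases j <;> simp [basisMat]

theorem coframe_mul_left (β : ℝ) (i : Fin 3) (a g : SL2R) (v : TangentSpace (𝓡 3) g) :
    coframe β i (a * g) (mfderiv (𝓡 3) (𝓡 3) (fun b ↦ a * b) g v) = coframe β i g v := by
  have h := fun k l ↦ maurerCartan_mul_left k l a g v
  fin_cases i
  · exact h 0 0
  · exact congrArg₂ (fun x y ↦ x + (-(β / 16)) * y) (h 0 1) (h 1 0)
  · exact congrArg (fun x ↦ 1 / 4 * x) (h 1 0)

theorem smoothFnAt_coframe (i : Fin 3) {g : SL2R} {X : Π g : SL2R, TangentSpace (𝓡 3) g}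
    (hX : SmoothVFAt X g) : SmoothFnAt (fun g ↦ coframe β i g (X g)) g := by
  fin_cases i
  · exact smoothFnAt_maurerCartan 0 0 hX
  · exact (smoothFnAt_maurerCartan 0 1 hX).add
      ((SmoothFnAt.const _).mul (smoothFnAt_maurerCartan 1 0 hX))
  · exact (SmoothFnAt.const _).mul (smoothFnAt_maurerCartan 1 0 hX)

theorem smoothVFAt_frame (β : ℝ) (i : Fin 3) (g : SL2R) : SmoothVFAt (frame β i) g :=
  smoothVFAt_mulInvariantVectorField _ g

theorem isFrameAt_frame (β : ℝ) (g : SL2R) : IsFrameAt (frame β) (coframe β) g :=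
  isFrameAt_of_smooth (fun i ↦ smoothVFAt_frame β i g) (fun i _ _ hX ↦ smoothFnAt_coframe i hX)
    (coframe_frame β)

theorem matDeriv_frame (β : ℝ) (i : Fin 3) (g : SL2R) :
    matDeriv g (frame β i g) = g.1 * basisMat β i := by
  rw [frame, matDeriv_mulInvariantVectorField, matDeriv_basisVec]

theorem mlieBracket_frame (β : ℝ) (i j : Fin 3) (g : SL2R) :
    mlieBracket (𝓡 3) (frame β i) (frame β j) g =
      ∑ k, adaptedConst 1 2 0 β 0 0 i j k • frame β k g := by
  apply matDeriv_injective
  have h := matDeriv_mlieBracket (basisVec β i) (basisVec β j) g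
  rw [matDeriv_basisVec, matDeriv_basisVec, basisMat_commutator] at h
  refine h.trans ?_
  rw [Fin.sum_univ_three, Fin.sum_univ_three]
  simp only [matDeriv_add, matDeriv_smul, matDeriv_frame, mul_add, mul_smul_comm]

theorem mfderiv_mul_left_frame (β : ℝ) (i : Fin 3) (a g : SL2R) :
    mfderiv (𝓡 3) (𝓡 3) (fun b ↦ a * b) g (frame β i g) = frame β i (a * g) := by
  apply matDeriv_injective
  rw [matDeriv_mul_left, matDeriv_frame, matDeriv_frame, ← mul_assoc,
    Matrix.SpecialLinearGroup.coe_mul]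

theorem eq_sum_frame (β : ℝ) {g : SL2R} (v : TangentSpace (𝓡 3) g) :
    v = coframe β 0 g v • frame β 0 g + coframe β 1 g v • frame β 1 g
      + coframe β 2 g v • frame β 2 g := by
  conv_lhs => rw [(isFrameAt_frame β g).eq_sum v, Fin.sum_univ_three]

/-- The tensor `φ` with `φ e₀ = 0`, `φ e₁ = e₁`, `φ e₂ = -e₂`. -/
def tensorφ (β : ℝ) (g : SL2R) : TangentSpace (𝓡 3) g →L[ℝ] TangentSpace (𝓡 3) g :=
  (coframe β 1 g).smulRight (frame β 1 g) + (-coframe β 2 g).smulRight (frame β 2 g)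

/-- The metric `θ⁰ θ⁰ + 2 (θ¹ θ² + θ² θ¹)`. -/
def tensorg (β : ℝ) (g : SL2R) : TangentSpace (𝓡 3) g →L[ℝ] TangentSpace (𝓡 3) g →L[ℝ] ℝ :=
  (coframe β 0 g).smulRight (coframe β 0 g) + (coframe β 1 g).smulRight ((2 : ℝ) • coframe β 2 g)
    + (coframe β 2 g).smulRight ((2 : ℝ) • coframe β 1 g)

theorem tensorφ_apply (g : SL2R) (v : TangentSpace (𝓡 3) g) :
    tensorφ β g v = coframe β 1 g v • frame β 1 g + (-coframe β 2 g v) • frame β 2 g := rfl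

theorem tensorg_apply (g : SL2R) (v w : TangentSpace (𝓡 3) g) :
    tensorg β g v w = coframe β 0 g v * coframe β 0 g w + coframe β 1 g v * (2 * coframe β 2 g w)
      + coframe β 2 g v * (2 * coframe β 1 g w) := rfl

theorem coframe_tensorφ (g : SL2R) (v : TangentSpace (𝓡 3) g) (i : Fin 3) :
    coframe β i g (tensorφ β g v) = ![0, coframe β 1 g v, -coframe β 2 g v] i := by
  rw [tensorφ_apply, map_add, map_smul, map_smul, coframe_frame, coframe_frame]
  fin_cases i <;> simp

theorem finrank_eigenspace_of_coframe {r : ℝ} {g : SL2R} {i : Fin 3}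
    (h : ∀ v : TangentSpace (𝓡 3) g, tensorφ β g v = r • v ↔ v = coframe β i g v • frame β i g) :
    Module.finrank ℝ (Module.End.eigenspace (tensorφ β g).toLinearMap r) = 1 := by
  have hne : frame β i g ≠ 0 := fun h0 ↦ by
    have := coframe_frame β g i i
    rw [h0, map_zero, if_pos rfl] at this
    exact zero_ne_one this
  have hs : Module.End.eigenspace (tensorφ β g).toLinearMap r =
      Submodule.span ℝ {frame β i g} := by
    ext v
    rw [Module.End.mem_eigenspace_iff, Submodule.mem_span_singleton]
    refine (h v).trans ⟨fun h ↦ ⟨_, h.symm⟩, ?_⟩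
    rintro ⟨a, rfl⟩
    rw [map_smul, coframe_frame, if_pos rfl, smul_eq_mul, mul_one]
  rw [hs, finrank_span_singleton hne]

/-- The left-invariant paracontact metric structures on `SL(2, ℝ)`. -/
def structureOf (β : ℝ) : ParacontactMetricStructure SL2R where
  φ := tensorφ β
  ξ := frame β 0
  η := coframe β 0
  g := tensorg β
  φ_smooth g := contMDiffAt_hom_of_smoothVFAt (E := fun g : SL2R ↦ TangentSpace (𝓡 3) g)
    fun X hX ↦ (((smoothVFAt_frame β 1 g).smul (smoothFnAt_coframe 1 hX)).add
      ((smoothVFAt_frame β 2 g).smul ((SmoothFnAt.const (-1)).mul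
        (smoothFnAt_coframe (β := β) 2 hX)))).congr (Filter.Eventually.of_forall fun q ↦ by
          rw [tensorφ_apply, neg_eq_neg_one_mul]; rfl) |>.contMDiffAt
  ξ_smooth g := (smoothVFAt_frame β 0 g).contMDiffAt
  η_smooth g := contMDiffAt_oneForm_of_smoothVFAt fun X hX ↦ (smoothFnAt_coframe 0 hX).contMDiffAt
  g_smooth g := contMDiffAt_bilinearForm_of_smoothVFAt fun X Y hX hY ↦ by
    have h := fun i ↦ smoothFnAt_coframe (β := β) i hX
    have h' := fun i ↦ smoothFnAt_coframe (β := β) i hY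
    exact ((((h 0).mul (h' 0)).add ((h 1).mul ((SmoothFnAt.const 2).mul (h' 2)))).add
      ((h 2).mul ((SmoothFnAt.const 2).mul (h' 1)))).contMDiffAt
  g_symm g v w := by
    rw [tensorg_apply, tensorg_apply]
    ring
  g_nondegenerate g v h := by
    have h0 := h (frame β 0 g)
    have h1 := h (frame β 1 g)
    have h2 := h (frame β 2 g)
    rw [tensorg_apply] at h0 h1 h2
    simp only [coframe_frame] at h0 h1 h2
    simp at h0 h1 h2
    rw [eq_sum_frame β v, h0, h1, h2]
    simp
  φ_ξ g := by
    rw [tensorφ_apply, coframe_frame, coframe_frame]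
    simp
  η_φ g v := coframe_tensorφ g v 0
  η_ξ g := coframe_frame β g 0 0
  φ_φ g v := by
    rw [tensorφ_apply, coframe_tensorφ, coframe_tensorφ]
    conv_rhs => rw [eq_sum_frame β v]
    simp only [map_add, map_smul, coframe_frame]
    simp
    abel
  finrank_eigenspace g := by
    have key : ∀ (r : ℝ) (v : TangentSpace (𝓡 3) g), tensorφ β g v = r • v →
        0 = r * coframe β 0 g v ∧ coframe β 1 g v = r * coframe β 1 g v ∧
          -coframe β 2 g v = r * coframe β 2 g v := fun r v h ↦ by
      have h' := fun i ↦ congrArg (coframe β i g) h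
      simp only [coframe_tensorφ, map_smul] at h'
      exact ⟨h' 0, h' 1, h' 2⟩
    rw [finrank_eigenspace_of_coframe (i := 1), finrank_eigenspace_of_coframe (i := 2)]
    · refine fun v ↦ ⟨fun h ↦ ?_, fun h ↦ ?_⟩
      · obtain ⟨h0, h1, -⟩ := key _ v h
        have h0' : coframe β 0 g v = 0 := by linarith
        have h1' : coframe β 1 g v = 0 := by linarith
        conv_lhs => rw [eq_sum_frame β v, h0', h1']
        module
      · rw [h, map_smul, tensorφ_apply, coframe_frame, coframe_frame]
        simp
    · refine fun v ↦ ⟨fun h ↦ ?_, fun h ↦ ?_⟩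
      · obtain ⟨h0, -, h2⟩ := key _ v h
        have h0' : coframe β 0 g v = 0 := by linarith
        have h2' : coframe β 2 g v = 0 := by linarith
        conv_lhs => rw [eq_sum_frame β v, h0', h2']
        module
      · rw [h, map_smul, tensorφ_apply, coframe_frame, coframe_frame]
        simp
  compatible g v w := by
    rw [tensorg_apply, tensorg_apply]
    simp only [coframe_tensorφ]
    simp
    ring
  paracontact X Y g hX hY := by
    rw [(isFrameAt_frame β g).extDeriv_eq hX hY, tensorg_apply]
    simp only [coframe_tensorφ, mlieBracket_frame, (isFrameAt_frame β g).coeff_sum]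
    simp [Fin.sum_univ_three, adaptedConst]
    ring

theorem structureOf_isLeftInvariant (β : ℝ) : (structureOf β).IsLeftInvariant := by
  refine fun a g ↦ ⟨fun v ↦ ?_, mfderiv_mul_left_frame β 0 a g, coframe_mul_left β 0 a g,
    fun v w ↦ ?_⟩
  · change tensorφ β (a * g) _ = mfderiv (𝓡 3) (𝓡 3) (fun b ↦ a * b) g (tensorφ β g v)
    rw [tensorφ_apply, tensorφ_apply, map_add, map_smul, map_smul, mfderiv_mul_left_frame,
      mfderiv_mul_left_frame, coframe_mul_left, coframe_mul_left]
  · change tensorg β (a * g) _ _ = tensorg β g v w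
    simp only [tensorg_apply, coframe_mul_left]

theorem frame_one (β : ℝ) (i : Fin 3) : frame β i 1 = basisVec β i := mulInvariantVectorField_one _

/-- The vectors `e` and `φe` are the half-sum and half-difference of the two null eigenvectors `e ±
φe`, inverting the change of basis used for normal frames. -/
theorem structureOf_hasBrackets (a₁ : ℝ) : (structureOf (-2 * a₁)).HasBrackets a₁ := by
  set β := -2 * a₁ with hβ
  refine ⟨structureOf_isLeftInvariant β, basisVec β 0,
    (1 / 2 : ℝ) • basisVec β 1 + (1 / 2 : ℝ) • basisVec β 2,
    (1 / 2 : ℝ) • basisVec β 1 + (-(1 / 2) : ℝ) • basisVec β 2, (frame_one β 0).symm, ?_, ?_, ?_,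
    ?_, ?_, ?_⟩
  · rw [← frame_one, ← frame_one]
    change _ = tensorφ β 1 _
    rw [tensorφ_apply]
    simp only [map_add, map_smul, coframe_frame]
    simp
  · rw [← frame_one, ← frame_one]
    change coframe β 0 1 _ = 0
    simp only [map_add, map_smul, coframe_frame]
    simp
  · rw [← frame_one, ← frame_one]
    change tensorg β 1 _ _ = 1
    rw [tensorg_apply]
    simp only [map_add, map_smul, coframe_frame]
    simp
    norm_num
  all_goals
    apply matDeriv_injective
    simp only [matDeriv_bracket, matDeriv_add, matDeriv_smul, matDeriv_basisVec]
    ext i j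
    fin_cases i <;> fin_cases j <;> simp [basisMat, hβ] <;> ring

end SL2R

/-! ### The Maurer-Cartan equation of a frame on `ℝ³` with constant structure functions. -/

section Frobenius

variable {A : Type*} [NormedRing A] [NormedAlgebra ℝ A]
  {e : Fin 3 → Π x : E3, TangentSpace (𝓡 3) x} {θ : Fin 3 → Π x : E3, TangentSpace (𝓡 3) x →L[ℝ] ℝ}
  {x₀ : E3} {c : Fin 3 → Fin 3 → Fin 3 → ℝ} {X : Fin 3 → A}

/-- The one-form `∑ θᵏ Xₖ` with values in an algebra. -/
def frameForm (θ : Fin 3 → Π x : E3, TangentSpace (𝓡 3) x →L[ℝ] ℝ) (X : Fin 3 → A) (x : E3) :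
    E3 →L[ℝ] A :=
  ∑ k, ContinuousLinearMap.smulRight (show E3 →L[ℝ] ℝ from θ k x) (X k)

theorem frameForm_apply (x v : E3) : frameForm θ X x v = ∑ k, θ k x v • X k := by
  simp only [frameForm, sum_apply]
  rfl

/-- The constant vector fields on `ℝ³`. -/
def constField (v : E3) : Π x : E3, TangentSpace (𝓡 3) x := fun _ ↦ v

theorem smoothVFAt_constField (v x : E3) : SmoothVFAt (constField v) x :=
  Filter.Eventually.of_forall fun _ ↦ contMDiffAt_vectorSpace_iff_contDiffAt.2 contDiffAt_const

theorem mlieBracket_constField (u v x : E3) :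
    mlieBracket (𝓡 3) (constField u) (constField v) x = 0 := by
  have : mlieBracket (𝓡 3) (constField u) (constField v) x =
      lieBracket ℝ (fun _ : E3 ↦ u) (fun _ ↦ v) x := by
    rw [← mlieBracketWithin_univ, ← lieBracketWithin_univ]
    exact congrFun mlieBracketWithin_eq_lieBracketWithin x
  rw [this, lieBracket]
  simp
  rfl

theorem mvfderiv_eq (f : E3 → ℝ) (x v : E3) : mvfderiv (𝓡 3) f x v = fderiv ℝ f x v :=
  congrArg (fun L : E3 →L[ℝ] ℝ ↦ L v) (mfderiv_eq_fderiv (f := f) (x := x))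

theorem IsFrameAt.contDiffAt_coeff (h : IsFrameAt e θ x₀) (k : Fin 3) (v : E3) :
    ContDiffAt ℝ ∞ (fun x ↦ θ k x v) x₀ :=
  (h.smoothFnAt_coeff k (smoothVFAt_constField v x₀)).contMDiffAt.contDiffAt

theorem IsFrameAt.contDiffAt_frameForm (h : IsFrameAt e θ x₀) (X : Fin 3 → A) :
    ContDiffAt ℝ ∞ (frameForm θ X) x₀ := by
  refine (contMDiffAt_clm_of_basis fun i ↦ ContDiffAt.contMDiffAt ?_).contDiffAt
  simp only [frameForm_apply]
  exact ContDiffAt.sum fun k _ ↦ (h.contDiffAt_coeff k _).smul contDiffAt_const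

theorem IsFrameAt.fderiv_frameForm (h : IsFrameAt e θ x₀) (X : Fin 3 → A) (u v : E3) :
    fderiv ℝ (frameForm θ X) x₀ u v = ∑ k, fderiv ℝ (fun x ↦ θ k x v) x₀ u • X k := by
  have hd := (h.contDiffAt_frameForm X).differentiableAt (by simp)
  have h1 : HasFDerivAt (fun x ↦ frameForm θ X x v)
      ((ContinuousLinearMap.apply ℝ A v).comp (fderiv ℝ (frameForm θ X) x₀)) x₀ :=
    (ContinuousLinearMap.apply ℝ A v).hasFDerivAt.comp x₀ hd.hasFDerivAt
  have h2 : HasFDerivAt (fun x ↦ frameForm θ X x v)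
      (∑ k, (fderiv ℝ (fun x ↦ θ k x v) x₀).smulRight (X k)) x₀ := by
    simp only [frameForm_apply]
    exact HasFDerivAt.fun_sum fun k _ ↦
      ((h.contDiffAt_coeff k v).differentiableAt (by simp)).hasFDerivAt.smul_const (X k)
  have := congrArg (fun L ↦ L u) (h1.unique h2)
  simpa using this

/-- Duality turns the structure constants of the frame into `dθᵏ = -½ ∑ cᵢⱼᵏ θⁱ ∧ θʲ`; as the `Xₖ`
have the same structure constants, `d(∑ θᵏ Xₖ)` cancels the commutator term. -/
theorem IsFrameAt.frameForm_flat (h : IsFrameAt e θ x₀) (hc : HasStructureConstantsAt e c x₀)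
    (hX : ∀ i j, X i * X j - X j * X i = ∑ k, c i j k • X k) (u v : E3) :
    fderiv ℝ (frameForm θ X) x₀ u v + frameForm θ X x₀ u * frameForm θ X x₀ v =
      fderiv ℝ (frameForm θ X) x₀ v u + frameForm θ X x₀ v * frameForm θ X x₀ u := by
  have h1 : ∀ k, fderiv ℝ (fun x ↦ θ k x v) x₀ u - fderiv ℝ (fun x ↦ θ k x u) x₀ v =
      -∑ i, ∑ j, θ i x₀ u * θ j x₀ v * c i j k := by
    intro k
    -- Constant fields commute, so for them the exterior derivative is just the antisymmetrised
    -- derivative of the coefficients.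
    have h2 := h.extDeriv_eq (smoothVFAt_constField u x₀).mdiffAt
      (smoothVFAt_constField v x₀).mdiffAt k
    rw [mlieBracket_constField, map_zero, sub_zero] at h2
    simp only [hc.self_of_nhds, h.coeff_sum] at h2
    rw [← mvfderiv_eq, ← mvfderiv_eq]
    exact h2
  have h3 : fderiv ℝ (frameForm θ X) x₀ u v - fderiv ℝ (frameForm θ X) x₀ v u =
      -∑ i, ∑ j, (θ i x₀ u * θ j x₀ v) • (X i * X j - X j * X i) := by
    rw [h.fderiv_frameForm, h.fderiv_frameForm, ← Finset.sum_sub_distrib]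
    simp only [← sub_smul, h1, hX]
    simp only [Finset.smul_sum, neg_smul, Finset.sum_neg_distrib, Finset.sum_smul, smul_smul]
    congr 1
    rw [Finset.sum_comm]
    refine Finset.sum_congr rfl fun i _ ↦ ?_
    rw [Finset.sum_comm]
  have h4 : ∀ u v : E3, frameForm θ X x₀ u * frameForm θ X x₀ v =
      ∑ i, ∑ j, (θ i x₀ u * θ j x₀ v) • (X i * X j) := by
    intro u v
    rw [frameForm_apply, frameForm_apply, Finset.sum_mul]
    refine Finset.sum_congr rfl fun i _ ↦ ?_
    rw [Finset.mul_sum]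
    exact Finset.sum_congr rfl fun j _ ↦ by rw [smul_mul_smul_comm]
  have h5 : frameForm θ X x₀ v * frameForm θ X x₀ u =
      ∑ i, ∑ j, (θ i x₀ u * θ j x₀ v) • (X j * X i) := by
    rw [h4, Finset.sum_comm]
    exact Finset.sum_congr rfl fun i _ ↦ Finset.sum_congr rfl fun j _ ↦ by rw [mul_comm]
  rw [← sub_eq_zero, add_sub_add_comm, h3, h4, h5, ← Finset.sum_sub_distrib]
  simp only [← Finset.sum_sub_distrib, ← smul_sub]
  exact neg_add_cancel _

/-- The equation `df = f ∑ θᵏ Xₖ` is solvable if the structure functions of the frame are the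
structure constants of the elements `Xₖ`. -/
theorem IsFrameAt.exists_hasFDerivAt [CompleteSpace A] (h : IsFrameAt e θ x₀)
    (hc : HasStructureConstantsAt e c x₀)
    (hX : ∀ i j, X i * X j - X j * X i = ∑ k, c i j k • X k) :
    ∃ r > 0, ∃ f : E3 → A, f x₀ = 1 ∧ ContDiffOn ℝ ∞ f (Metric.ball x₀ r) ∧
      ∀ x ∈ Metric.ball x₀ r,
        HasFDerivAt f ((ContinuousLinearMap.mul ℝ A (f x)).comp (frameForm θ X x)) x := by
  obtain ⟨r₁, hr₁, H₁⟩ := exists_hasFDerivAt_of_flat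
    ((h.contDiffAt_frameForm X).of_le (WithTop.coe_le_coe.2 le_top)) (by
      filter_upwards [h.eventually, hc.eventually_nhds] with x hx hcx
      exact hx.frameForm_flat hcx hX)
  obtain ⟨r₂, hr₂, H₂⟩ := Metric.eventually_nhds_iff_ball.1 h.eventually
  obtain ⟨f, hf1, hf⟩ := H₁ 1
  have hf' : ∀ x ∈ Metric.ball x₀ (min r₁ r₂),
      HasFDerivAt f ((ContinuousLinearMap.mul ℝ A (f x)).comp (frameForm θ X x)) x := fun x hx ↦
    hf x (Metric.ball_subset_ball (min_le_left _ _) hx)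
  refine ⟨min r₁ r₂, lt_min hr₁ hr₂, f, hf1, contDiffOn_of_hasFDerivAt_mul Metric.isOpen_ball
    (fun x hx ↦ ?_) hf', hf'⟩
  exact ((H₂ x (Metric.ball_subset_ball (min_le_right _ _) hx)).contDiffAt_frameForm
    X).contDiffWithinAt

end Frobenius

/-! ### Local diffeomorphisms from the inverse function theorem. -/

section InverseFunction

variable {N : Type*} [TopologicalSpace N] [ChartedSpace E3 N] [IsManifold (𝓡 3) ∞ N]

theorem isLocalDiffeo_chartAt (p : N) : IsLocalDiffeo (chartAt E3 p) :=
  ⟨contMDiffOn_chart, contMDiffOn_chart_symm⟩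

/-- The inverse function theorem. -/
theorem exists_isLocalDiffeo {G : E3 → N} {x₀ : E3}
    (hG : ∀ᶠ x in 𝓝 x₀, ContMDiffAt (𝓡 3) (𝓡 3) ∞ G x ∧
      (mfderiv (𝓡 3) (𝓡 3) G x).IsInvertible) :
    ∃ F : OpenPartialHomeomorph E3 N, x₀ ∈ F.source ∧ IsLocalDiffeo F ∧
      ∀ x ∈ F.source, F x = G x := by
  set ψ := chartAt E3 (G x₀) with hψ
  have hψd : IsLocalDiffeo ψ := isLocalDiffeo_chartAt _
  have hGψ : ∀ᶠ x in 𝓝 x₀, G x ∈ ψ.source :=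
    hG.self_of_nhds.1.continuousAt.eventually (eventually_mem_source (mem_chart_source E3 _))
  obtain ⟨U, hU, hUo, hx₀⟩ := eventually_nhds_iff.1 (hG.and hGψ)
  have hH : ∀ x ∈ U, ContDiffAt ℝ ∞ (ψ ∘ G) x := fun x hx ↦
    ((hψd.contMDiffAt (hU x hx).2).comp x (hU x hx).1.1).contDiffAt
  have hH' : ∀ x ∈ U, (fderiv ℝ (ψ ∘ G) x).IsInvertible := fun x hx ↦ by
    have h1 := mfderiv_comp x ((hψd.contMDiffAt (hU x hx).2).mdifferentiableAt (by simp))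
      ((hU x hx).1.1.mdifferentiableAt (by simp))
    have h2 := (hψd.isInvertible (hU x hx).2).comp (hU x hx).1.2
    rw [← h1, mfderiv_eq_fderiv] at h2
    exact h2
  have hder : ∀ x ∈ U, ∃ L : E3 ≃L[ℝ] E3, HasFDerivAt (ψ ∘ G) (L : E3 →L[ℝ] E3) x :=
    fun x hx ↦ by
      obtain ⟨L, hL⟩ := hH' x hx
      exact ⟨L, hL ▸ ((hH x hx).differentiableAt (by simp)).hasFDerivAt⟩
  obtain ⟨L, hL⟩ := hder x₀ hx₀
  -- Restricting to `U` keeps the derivative invertible at every point of the source, which makes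
  -- the inverse smooth on the whole target and not only at the image of `x₀`.
  set F₀ := ((hH x₀ hx₀).toOpenPartialHomeomorph (ψ ∘ G) hL (by simp)).restrOpen U hUo with hF₀
  have hF₀s : F₀.source ⊆ U := fun x hx ↦ hx.2
  have hF₀x : ∀ x, F₀ x = ψ (G x) := fun x ↦ rfl
  have hF₀d : IsLocalDiffeo F₀ := by
    constructor
    · exact fun x hx ↦ (hH x (hF₀s hx)).contMDiffAt.contMDiffWithinAt
    · intro y hy
      have hy' := F₀.map_target hy
      obtain ⟨L, hL⟩ := hder _ (hF₀s hy')
      exact (F₀.contDiffAt_symm hy hL (hH _ (hF₀s hy'))).contMDiffAt.contMDiffWithinAt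
  refine ⟨F₀.trans ψ.symm, ?_, hF₀d.trans hψd.symm, fun x hx ↦ ?_⟩
  · rw [OpenPartialHomeomorph.trans_source]
    exact ⟨⟨(hH x₀ hx₀).mem_toOpenPartialHomeomorph_source hL (by simp), hx₀⟩,
      ψ.map_source (hU x₀ hx₀).2⟩
  · rw [OpenPartialHomeomorph.trans_source] at hx
    exact ψ.left_inv (hU x (hF₀s hx.1)).2

end InverseFunction

/-! ### Developing a frame on `ℝ³` into `SL(2, ℝ)`. -/

namespace SL2R

variable {e : Fin 3 → Π x : E3, TangentSpace (𝓡 3) x} {θ : Fin 3 → Π x : E3, TangentSpace (𝓡 3) x →L[ℝ] ℝ}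
  {x₀ : E3} {β : ℝ}

section Solution

attribute [local instance] Matrix.linftyOpNormedRing Matrix.linftyOpNormedAlgebra

/-- The matrix entries as continuous linear forms. -/
def entryCLM (i j : Fin 2) : Matrix (Fin 2) (Fin 2) ℝ →L[ℝ] ℝ :=
  LinearMap.toContinuousLinearMap (Matrix.entryLinearMap ℝ ℝ i j)

/-- Solutions of `df = f Ω` with a trace-free form `Ω` have constant determinant. -/
theorem det_eq_one_of_hasFDerivAt {f : E3 → Matrix (Fin 2) (Fin 2) ℝ}
    {Ω : E3 → E3 →L[ℝ] Matrix (Fin 2) (Fin 2) ℝ} {r : ℝ} (hr : 0 < r) (h1 : f x₀ = 1)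
    (hf : ∀ x ∈ Metric.ball x₀ r,
      HasFDerivAt f ((ContinuousLinearMap.mul ℝ (Matrix (Fin 2) (Fin 2) ℝ) (f x)).comp (Ω x)) x)
    (hΩ : ∀ x v, (Ω x v).trace = 0) {x : E3} (hx : x ∈ Metric.ball x₀ r) : (f x).det = 1 := by
  -- By Jacobi's formula `d(det f) = det f · tr Ω = 0`, and the ball is convex.
  have hd : ∀ x ∈ Metric.ball x₀ r,
      HasFDerivAt (fun x ↦ f x 0 0 * f x 1 1 - f x 0 1 * f x 1 0) (0 : E3 →L[ℝ] ℝ) x := by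
    intro x hx
    obtain ⟨D, hD, hDv⟩ : ∃ D : Fin 2 → Fin 2 → E3 →L[ℝ] ℝ,
        (∀ i j, HasFDerivAt (fun x ↦ f x i j) (D i j) x) ∧
        ∀ i j v, D i j v = f x i 0 * Ω x v 0 j + f x i 1 * Ω x v 1 j := by
      refine ⟨_, fun i j ↦ (entryCLM i j).hasFDerivAt.comp x (hf x hx), fun i j v ↦ ?_⟩
      change (f x * Ω x v) i j = _
      rw [Matrix.mul_apply, Fin.sum_univ_two]
    refine (((hD 0 0).mul (hD 1 1)).sub ((hD 0 1).mul (hD 1 0))).congr_fderiv ?_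
    ext v
    have ht := hΩ x v
    rw [Matrix.trace_fin_two] at ht
    simp only [sub_apply, add_apply, smul_apply, smul_eq_mul, hDv, zero_apply]
    linear_combination (f x 0 0 * f x 1 1 - f x 0 1 * f x 1 0) * ht
  have := (convex_ball x₀ r).is_const_of_fderivWithin_eq_zero (𝕜 := ℝ)
    (fun x hx ↦ (hd x hx).differentiableAt.differentiableWithinAt)
    (fun x hx ↦ (hd x hx).hasFDerivWithinAt.fderivWithin
      (Metric.isOpen_ball.uniqueDiffWithinAt hx)) hx (Metric.mem_ball_self hr)
  rw [Matrix.det_fin_two, this, h1]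
  simp

/-- A frame on `ℝ³` with the structure constants of `frame β` is locally the pullback of
`frame β`. -/
theorem exists_mfderiv_eq_frame (h : IsFrameAt e θ x₀)
    (hc : HasStructureConstantsAt e (adaptedConst 1 2 0 β 0 0) x₀) :
    ∃ G : E3 → SL2R, ∀ᶠ x in 𝓝 x₀, ContMDiffAt (𝓡 3) (𝓡 3) ∞ G x ∧
      ∀ i, mfderiv (𝓡 3) (𝓡 3) G x (e i x) = frame β i (G x) := by
  have : CompleteSpace (Matrix (Fin 2) (Fin 2) ℝ) := FiniteDimensional.complete ℝ _
  obtain ⟨r, hr, f, h1, hfs, hf⟩ := h.exists_hasFDerivAt hc (basisMat_commutator β)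
  have hdet : ∀ x ∈ Metric.ball x₀ r, (f x).det = 1 := fun x hx ↦
    det_eq_one_of_hasFDerivAt hr h1 hf (fun x v ↦ by
      refine (congrArg Matrix.trace (frameForm_apply x v)).trans ?_
      rw [Matrix.trace_sum]
      simp [basisMat_trace]) hx
  -- The default value `1` plays no role: on the ball the determinant of `f` is `1`.
  let G : E3 → SL2R := fun x ↦ open scoped Classical in
    if h : (f x).det = 1 then ⟨f x, h⟩ else 1
  have hG : ∀ x ∈ Metric.ball x₀ r, (G x).1 = f x := fun x hx ↦
    congrArg Subtype.val (dif_pos (hdet x hx))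
  have hGe : ∀ i j, ∀ x ∈ Metric.ball x₀ r,
      (fun y ↦ entry i j (G y)) =ᶠ[𝓝 x] fun y ↦ f y i j := fun i j x hx ↦ by
    filter_upwards [Metric.isOpen_ball.mem_nhds hx] with y hy
    exact congrFun (congrFun (hG y hy) i) j
  have hGs : ∀ x ∈ Metric.ball x₀ r, ContMDiffAt (𝓡 3) (𝓡 3) ∞ G x := fun x hx ↦
    contMDiffAt_of_entry fun i j ↦ (((entryCLM i j).contDiff.contDiffAt.comp x
      (hfs.contDiffAt (Metric.isOpen_ball.mem_nhds hx))).contMDiffAt).congr_of_eventuallyEq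
        (hGe i j x hx)
  refine ⟨G, ?_⟩
  filter_upwards [Metric.ball_mem_nhds x₀ hr, h.eventually] with x hx hfr
  refine ⟨hGs x hx, fun k ↦ matDeriv_injective ?_⟩
  -- Evaluating `df = f Ω` on `eₖ` gives `f Xₖ`, which is the matrix of the left-invariant field
  -- with matrix `Xₖ` at the identity.
  have hΩ : frameForm θ (basisMat β) x (e k x) = basisMat β k := by
    refine (frameForm_apply x (e k x)).trans ?_
    simp [hfr.dual_apply]
  rw [matDeriv_frame, hG x hx, ← hΩ]
  ext i j
  refine (mvfderiv_entry_comp ((hGs x hx).mdifferentiableAt (by simp)) (e k x) i j).trans ?_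
  rw [mvfderiv_congr (hGe i j x hx)]
  refine (mvfderiv_eq _ x (e k x)).trans ?_
  have hij := ((entryCLM i j).hasFDerivAt.comp x (hf x hx)).fderiv
  exact congrArg (fun L ↦ L (e k x)) hij

end Solution

theorem isInvertible_of_frame {x : E3} {L : E3 →L[ℝ] E3} {g : SL2R}
    (hL : ∀ i, (show TangentSpace (𝓡 3) g from L (e i x)) = frame β i g) : L.IsInvertible := by
  have hs : Function.Surjective L.toLinearMap := fun w ↦ by
    refine ⟨∑ i, coframe β i g w • (show E3 from e i x), ?_⟩
    rw [map_sum]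
    refine Eq.trans ?_ ((isFrameAt_frame β g).eq_sum w).symm
    refine Finset.sum_congr rfl fun i _ ↦ ?_
    rw [map_smul]
    exact congrArg (fun v : E3 ↦ coframe β i g w • v) (hL i)
  have hi : Function.Injective L.toLinearMap :=
    (LinearMap.injective_iff_surjective_of_finrank_eq_finrank (V := E3) (V₂ := E3) rfl).2 hs
  exact ⟨(LinearEquiv.ofBijective L.toLinearMap ⟨hi, hs⟩).toContinuousLinearEquiv, by ext v; rfl⟩

theorem exists_isLocalDiffeo_of_isFrameAt (h : IsFrameAt e θ x₀)
    (hc : HasStructureConstantsAt e (adaptedConst 1 2 0 β 0 0) x₀) :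
    ∃ F : OpenPartialHomeomorph E3 SL2R, x₀ ∈ F.source ∧ IsLocalDiffeo F ∧
      ∀ᶠ x in 𝓝 x₀, ∀ i, mfderiv (𝓡 3) (𝓡 3) F x (e i x) = frame β i (F x) := by
  obtain ⟨G, hG⟩ := exists_mfderiv_eq_frame h hc
  obtain ⟨F, hx₀, hF, hFG⟩ := exists_isLocalDiffeo (hG.mono fun x hx ↦
    ⟨hx.1, isInvertible_of_frame hx.2⟩)
  refine ⟨F, hx₀, hF, ?_⟩
  filter_upwards [hG, eventually_mem_source hx₀] with x hx hxF i
  have hev : F =ᶠ[𝓝 x] G := (eventually_mem_source hxF).mono hFG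
  have h1 : mfderiv (𝓡 3) (𝓡 3) F x (e i x) = frame β i (G x) := by
    rw [← hx.2 i, hev.mfderiv_eq]
    rfl
  have : ∀ (a b : SL2R) (_ : a = b), (show E3 from frame β i a) = frame β i b := by
    rintro a _ rfl
    rfl
  exact h1.trans (this _ _ (hFG x hxF).symm)

end SL2R

/-! ### Local isometry with `SL(2, ℝ)` and its converse. -/

section LocalIsometry

open SL2R

variable {M : Type*} [TopologicalSpace M] [ChartedSpace E3 M] [IsManifold (𝓡 3) ∞ M]
  {S : ParacontactMetricStructure M} {β : ℝ} {p : M}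

/-- A map that carries an adapted frame to the invariant frame preserves the structure tensors. -/
theorem preservesAt_of_frame {E₁ E₂ : Π q : M, TangentSpace (𝓡 3) q} {f : M → SL2R}
    (hE : IsAdaptedAt S 1 E₁ E₂ p)
    (hf : ∀ i, mfderiv (𝓡 3) (𝓡 3) f p (adaptedFrame S E₁ E₂ i p) = frame β i (f p)) :
    PreservesAt S (structureOf β) f p := by
  have hv : ∀ v, v = S.η p v • S.ξ p + (1 / 2 * S.g p (E₂ p) v) • E₁ p
      + (1 / 2 * S.g p (E₁ p) v) • E₂ p := fun v ↦ by
    conv_lhs => rw [hE.isFrameAt.eq_sum v, Fin.sum_univ_three]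
    rfl
  have h0 : mfderiv (𝓡 3) (𝓡 3) f p (S.ξ p) = frame β 0 (f p) := hf 0
  have h1 : mfderiv (𝓡 3) (𝓡 3) f p (E₁ p) = frame β 1 (f p) := hf 1
  have h2 : mfderiv (𝓡 3) (𝓡 3) f p (E₂ p) = frame β 2 (f p) := hf 2
  have hθ : ∀ i v, coframe β i (f p) (mfderiv (𝓡 3) (𝓡 3) f p v) =
      ![S.η p v, 1 / 2 * S.g p (E₂ p) v, 1 / 2 * S.g p (E₁ p) v] i := fun i v ↦ by
    conv_lhs => rw [hv v]
    simp only [map_add, map_smul, h0, h1, h2, coframe_frame]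
    fin_cases i <;> simp
  refine ⟨fun v ↦ ?_, h0, hθ 0, fun v w ↦ ?_⟩
  · change tensorφ β (f p) _ = _
    rw [tensorφ_apply, hθ, hθ]
    conv_rhs => rw [hv v]
    simp only [map_add, map_smul, S.φ_ξ, hE.φ₁, hE.φ₂, map_zero, h1, h2]
    simp
  · change tensorg β (f p) _ _ = _
    rw [tensorg_apply]
    simp only [hθ]
    conv_rhs => rw [hv v]
    simp only [map_add, map_smul, add_apply, smul_apply, S.g_ξ, smul_eq_mul]
    simp

/-- A structure with a normal frame is locally isometric to `structureOf β`. -/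
theorem HasNormalFrameAt.exists_isLocalEquiv (h : HasNormalFrameAt S β p) :
    ∃ F : OpenPartialHomeomorph M SL2R, p ∈ F.source ∧ IsLocalEquiv S (structureOf β) F := by
  obtain ⟨E₁, E₂, hE, hc⟩ := h
  -- The development into `SL(2, ℝ)` is constructed on `ℝ³`, so the adapted frame is first moved
  -- there by a chart.
  set χ := chartAt E3 p
  have hχ : IsLocalDiffeo χ := isLocalDiffeo_chartAt p
  have hp : p ∈ χ.source := mem_chart_source E3 p
  have hp' := χ.map_source hp
  have hE' : IsAdaptedAt S 1 E₁ E₂ (χ.symm (χ p)) := by rwa [χ.left_inv hp]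
  have hc' : HasStructureConstantsAt (adaptedFrame S E₁ E₂) (adaptedConst 1 2 0 β 0 0)
      (χ.symm (χ p)) := by rwa [χ.left_inv hp]
  obtain ⟨F, hF0, hF, hFe⟩ := exists_isLocalDiffeo_of_isFrameAt
    (hχ.symm.isFrameAt hp' hE'.isFrameAt)
    (hχ.symm.hasStructureConstantsAt hp' hE'.isFrameAt.smooth hc')
  have hpres : ∀ᶠ q in 𝓝 p, PreservesAt S (structureOf β) (χ.trans F) q := by
    have hpt : p ∈ (χ.trans F).source := by
      rw [OpenPartialHomeomorph.trans_source]
      exact ⟨hp, hF0⟩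
    filter_upwards [hE.eventually, eventually_mem_source hpt, eventually_mem_source hp,
      (χ.continuousAt hp).eventually hFe] with q hq hqs hqχ hqF
    refine preservesAt_of_frame hq fun i ↦ ?_
    rw [hχ.mfderiv_trans hF hqs]
    refine Eq.trans (congrArg _ ?_) (hqF i)
    apply (hχ.symm.isInvertible (χ.map_source hqχ)).injective
    rw [hχ.symm.mfderiv_mpullback (χ.map_source hqχ)]
    have h1 := congrArg (fun L ↦ L (adaptedFrame S E₁ E₂ i q))
      (hχ.mdifferentiable.symm_comp_deriv hqχ)
    refine Eq.trans h1 ?_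
    have : ∀ (a b : M) (_ : a = b), (show E3 from adaptedFrame S E₁ E₂ i a) =
        adaptedFrame S E₁ E₂ i b := by
      rintro a _ rfl
      rfl
    exact this _ _ (χ.left_inv hqχ).symm
  -- The composite matches the frames only near `p`, hence the final restriction to an open `U` on
  -- which all structure tensors are preserved.
  obtain ⟨U, hU, hUo, hpU⟩ := eventually_nhds_iff.1 hpres
  refine ⟨(χ.trans F).restrOpen U hUo, ⟨⟨hp, hF0⟩, hpU⟩, ⟨?_, ?_⟩, fun q hq ↦ hU q hq.2⟩
  · exact (hχ.trans hF).contMDiffOn.mono fun x hx ↦ hx.1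
  · exact (hχ.trans hF).contMDiffOn_symm.mono fun x hx ↦ hx.1

/-- A normal frame at one point suffices: an automorphism takes any `q` to `p`, and composing it
with the local isometry at `p` gives one at `q`. -/
theorem ParacontactMetricStructure.IsHomogeneous.isLocallyIsometricTo (hS : S.IsHomogeneous)
    (h : HasNormalFrameAt S β p) : S.IsLocallyIsometricTo (structureOf β) := by
  intro q
  obtain ⟨F, hF, hF'⟩ := h.exists_isLocalEquiv
  obtain ⟨H, hq, rfl, hH⟩ := hS.exists_isLocalEquiv q p
  have := hH.trans hF'
  exact ⟨H.trans F, ⟨hq, hF⟩, this.contMDiffOn, this.contMDiffOn_symm, this.preserves⟩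

theorem ParacontactMetricStructure.IsLocallyIsometricTo.isNontrivialRicciSoliton [Nonempty M]
    {S₀ : ParacontactMetricStructure SL2R} {a₁ : ℝ} (ha₁ : a₁ ≠ 0) (h₀ : S₀.HasBrackets a₁)
    (h : S.IsLocallyIsometricTo S₀) : S.IsNontrivialRicciSoliton := by
  refine isNontrivialRicciSoliton_of_hasNormalFrameAt (β := -2 * a₁) (by simpa using ha₁)
    fun p ↦ ?_
  obtain ⟨F, hp, h1, h2, h3⟩ := h p
  exact IsLocalEquiv.hasNormalFrameAt ⟨⟨h1, h2⟩, h3⟩ hp (h₀.hasNormalFrameAt (F p))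

end LocalIsometry

end ParacontactGeometry

end

theorem mainTheorem3 :
    (∀ a₁ : ℝ, a₁ ≠ 0 →
      ∃ S₀ : ParacontactGeometry.ParacontactMetricStructure ParacontactGeometry.SL2R,
        S₀.HasBrackets a₁) ∧
    ∀ (M : Type*) [TopologicalSpace M] [T2Space M] [SecondCountableTopology M] [ConnectedSpace M]
      [ChartedSpace ParacontactGeometry.E3 M] [IsManifold (𝓡 3) ∞ M]
      (S : ParacontactGeometry.ParacontactMetricStructure M), S.IsHomogeneous →
      (S.IsNontrivialRicciSoliton ↔
        ∃ a₁ : ℝ, a₁ ≠ 0 ∧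
          ∃ S₀ : ParacontactGeometry.ParacontactMetricStructure ParacontactGeometry.SL2R,
            S₀.HasBrackets a₁ ∧ S.IsLocallyIsometricTo S₀) := by
  refine ⟨fun a₁ _ ↦ ⟨_, ParacontactGeometry.SL2R.structureOf_hasBrackets a₁⟩, ?_⟩
  intro M _ _ _ _ _ _ S hS
  constructor
  · intro hsol
    obtain ⟨β, p, hβ, hN⟩ := hS.exists_hasNormalFrameAt hsol
    obtain ⟨a₁, rfl⟩ : ∃ a₁, β = -2 * a₁ := ⟨-β / 2, by ring⟩
    exact ⟨a₁, by simpa using hβ, _, ParacontactGeometry.SL2R.structureOf_hasBrackets a₁,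
      hS.isLocallyIsometricTo hN⟩
  · rintro ⟨a₁, ha₁, S₀, h₀, h⟩
    -- The point of `M` needed to exclude Einstein metrics comes from connectedness, which includes
    -- nonemptiness.
    exact h.isNontrivialRicciSoliton ha₁ h₀
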